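/- **Setting.** Let $\mathbb{R}^p$ carry the Euclidean norm and $\mathbb{R}^q$ an arbitrary norm $\|\cdot\|$ with dual norm $\|\cdot\|_*$. Consider $\min_x\psi(x)$, $\psi(x):=\max_{y}\{f(x,y)-r(y)\}+g(x)$, where $f=\frac1n\sum_{i=1}^n f_i$, $n\ge1$, and $g,r$ are proper, closed, extended-valued ($+\infty$ allowed); $\mathcal X:=\mathrm{dom}\,g$, $\mathcal Y:=\mathrm{dom}\,r$. $\partial$ is the Fréchet subdifferential. Let $d_y$ be a distance generating function on $\mathcal Y$: convex and closed (lower semicontinuous) on $\mathcal Y$, and continuously differentiable and $1$-strongly convex with respect to $\|\cdot\|$ on $\mathcal Y^o=\{y\in\mathcal Y:\partial d_y(y)\ne\emptyset\}$; $V_y(y,y')=d_y(y)-d_y(y')-\langle\nabla d_y(y'),y-y'\rangle$. **Assumptions.** (1) For $y\in\mathcal Y$, $f(\cdot,y)$ is $\rho$-weakly convex on $\mathcal X$ ($\rho>0$), i.e. $f(x,y)\ge f(x',y)+\zeta^\top(x-x')-\frac\rho2\|x-x'\|_2^2$ for $x,x'\in\mathcal X$, $\zeta\in\partial_xf(x',y)$;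 for $x\in\mathcal X$, $f(x,\cdot)$ is concave on $\mathcal Y$; $g$ is convex; $r$ is convex and $\mu$-strongly convex with respect to $V_y$ ($\mu\ge0$), i.e. $r(y)\ge r(y')+\zeta^\top(y-y')+\mu V_y(y,y')$ for $y\in\mathcal Y$, $y'\in\mathcal Y^o$, $\zeta\in\partial r(y')$; $\psi^*:=\inf\psi>-\infty$. (2) Each $f_i$ is differentiable and, on $\mathcal X\times\mathcal Y$ with the distance $(\|x-x'\|_2^2+\|y-y'\|^2)^{1/2}$, $\nabla_xf_i$ is $L_x$-Lipschitz (in $\|\cdot\|_2$) and $\nabla_yf_i$ is $L_y$-Lipschitz (in $\|\cdot\|_*$), $L_x,L_y\ge0$ not both $0$. (3) $D_x:=\sup_{x,x'\in\mathcal X}\|x-x'\|_2<\infty$; $d_y$ attains its minimum on $\mathcal Y$ and $D_y:=\sqrt{2\sup_{\mathcal Y}d_y-2\min_{\mathcal Y}d_y}<\infty$. **Algorithm.** Let $\gamma=1/(2\rho)$ and $\mu_x=1/\gamma-\rho$, and fix $c\ge4/3$. PG-SVRG starts at $\bar x^{(0)}\in\mathcal X$ and for $t=0,\dots,T-2$ sets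 $\bar x^{(t+1)}=\mathrm{SVRG}(\bar x^{(t)},k_t,\lambda_t)$, where $\lambda_t=+\infty$ (so $1/\lambda_t=0$) if $\mu>0$ and $\lambda_t=t+2$ if $\mu=0$; $\mu_y^t=\frac1{\lambda_t}+\mu$; $\Lambda_t=52\max\{L_x^2,L_y^2\}/\min\{\mu_x^2,(\mu_y^t)^2\}$; and $$k_t=\max\Big\{2,\Big\lceil1+c\log\big[(t+1)^2(\tfrac4{\gamma\mu_x}+1)(\tfrac14+\tfrac{\Lambda_t}2)(\mu_xD_x^2+\mu_y^tD_y^2)\big]\Big\rceil\Big\}.$$ (If the bracket is $0$, take $k_t=2$.) $\mathrm{SVRG}(\bar x,K,\lambda)$: let $\mu_y=\frac1\lambda+\mu$, $\Lambda=52\max\{L_x^2,L_y^2\}/\min\{\mu_x^2,\mu_y^2\}$, $\eta_x=\frac1{\mu_x\Lambda}$, $\eta_y=\frac1{\mu_y\Lambda}$, $J=\lceil1+(\frac32+3\Lambda)\log4\rceil$, $\bar y=\arg\min_{\mathcal Y}d_y$, $(\hat x^{(0)},\hat y^{(0)})=(\bar x,\bar y)$. For $k=0,\dots,K-2$: compute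 $\nabla_xf,\nabla_yf$ at $(\hat x^{(k)},\hat y^{(k)})$, set $(x^{(0)},y^{(0)})=(\hat x^{(k)},\hat y^{(k)})$, and for $j=0,\dots,J-2$ sample $l$ uniformly from $\{1,\dots,n\}$ (independently of everything before), form $g_x^{(j)}=\nabla_xf(\hat x^{(k)},\hat y^{(k)})-\nabla_xf_l(\hat x^{(k)},\hat y^{(k)})+\nabla_xf_l(x^{(j)},y^{(j)})$ and $g_y^{(j)}$ likewise, and set $$x^{(j+1)}=\arg\min_x\{x^\top g_x^{(j)}+\tfrac1{2\eta_x}\|x-x^{(j)}\|_2^2+\tfrac1{2\gamma}\|x-\bar x\|_2^2+g(x)\},$$ $$y^{(j+1)}=\arg\min_y\{-y^\top g_y^{(j)}+\tfrac1{\eta_y}V_y(y,y^{(j)})+\tfrac1\lambda V_y(y,\bar y)+r(y)\};$$ then $(\hat x^{(k+1)},\hat y^{(k+1)})=(x^{(J-1)},y^{(J-1)})$. Return $\hat x^{(K-1)}$. The output of PG-SVRG is $\bar x^{(\tau)}$ with $\tau$ uniform on $\{0,\dots,T-1\}$, independent of all samples. The complexity counts one unit for every inner iteration and $n$ units for every full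 gradient. **Theorem.** Let $\Delta\in\mathbb{R}$. There are constants $C$ and $a\in\mathbb N$ depending only on $\rho,\mu,L_x,L_y,D_x,D_y,\Delta,c$ (in particular not on $n,p,q$) such that for every $\epsilon\in(0,1]$ there is an integer $1\le T\le C\epsilon^{-2}(1+\log\frac1\epsilon)^a$ (depending only on $\epsilon$ and these parameters) for which, for every problem as above with $\psi(\bar x^{(0)})-\psi^*\le\Delta$, PG-SVRG with this $T$ satisfies, with $x_\dagger^{(\tau)}:=\mathrm{prox}_{\gamma\psi}(\bar x^{(\tau)})=\arg\min_z\{\psi(z)+\frac1{2\gamma}\|z-\bar x^{(\tau)}\|_2^2\}$, $$\mathbb E\big[\mathrm{Dist}(0,\partial\psi(x_\dagger^{(\tau)}))^2\big]\le\frac1{\gamma^2}\,\mathbb E\|x_\dagger^{(\tau)}-\bar x^{(\tau)}\|_2^2\le\epsilon^2,$$ and its total complexity is at most $C\,n\epsilon^{-2}(1+\log\frac1\epsilon)^a$ if $\mu>0$, and at most $C\,(n\epsilon^{-2}+\epsilon^{-6})(1+\log\frac1\epsilon)^a$ if $\mu=0$. -/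

import Mathlib

open scoped ENNReal Topology

noncomputable section

namespace PGSVRG

/-! ### Extended-valued functions -/

/-- Effective domain of an extended-valued function. -/
def dom {V : Type*} (h : V → EReal) : Set V := {x | h x ≠ ⊤}

/-- A chosen minimizer of `h` over the whole space (a global minimizer whenever one exists). -/
def argmin {V : Type*} [Nonempty V] (h : V → EReal) : V :=
  Classical.epsilon fun z => ∀ w, h z ≤ h w

/-- `h : V → ℝ ∪ {+∞}` is proper and closed (lower semicontinuous). -/
structure IsProperClosed {V : Type*} [TopologicalSpace V] (h : V → EReal) : Prop where
  ne_bot : ∀ x, h x ≠ ⊥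
  nonempty_dom : (dom h).Nonempty
  lsc : LowerSemicontinuous h

/-- Convexity of `h : V → ℝ ∪ {+∞}`: its domain is convex and it is convex there. -/
def IsConvex {V : Type*} [AddCommGroup V] [Module ℝ V] (h : V → EReal) : Prop :=
  ConvexOn ℝ (dom h) fun x => (h x).toReal

section Subdifferential

variable {V : Type*} [NormedAddCommGroup V] [NormedSpace ℝ V]

/-- Fréchet subdifferential of an extended-valued function at `x` (empty where `h x` is infinite).
Subgradients are linear functionals; on a Euclidean space the dual norm is the Euclidean norm. -/
def subdiff (h : V → EReal) (x : V) : Set (V →L[ℝ] ℝ) :=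
  {ζ | h x ≠ ⊤ ∧ h x ≠ ⊥ ∧ ∀ c : ℝ, 0 < c → ∀ᶠ x' in 𝓝 x,
    h x + ((ζ (x' - x) - c * ‖x' - x‖ : ℝ) : EReal) ≤ h x'}

/-- `ρ`-weak convexity of `h` on `X`. -/
def WeaklyConvexOn (ρ : ℝ) (X : Set V) (h : V → ℝ) : Prop :=
  ∀ x ∈ X, ∀ x' ∈ X, ∀ ζ ∈ subdiff (fun z => (h z : EReal)) x',
    h x' + ζ (x - x') - ρ / 2 * ‖x - x'‖ ^ 2 ≤ h x

open Classical in
/-- Extension of `d : Y → ℝ` by `+∞` outside `Y`. -/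
def extendTop (Y : Set V) (d : V → ℝ) : V → EReal := fun y => if y ∈ Y then (d y : EReal) else ⊤

/-- `Yᵒ`: the points of `Y` where `d : Y → ℝ` has a subgradient. -/
def subdom (Y : Set V) (d : V → ℝ) : Set V := {y ∈ Y | (subdiff (extendTop Y d) y).Nonempty}

/-- Bregman divergence `V(y, y') = d(y) - d(y') - ⟨∇d(y'), y - y'⟩`; here `d'` is the gradient. -/
def bregman (d : V → ℝ) (d' : V → V →L[ℝ] ℝ) (y y' : V) : ℝ := d y - d y' - d' y' (y - y')

/-- `d` is a distance generating function on `Y` with respect to the norm of `V`, with gradient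
`d'` on `Yᵒ`: convex and closed on `Y`, continuously differentiable and `1`-strongly convex
on `Yᵒ`. The gradient is taken along `Y`, since `Yᵒ` may contain relative boundary points of `Y`
and `Y` may have empty interior. -/
structure IsDistGen (Y : Set V) (d : V → ℝ) (d' : V → V →L[ℝ] ℝ) : Prop where
  convex : ConvexOn ℝ Y d
  lsc : LowerSemicontinuousOn d Y
  hasGrad : ∀ y ∈ subdom Y d, HasFDerivWithinAt d (d' y) Y y
  grad_cont : ContinuousOn d' (subdom Y d)
  strong : ∀ y ∈ Y, ∀ y' ∈ subdom Y d, d y' + d' y' (y - y') + 1 / 2 * ‖y - y'‖ ^ 2 ≤ d y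

/-- `r` is (convex and) `μ`-strongly convex with respect to the Bregman divergence of `d`. -/
structure StronglyConvexBregman (μ : ℝ) (d : V → ℝ) (d' : V → V →L[ℝ] ℝ) (r : V → EReal) :
    Prop where
  convex : IsConvex r
  strong : ∀ y ∈ dom r, ∀ y' ∈ subdom (dom r) d, ∀ ζ ∈ subdiff r y',
    (r y').toReal + ζ (y - y') + μ * bregman d d' y y' ≤ (r y).toReal

end Subdifferential

/-! ### The finite-sum min-max problem -/

/-- Data of `min_x max_y f(x,y) - r(y) + g(x)`, `f = (1/n) ∑ i, f_i`, together with a distance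
generating function `d` on `dom r` and its gradient `d'`. -/
structure Problem (E F : Type*) [NormedAddCommGroup F] [NormedSpace ℝ F] (n : ℕ) where
  fi : Fin n → E → F → ℝ
  g : E → EReal
  r : F → EReal
  d : F → ℝ
  d' : F → F →L[ℝ] ℝ

/-- The numerical constants of the problem class. -/
structure Params where
  ρ : ℝ
  μ : ℝ
  Lx : ℝ
  Ly : ℝ
  Dx : ℝ
  Dy : ℝ

section Problem

variable {E F : Type*} [NormedAddCommGroup E] [NormedSpace ℝ E]
  [NormedAddCommGroup F] [NormedSpace ℝ F] {n : ℕ}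

/-- Partial gradient in `x`. -/
def gradX (h : E → F → ℝ) (x : E) (y : F) : E →L[ℝ] ℝ := fderiv ℝ (fun z => h z y) x

/-- Partial gradient in `y`. -/
def gradY (h : E → F → ℝ) (x : E) (y : F) : F →L[ℝ] ℝ := fderiv ℝ (fun z => h x z) y

namespace Problem

/-- `f = (1/n) ∑ i, f_i`. -/
def f (D : Problem E F n) (x : E) (y : F) : ℝ := (1 / (n : ℝ)) * ∑ i, D.fi i x y

/-- `𝒳 = dom g`. -/
def X (D : Problem E F n) : Set E := dom D.g

/-- `𝒴 = dom r`. -/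
def Y (D : Problem E F n) : Set F := dom D.r

/-- `ψ(x) = max_y {f(x,y) - r(y)} + g(x)`. -/
def ψ (D : Problem E F n) (x : E) : EReal := (⨆ y, ((D.f x y : EReal) - D.r y)) + D.g x

/-- `prox_{γψ}(x) = argmin_z {ψ(z) + ‖z - x‖² / (2γ)}`. -/
def prox (D : Problem E F n) (γ : ℝ) (x : E) : E :=
  argmin fun z => D.ψ z + ((1 / (2 * γ) * ‖z - x‖ ^ 2 : ℝ) : EReal)

/-- The standing assumptions: weak convexity / concavity, `r` strongly convex, `ψ` bounded below,
smooth summands with Lipschitz partial gradients (in the dual norms), and bounded domains. -/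
structure Assumptions (D : Problem E F n) (P : Params) : Prop where
  g_closed : IsProperClosed D.g
  g_convex : IsConvex D.g
  r_closed : IsProperClosed D.r
  distGen : IsDistGen D.Y D.d D.d'
  weakly_convex : ∀ y ∈ D.Y, WeaklyConvexOn P.ρ D.X fun x => D.f x y
  concave : ∀ x ∈ D.X, ConcaveOn ℝ D.Y fun y => D.f x y
  r_strong : StronglyConvexBregman P.μ D.d D.d' D.r
  ψ_bddBelow : ⊥ < ⨅ x, D.ψ x
  differentiable : ∀ i, Differentiable ℝ fun z : E × F => D.fi i z.1 z.2
  lipschitz_gradX : ∀ i, ∀ x ∈ D.X, ∀ x' ∈ D.X, ∀ y ∈ D.Y, ∀ y' ∈ D.Y,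
    ‖gradX (D.fi i) x y - gradX (D.fi i) x' y'‖ ≤ P.Lx * √(‖x - x'‖ ^ 2 + ‖y - y'‖ ^ 2)
  lipschitz_gradY : ∀ i, ∀ x ∈ D.X, ∀ x' ∈ D.X, ∀ y ∈ D.Y, ∀ y' ∈ D.Y,
    ‖gradY (D.fi i) x y - gradY (D.fi i) x' y'‖ ≤ P.Ly * √(‖x - x'‖ ^ 2 + ‖y - y'‖ ^ 2)
  bounded_X : Bornology.IsBounded D.X
  Dx_eq : P.Dx = Metric.diam D.X
  d_bddAbove : BddAbove (D.d '' D.Y)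
  d_min : ∃ y ∈ D.Y, IsMinOn D.d D.Y y
  Dy_eq : P.Dy = √(2 * sSup (D.d '' D.Y) - 2 * sInf (D.d '' D.Y))

end Problem

/-! ### The algorithms

`invLam` stands for `1/λ`, with the convention `1/λ = 0` for `λ = +∞`. -/

/-- `μ_x = 1/γ - ρ`. -/
def muX (P : Params) (γ : ℝ) : ℝ := 1 / γ - P.ρ

/-- `μ_y = 1/λ + μ`. -/
def muY (P : Params) (invLam : ℝ) : ℝ := invLam + P.μ

/-- `Λ = 52 max{L_x², L_y²} / min{μ_x², μ_y²}`. -/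
def bigLam (P : Params) (γ invLam : ℝ) : ℝ :=
  52 * max (P.Lx ^ 2) (P.Ly ^ 2) / min (muX P γ ^ 2) (muY P invLam ^ 2)

/-- `η_x = 1/(μ_x Λ)`. -/
def etaX (P : Params) (γ invLam : ℝ) : ℝ := 1 / (muX P γ * bigLam P γ invLam)

/-- `η_y = 1/(μ_y Λ)`. -/
def etaY (P : Params) (γ invLam : ℝ) : ℝ := 1 / (muY P invLam * bigLam P γ invLam)

/-- Length `J` of a stage of SVRG. -/
def stageLen (P : Params) (γ invLam : ℝ) : ℕ :=
  ⌈1 + (3 / 2 + 3 * bigLam P γ invLam) * Real.log 4⌉₊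

/-- State of SVRG: the current points and the number of (equivalent) stochastic gradients
computed so far. -/
structure State (E F : Type*) where
  x : E
  y : F
  cost : ℕ

/-- The loop `for k = 0, 1, 2, …: s ← step k s`, after a given number of passes. -/
def iter {S : Type*} (step : ℕ → S → S) (s : S) : ℕ → S
  | 0 => s
  | k + 1 => step k (iter step s k)

/-- `ȳ = argmin_{y ∈ 𝒴} d(y)`. -/
def yBar (D : Problem E F n) : F := argmin (extendTop D.Y D.d)

/-- One inner iteration of SVRG with reference point `(xh, yh)` and sampled index `l`; it computes
one (variance-reduced) stochastic gradient. -/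
def innerStep (D : Problem E F n) (P : Params) (γ invLam : ℝ) (xb : E) (xh : E) (yh : F)
    (l : Fin n) (s : State E F) : State E F :=
  let gx : E →L[ℝ] ℝ := gradX D.f xh yh - gradX (D.fi l) xh yh + gradX (D.fi l) s.x s.y
  let gy : F →L[ℝ] ℝ := gradY D.f xh yh - gradY (D.fi l) xh yh + gradY (D.fi l) s.x s.y
  { x := argmin fun z => ((gx z + 1 / (2 * etaX P γ invLam) * ‖z - s.x‖ ^ 2
        + 1 / (2 * γ) * ‖z - xb‖ ^ 2 : ℝ) : EReal) + D.g z
    y := argmin fun z => ((-gy z + 1 / etaY P γ invLam * bregman D.d D.d' z s.y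
        + invLam * bregman D.d D.d' z (yBar D) : ℝ) : EReal) + D.r z
    cost := s.cost + 1 }

/-- One stage of SVRG: the full gradient at the reference point (`n` stochastic gradients) and
`J - 1` inner iterations with sampled indices `l 0, l 1, …`. -/
def stage (D : Problem E F n) (P : Params) (γ invLam : ℝ) (xb : E) (l : ℕ → Fin n)
    (s : State E F) : State E F :=
  iter (fun j => innerStep D P γ invLam xb s.x s.y (l j)) ⟨s.x, s.y, s.cost + n⟩
    (stageLen P γ invLam - 1)

/-- `SVRG(x̄, K, λ)`: `K - 1` stages; `l k j` is the index sampled in inner iteration `j` of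
stage `k`. -/
def svrg (D : Problem E F n) (P : Params) (γ : ℝ) (xb : E) (K : ℕ) (invLam : ℝ)
    (l : ℕ → ℕ → Fin n) : State E F :=
  iter (fun k => stage D P γ invLam xb (l k)) ⟨xb, yBar D, 0⟩ (K - 1)

open Classical in
/-- `1/λ_t`, where `λ_t = +∞` if `μ > 0` and `λ_t = t + 2` if `μ = 0`. -/
def invLamSeq (P : Params) (t : ℕ) : ℝ := if 0 < P.μ then 0 else 1 / ((t : ℝ) + 2)

/-- `k_t = 1 + c log[(t+1)² (4/(γ μ_x) + 1) (1/4 + Λ_t/2) (μ_x D_x² + μ_y^t D_y²)]`, rounded up to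
an integer and to the value `2` that SVRG needs at least. -/
def stageCount (P : Params) (γ c : ℝ) (t : ℕ) : ℕ :=
  max 2 ⌈1 + c * Real.log (((t : ℝ) + 1) ^ 2 * (4 / (γ * muX P γ) + 1)
    * (1 / 4 + bigLam P γ (invLamSeq P t) / 2)
    * (muX P γ * P.Dx ^ 2 + muY P (invLamSeq P t) * P.Dy ^ 2))⌉₊

/-- PG-SVRG started at `x0`: the pair of `x̄^(t)` and the number of (equivalent) stochastic
gradients computed to obtain it; `l (t, k, j)` is the index sampled in inner iteration `j` of
stage `k` of the `t`-th call of SVRG. -/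
def pgsvrg (D : Problem E F n) (P : Params) (γ c : ℝ) (x0 : E) (l : ℕ × ℕ × ℕ → Fin n) :
    ℕ → E × ℕ :=
  iter (fun t s =>
    let out := svrg D P γ s.1 (stageCount P γ c t) (invLamSeq P t) fun k j => l (t, k, j)
    (out.x, s.2 + out.cost)) (x0, 0)

end Problem

end PGSVRG

end

universe u v

open PGSVRG MeasureTheory ProbabilityTheory

namespace PGSVRG

/-! ### Convex analysis -/

/-! ### Existence of minimizers of extended-valued functions. -/

section Argmin

variable {V : Type*}

/-! The method is an inexact proximal point method for the `ρ`-weakly convex function ψ. With γ =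
1/(2ρ) the proximal subproblem at x̄ is strongly convex in x with modulus μ_x = ρ. The extra term
V(·, ȳ)/λ, together with r, makes it strongly concave in y with modulus μ_y and changes the
objective by at most D_y²/(2λ). If x̄⁺ solves the subproblem up to an error e, quadratic growth at
the proximal point gives μ_x/2 ‖prox(x̄) − x̄‖² + ψ(x̄⁺) ≤ ψ(x̄) + e + D_y²/(2λ)
(`Problem.Assumptions.outer_step_le`). With mean errors at most 9/(t+1)² and 1/λ_t ≤ 1/(t+2) these
inequalities telescope, and the mean squared residuals sum to O(1 + log T)
(`IsExp.sum_residual_le`). A uniformly drawn iterate therefore has mean squared residual O((1 + log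
T)/T), and T of order ε⁻²(1 + log ε⁻¹) suffices. The residual divided by γ is the norm of an element
of ∂ψ at the proximal point (`Problem.Assumptions.infEDist_subdiff_le`).

For the subproblem, let (x_s, y_s) be its saddle point (`Problem.Assumptions.exists_saddle`) and Φ =
μ_x/2 ‖x_s − x‖² + μ_y V(y_s, y). The two proximal inequalities, weak convexity and concavity of f,
and Young's inequality for the gradient noise give, on average over the sampled index, (Λ+1) Φ⁺ +
gap⁺/2 ≤ (Λ + 5/24) Φ + (5/24) Φ_ref (`IsSaddle.avg_innerStep_le`). One stage then multiplies the
mean of Φ by at most 17/38 and also bounds the gap at its last iterate (`IsExp.stage_le`). The gap,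
plus a multiple of Φ, controls the primal error (`IsSaddle.primal_le`), and k_t is large enough for
the accuracy 9/(t+1)² (`IsExp.svrg_le`, `stageCount_error_le`).

Two points need care. Strong convexity of r is assumed only for base points in 𝒴ᵒ, while the saddle
point may lie outside; `StronglyConvexBregman.strongConvexOn` transfers it to the norm and to all of
𝒴 by approximation. Moreover, T outer iterates read only finitely many indices, so every expectation
is a finite average (`IsExp`, `finAvg_isExp`, `lintegral_eq_sum`) and no measurability of minimizers
is involved.

For the complexity, k_t is O(1 + log t), and J is O(1 + Λ_t), which is bounded if μ > 0 and O(t²) if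
μ = 0. Summing over t < T gives nT, respectively nT + T³, up to logarithms. -/

theorem argmin_le [Nonempty V] {h : V → EReal} (hex : ∃ z, ∀ w, h z ≤ h w) (w : V) :
    h (argmin h) ≤ h w :=
  Classical.epsilon_spec hex w

theorem coe_toReal_of_mem_dom {h : V → EReal} (hbot : ∀ x, h x ≠ ⊥) {x : V} (hx : x ∈ dom h) :
    ((h x).toReal : EReal) = h x :=
  EReal.coe_toReal hx (hbot x)

/-- `argmin` is a bare choice and means something only once a minimizer exists. This passes from a
real-valued minimum over the domain, the form that compactness provides, to the point chosen by the
algorithm. -/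
theorem argmin_coe_add [Nonempty V] {h : V → EReal} (hbot : ∀ x, h x ≠ ⊥) {k : V → ℝ}
    (hex : ∃ y ∈ dom h, ∀ z ∈ dom h, (h y).toReal + k y ≤ (h z).toReal + k z) :
    argmin (fun z => (k z : EReal) + h z) ∈ dom h ∧ ∀ z ∈ dom h,
      (h (argmin fun z => (k z : EReal) + h z)).toReal + k (argmin fun z => (k z : EReal) + h z)
        ≤ (h z).toReal + k z := by
  obtain ⟨y, hy, hmin⟩ := hex
  have key : ∀ w, (k y : EReal) + h y ≤ (k w : EReal) + h w := by
    intro w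
    by_cases hw : w ∈ dom h
    · rw [← coe_toReal_of_mem_dom hbot hy, ← coe_toReal_of_mem_dom hbot hw]
      have := hmin w hw
      exact_mod_cast (by linarith : k y + (h y).toReal ≤ k w + (h w).toReal)
    · have : h w = ⊤ := by simpa [dom] using hw
      rw [this, EReal.coe_add_top]
      exact le_top
  have hle := argmin_le (h := fun z => (k z : EReal) + h z) ⟨y, key⟩
  set a := argmin fun z => (k z : EReal) + h z with ha
  have hadom : a ∈ dom h := by
    intro htop
    have := hle y
    rw [htop, EReal.coe_add_top, ← coe_toReal_of_mem_dom hbot hy] at this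
    rw [top_le_iff] at this
    exact EReal.coe_ne_top _ (by rw [← EReal.coe_add] at this; exact this)
  refine ⟨hadom, fun z hz => ?_⟩
  have := hle z
  rw [← coe_toReal_of_mem_dom hbot hz, ← coe_toReal_of_mem_dom hbot hadom] at this
  have h2 : k a + (h a).toReal ≤ k z + (h z).toReal := by exact_mod_cast this
  linarith

end Argmin

section Minimizer

variable {V : Type*} [NormedAddCommGroup V] [NormedSpace ℝ V]

/-- The sum of a closed function and a function that is lower semicontinuous and bounded below on
its domain attains its minimum if the domain is bounded. -/
theorem exists_isMinOn_dom_add [FiniteDimensional ℝ V] {h : V → EReal} (hh : IsProperClosed h)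
    (hbdd : Bornology.IsBounded (dom h)) {k : V → ℝ} (hk : LowerSemicontinuousOn k (dom h))
    {m : ℝ} (hm : ∀ z ∈ dom h, m ≤ k z) :
    ∃ y ∈ dom h, ∀ z ∈ dom h, (h y).toReal + k y ≤ (h z).toReal + k z := by
  classical
  have : ProperSpace V := FiniteDimensional.proper ℝ V
  -- With the value +∞ off the domain, the sum is lower semicontinuous on the whole space. It
  -- attains its minimum on the compact closure of the domain, and the minimizer is in the domain
  -- because the minimum is finite.
  set H : V → EReal := fun z => if z ∈ dom h then (((h z).toReal + k z : ℝ) : EReal) else ⊤ with hH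
  have hlsc : LowerSemicontinuous H := by
    intro x y hy
    by_cases hx : x ∈ dom h
    · have hHx : H x = (((h x).toReal + k x : ℝ) : EReal) := by simp [hH, hx]
      rw [hHx] at hy
      obtain ⟨q, hyq, hq⟩ := EReal.lt_iff_exists_real_btwn.1 hy
      have hq' : q < (h x).toReal + k x := by exact_mod_cast hq
      set e := ((h x).toReal + k x - q) / 2 with he
      have hepos : 0 < e := by rw [he]; linarith
      have h1 : (((h x).toReal - e : ℝ) : EReal) < h x := by
        conv_rhs => rw [← coe_toReal_of_mem_dom hh.ne_bot hx]
        exact_mod_cast (by linarith)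
      have h2 : k x - e < k x := by linarith
      have e1 := hh.lsc x _ h1
      have e2 := eventually_nhdsWithin_iff.1 (hk x hx _ h2)
      filter_upwards [e1, e2] with z hz1 hz2
      by_cases hz : z ∈ dom h
      · have := hz2 hz
        rw [← coe_toReal_of_mem_dom hh.ne_bot hz] at hz1
        have hz1' : (h x).toReal - e < (h z).toReal := by exact_mod_cast hz1
        refine hyq.trans ?_
        simp only [hH, hz, if_true]
        exact_mod_cast (by rw [he] at *; linarith)
      · simp only [hH, hz, if_false]
        exact hyq.trans (EReal.coe_lt_top q)
    · have hHx : H x = ⊤ := by simp [hH, hx]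
      have htop : h x = ⊤ := by simpa [dom] using hx
      rw [hHx] at hy
      obtain ⟨q, hyq, -⟩ := EReal.lt_iff_exists_real_btwn.1 hy
      -- At a point off the domain nothing is known about `k` but its lower bound on nearby domain
      -- points; the growth of `h` has to compensate for it.
      have h1 : ((q - m : ℝ) : EReal) < h x := by rw [htop]; exact EReal.coe_lt_top _
      filter_upwards [hh.lsc x _ h1] with z hz1
      by_cases hz : z ∈ dom h
      · have := hm z hz
        rw [← coe_toReal_of_mem_dom hh.ne_bot hz] at hz1
        have hz1' : q - m < (h z).toReal := by exact_mod_cast hz1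
        refine hyq.trans ?_
        simp only [hH, hz, if_true]
        exact_mod_cast (by linarith)
      · simp only [hH, hz, if_false]
        exact hyq.trans (EReal.coe_lt_top q)
  obtain ⟨y0, hy0⟩ := hh.nonempty_dom
  have hcomp : IsCompact (closure (dom h)) := hbdd.isCompact_closure
  obtain ⟨y, -, hmin⟩ := (hlsc.lowerSemicontinuousOn (closure (dom h))).exists_isMinOn
    ⟨y0, subset_closure hy0⟩ hcomp
  have hle : ∀ z ∈ dom h, H y ≤ H z := fun z hz => hmin (subset_closure hz)
  have hy : y ∈ dom h := by
    by_contra hcon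
    have := hle y0 hy0
    simp only [hH, hcon, hy0, if_true, if_false, top_le_iff] at this
    exact EReal.coe_ne_top _ this
  refine ⟨y, hy, fun z hz => ?_⟩
  have := hle z hz
  simp only [hH, hy, hz, if_true] at this
  exact_mod_cast this

end Minimizer

/-! ### Separation of a convex function from a concave one. -/

section Sandwich

variable {V : Type*} [AddCommGroup V] [Module ℝ V]

/-- Nonnegative multiples of differences of points of a convex set already form a subspace: a
negative factor swaps the two points, and a sum is a rescaled pair of convex combinations. -/
theorem exists_smul_sub_of_mem_span {Y : Set V} (hY : Convex ℝ Y) {y0 : V} (hy0 : y0 ∈ Y) {w : V}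
    (hw : w ∈ Submodule.span ℝ {v : V | ∃ y ∈ Y, ∃ y' ∈ Y, v = y - y'}) :
    ∃ t : ℝ, 0 ≤ t ∧ ∃ y ∈ Y, ∃ y' ∈ Y, w = t • (y - y') := by
  induction hw using Submodule.span_induction with
  | mem x hx =>
    obtain ⟨y, hy, y', hy', rfl⟩ := hx
    exact ⟨1, zero_le_one, y, hy, y', hy', by simp⟩
  | zero => exact ⟨0, le_rfl, y0, hy0, y0, hy0, by simp⟩
  | add a b _ _ iha ihb =>
    obtain ⟨s, hs, y, hy, y', hy', rfl⟩ := iha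
    obtain ⟨t, ht, z, hz, z', hz', rfl⟩ := ihb
    rcases (add_nonneg hs ht).eq_or_lt with h0 | hpos
    · have : s = 0 := by linarith
      have : t = 0 := by linarith
      subst_vars
      exact ⟨0, le_rfl, y0, hy0, y0, hy0, by simp⟩
    · have hsum : s / (s + t) + t / (s + t) = 1 := by field_simp
      refine ⟨s + t, hpos.le, (s / (s + t)) • y + (t / (s + t)) • z,
        hY hy hz (by positivity) (by positivity) hsum,
        (s / (s + t)) • y' + (t / (s + t)) • z',
        hY hy' hz' (by positivity) (by positivity) hsum, ?_⟩
      have e1 : (s + t) * (s / (s + t)) = s := by field_simp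
      have e2 : (s + t) * (t / (s + t)) = t := by field_simp
      simp only [smul_sub, smul_add, smul_smul, e1, e2]
      abel
  | smul a x _ ih =>
    obtain ⟨s, hs, y, hy, y', hy', rfl⟩ := ih
    rcases le_total 0 a with ha | ha
    · exact ⟨a * s, mul_nonneg ha hs, y, hy, y', hy', by rw [smul_smul]⟩
    · refine ⟨-a * s, mul_nonneg (by linarith) hs, y', hy', y, hy, ?_⟩
      rw [← neg_sub y y', smul_neg, smul_smul, neg_mul, neg_smul, neg_neg]

/-- **Sandwich theorem**: a linear functional separates a convex function from a concave minorant
on the same convex set. -/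
theorem exists_linear_sandwich {Y : Set V} {f1 f2 : V → ℝ} (h1 : ConvexOn ℝ Y f1)
    (h2 : ConcaveOn ℝ Y f2) (hle : ∀ y ∈ Y, f2 y ≤ f1 y) {y0 : V} (hy0 : y0 ∈ Y) :
    ∃ g : V →ₗ[ℝ] ℝ, ∀ y ∈ Y, ∀ y' ∈ Y, g (y - y') ≤ f1 y - f2 y' := by
  set W : Submodule ℝ V := Submodule.span ℝ {v : V | ∃ y ∈ Y, ∃ y' ∈ Y, v = y - y'} with hW
  -- M. Riesz extension on the span W of the differences. The functional (0, σ) ↦ σ is nonnegative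
  -- on this cone because f2 ≤ f1, and every (w, τ) enters the cone after a shift in the second
  -- coordinate because w is a multiple of a difference. Evaluating the extension at (y − y', f1 y −
  -- f2 y') gives the claim, with no interior point or topology.
  let s : PointedCone ℝ (W × ℝ) :=
    { carrier := {p | ∃ t : ℝ, 0 ≤ t ∧ ∃ y ∈ Y, ∃ y' ∈ Y, (p.1 : V) = t • (y - y') ∧
        t * (f1 y - f2 y') ≤ p.2}
      zero_mem' := ⟨0, le_rfl, y0, hy0, y0, hy0, by simp, by simp⟩
      add_mem' := by
        rintro ⟨a, σ⟩ ⟨b, τ⟩ ⟨s, hs, y, hy, y', hy', ha, hσ⟩ ⟨t, ht, z, hz, z', hz', hb, hτ⟩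
        simp only at ha hb hσ hτ
        rcases (add_nonneg hs ht).eq_or_lt with h0 | hpos
        · have hs0 : s = 0 := by linarith
          have ht0 : t = 0 := by linarith
          subst hs0 ht0
          refine ⟨0, le_rfl, y0, hy0, y0, hy0, ?_, ?_⟩
          · simp [ha, hb]
          · simp only [zero_mul, Prod.snd_add] at *
            linarith
        · have hsum : s / (s + t) + t / (s + t) = 1 := by field_simp
          have e1 : (s + t) * (s / (s + t)) = s := by field_simp
          have e2 : (s + t) * (t / (s + t)) = t := by field_simp
          refine ⟨s + t, hpos.le, (s / (s + t)) • y + (t / (s + t)) • z,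
            h1.1 hy hz (by positivity) (by positivity) hsum,
            (s / (s + t)) • y' + (t / (s + t)) • z',
            h1.1 hy' hz' (by positivity) (by positivity) hsum, ?_, ?_⟩
          · simp only [Prod.fst_add, Submodule.coe_add, ha, hb]
            simp only [smul_sub, smul_add, smul_smul, e1, e2]
            abel
          · have c1 := h1.2 hy hz (div_nonneg hs hpos.le) (div_nonneg ht hpos.le) hsum
            have c2 := h2.2 hy' hz' (div_nonneg hs hpos.le) (div_nonneg ht hpos.le) hsum
            simp only [smul_eq_mul, Prod.snd_add] at c1 c2 ⊢
            calc _ ≤ (s + t) * ((s / (s + t) * f1 y + t / (s + t) * f1 z)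
                  - (s / (s + t) * f2 y' + t / (s + t) * f2 z')) :=
                  mul_le_mul_of_nonneg_left (by linarith) hpos.le
              _ = s * (f1 y - f2 y') + t * (f1 z - f2 z') := by field_simp; ring
              _ ≤ _ := by linarith
      smul_mem' := by
        rintro ⟨a, ha0⟩ ⟨b, τ⟩ ⟨t, ht, z, hz, z', hz', hb, hτ⟩
        refine ⟨a * t, mul_nonneg ha0 ht, z, hz, z', hz', ?_, ?_⟩
        · simp only at hb
          simp only [Prod.smul_mk, Nonneg.mk_smul, Submodule.coe_smul, hb, smul_smul]
        · simp only [Prod.smul_mk, Nonneg.mk_smul, smul_eq_mul] at hτ ⊢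
          rw [mul_assoc]
          exact mul_le_mul_of_nonneg_left hτ ha0 }
  let φ : (W × ℝ) →ₗ.[ℝ] ℝ :=
    { domain := Submodule.prod ⊥ ⊤
      toFun := (LinearMap.snd ℝ W ℝ).comp (Submodule.subtype _) }
  obtain ⟨G, hG1, hG2⟩ := riesz_extension s φ (by
    rintro ⟨⟨a, σ⟩, hx⟩ ⟨t, ht, y, hy, y', hy', ha, hσ⟩
    have ha0 : a = 0 := by simpa using (Submodule.mem_prod.1 hx).1
    simp only [ha0, Submodule.coe_zero] at ha hσ
    change 0 ≤ σ
    rcases smul_eq_zero.1 ha.symm with h0 | h0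
    · rw [h0] at hσ; linarith
    · have : y = y' := sub_eq_zero.1 h0
      subst this
      exact (mul_nonneg ht (by linarith [hle y hy])).trans hσ) (by
    rintro ⟨w, τ⟩
    obtain ⟨t, ht, y, hy, y', hy', hw⟩ := exists_smul_sub_of_mem_span h1.1 hy0 w.2
    refine ⟨⟨(0, t * (f1 y - f2 y') - τ), by simp [φ, Submodule.mem_prod]⟩, t, ht, y, hy, y', hy', ?_, ?_⟩
    · simpa using hw
    · simp)
  obtain ⟨g, hg⟩ := LinearMap.exists_extend (-(G.comp (LinearMap.inl ℝ W ℝ)))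
  refine ⟨g, fun y hy y' hy' => ?_⟩
  have hmem : y - y' ∈ W := Submodule.subset_span ⟨y, hy, y', hy', rfl⟩
  have e1 : g (y - y') = -G (⟨y - y', hmem⟩, 0) := by
    have := LinearMap.congr_fun hg ⟨y - y', hmem⟩
    simpa using this
  have e2 : G (0, f1 y - f2 y') = f1 y - f2 y' :=
    hG1 ⟨(0, f1 y - f2 y'), by simp [φ, Submodule.mem_prod]⟩
  have e3 : 0 ≤ G (⟨y - y', hmem⟩, f1 y - f2 y') :=
    hG2 _ ⟨1, zero_le_one, y, hy, y', hy', by simp, by simp⟩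
  have e4 : G (⟨y - y', hmem⟩, f1 y - f2 y') = G (⟨y - y', hmem⟩, 0) + G (0, f1 y - f2 y') := by
    rw [← map_add]; simp
  rw [e1]
  linarith

/-- If the sum of two convex functions is minimal at `y0`, a linear functional is a subgradient of
the first one and its negative is a subgradient of the second one. -/
theorem exists_linear_of_isMin_add {Y : Set V} {f1 f2 : V → ℝ} (h1 : ConvexOn ℝ Y f1)
    (h2 : ConvexOn ℝ Y f2) {y0 : V} (hy0 : y0 ∈ Y)
    (hmin : ∀ y ∈ Y, f1 y0 + f2 y0 ≤ f1 y + f2 y) :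
    ∃ g : V →ₗ[ℝ] ℝ, (∀ y ∈ Y, f1 y0 + g (y - y0) ≤ f1 y) ∧
      ∀ y ∈ Y, f2 y0 - g (y - y0) ≤ f2 y := by
  obtain ⟨g, hg⟩ := exists_linear_sandwich h1
    (f2 := fun y => -f2 y + (f1 y0 + f2 y0)) (h2.neg.add_const _)
    (fun y hy => by have := hmin y hy; linarith) hy0
  refine ⟨g, fun y hy => ?_, fun y hy => ?_⟩
  · have := hg y hy y0 hy0
    linarith
  · have := hg y0 hy0 y hy
    rw [← neg_sub y y0, map_neg] at this
    linarith

end Sandwich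

end PGSVRG

namespace PGSVRG

/-! ### One-sided derivatives along segments. -/

section Derivative

theorem le_of_hasDerivWithinAt {φ : ℝ → ℝ} {φ' A B : ℝ}
    (hφ : HasDerivWithinAt φ φ' (Set.Icc 0 1) 0)
    (h : ∀ s ∈ Set.Ioc (0 : ℝ) 1, s * A - s ^ 2 * B ≤ φ s - φ 0) : A ≤ φ' := by
  have h1 := hasDerivWithinAt_iff_tendsto_slope.1 hφ
  have hset : (Set.Icc (0 : ℝ) 1) \ {0} = Set.Ioc 0 1 := by
    ext x; simp only [Set.mem_sdiff, Set.mem_Icc, Set.mem_singleton_iff, Set.mem_Ioc]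
    constructor
    · rintro ⟨⟨h0, h1⟩, h2⟩; exact ⟨lt_of_le_of_ne h0 (Ne.symm h2), h1⟩
    · rintro ⟨h0, h1⟩; exact ⟨⟨h0.le, h1⟩, h0.ne'⟩
  rw [hset] at h1
  have hne : (𝓝[Set.Ioc (0 : ℝ) 1] 0).NeBot := by
    rw [nhdsWithin_Ioc_eq_nhdsGT (zero_lt_one' ℝ)]; infer_instance
  have h2 : Filter.Tendsto (fun s : ℝ => A - s * B) (𝓝[Set.Ioc (0 : ℝ) 1] 0) (𝓝 (A - 0 * B)) :=
    ((continuous_const.sub (continuous_id.mul continuous_const)).tendsto 0).mono_left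
      nhdsWithin_le_nhds
  rw [zero_mul, sub_zero] at h2
  refine le_of_tendsto_of_tendsto h2 h1 ?_
  filter_upwards [self_mem_nhdsWithin] with s hs
  rw [slope_def_field, sub_zero, le_div_iff₀ hs.1]
  have := h s hs
  nlinarith

variable {V : Type*} [NormedAddCommGroup V] [NormedSpace ℝ V]

/-- Only the derivative along the set enters, since the segment from `y0` to `y` stays in it. The
point `y0` may thus lie on the boundary of a set with empty interior. -/
theorem le_of_hasFDerivWithinAt {Y : Set V} (hY : Convex ℝ Y) {f : V → ℝ} {f' : V →L[ℝ] ℝ}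
    {y0 y : V} (hf : HasFDerivWithinAt f f' Y y0) (hy0 : y0 ∈ Y) (hy : y ∈ Y) {A B : ℝ}
    (h : ∀ s ∈ Set.Ioc (0 : ℝ) 1,
      s * A - s ^ 2 * B ≤ f ((1 - s) • y0 + s • y) - f y0) : A ≤ f' (y - y0) := by
  have hline : HasDerivWithinAt (fun s : ℝ => (1 - s) • y0 + s • y) (y - y0) (Set.Icc 0 1) 0 := by
    have h1 : HasDerivAt (fun s : ℝ => y0 + s • (y - y0)) ((1 : ℝ) • (y - y0)) 0 :=
      ((hasDerivAt_id (0 : ℝ)).smul_const (y - y0)).const_add y0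
    rw [one_smul] at h1
    refine (h1.hasDerivWithinAt).congr_of_eventuallyEq ?_ ?_
    · refine Filter.Eventually.of_forall fun s => ?_
      simp only [sub_smul, one_smul, smul_sub]; abel
    · simp
  have hcomp : HasDerivWithinAt (f ∘ fun s : ℝ => (1 - s) • y0 + s • y) (f' (y - y0))
      (Set.Icc 0 1) 0 := by
    refine HasFDerivWithinAt.comp_hasDerivWithinAt (t := Y) 0 (by simpa using hf) hline ?_
    intro s hs
    exact hY hy0 hy (by linarith [hs.2]) hs.1 (by ring)
  refine le_of_hasDerivWithinAt hcomp (B := B) fun s hs => ?_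
  simpa using h s hs

theorem ConcaveOn.le_add_fderiv {Y : Set V} {f : V → ℝ} (hf : ConcaveOn ℝ Y f)
    (hd : Differentiable ℝ f) {y0 y : V} (hy0 : y0 ∈ Y) (hy : y ∈ Y) :
    f y ≤ f y0 + fderiv ℝ f y0 (y - y0) := by
  have := le_of_hasFDerivWithinAt hf.1 (hd y0).hasFDerivAt.hasFDerivWithinAt hy0 hy
    (A := f y - f y0) (B := 0) (fun s hs => by
      have := hf.2 hy0 hy (sub_nonneg.2 hs.2) hs.1.le (by ring)
      simp only [smul_eq_mul] at this
      linarith)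
  linarith

end Derivative

/-! ### Strong convexity and quadratic growth. -/

section Strong

variable {V : Type*} [NormedAddCommGroup V] [NormedSpace ℝ V] {S : Set V} {f g : V → ℝ} {m m' : ℝ}

theorem strongConvexOn_add (hf : StrongConvexOn S m f) (hg : StrongConvexOn S m' g) :
    StrongConvexOn S (m + m') fun x => f x + g x := by
  refine ⟨hf.1, fun x hx y hy a b ha hb hab => ?_⟩
  have h1 := hf.2 hx hy ha hb hab
  have h2 := hg.2 hx hy ha hb hab
  simp only [smul_eq_mul] at *
  linarith

theorem strongConvexOn_of_convexOn (hf : ConvexOn ℝ S f) : StrongConvexOn S 0 f :=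
  strongConvexOn_zero.2 hf

/-- A strongly convex function grows quadratically away from its minimizer. -/
theorem StrongConvexOn.add_sq_le_of_isMin (hf : StrongConvexOn S m f) {x0 : V} (hx0 : x0 ∈ S)
    (hmin : ∀ x ∈ S, f x0 ≤ f x) {x : V} (hx : x ∈ S) : f x0 + m / 2 * ‖x - x0‖ ^ 2 ≤ f x := by
  -- Minimality against the point at parameter `s` of the segment, divided by `s`; the factor `1 -
  -- s` disappears in the limit.
  have key : ∀ s ∈ Set.Ioo (0 : ℝ) 1, (1 - s) * (m / 2 * ‖x - x0‖ ^ 2) ≤ f x - f x0 := by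
    intro s hs
    have h1 := hf.2 hx0 hx (sub_nonneg.2 hs.2.le) hs.1.le (by ring)
    have h2 := hmin _ (hf.1 hx0 hx (sub_nonneg.2 hs.2.le) hs.1.le (by ring))
    simp only [smul_eq_mul] at h1
    rw [norm_sub_rev x0 x] at h1
    have h3 : s * ((1 - s) * (m / 2 * ‖x - x0‖ ^ 2)) ≤ s * (f x - f x0) := by nlinarith
    exact le_of_mul_le_mul_left h3 hs.1
  have h2 : Filter.Tendsto (fun s : ℝ => (1 - s) * (m / 2 * ‖x - x0‖ ^ 2)) (𝓝[>] 0)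
      (𝓝 ((1 - 0) * (m / 2 * ‖x - x0‖ ^ 2))) :=
    (((continuous_const.sub continuous_id).mul continuous_const).tendsto (0 : ℝ)).mono_left
      nhdsWithin_le_nhds
  have h3 := le_of_tendsto h2 (by
    filter_upwards [Ioo_mem_nhdsGT (zero_lt_one' ℝ)] with s hs using key s hs)
  linarith

/-- Use the subgradient at the convex combination and test it at both end points. In the weighted
sum the linear terms cancel, and ab² + ba² = ab gives the quadratic term. -/
theorem StrongConvexOn.of_convex_comb_ge (hS : Convex ℝ S)
    (h : ∀ x ∈ S, ∃ ζ : V →L[ℝ] ℝ, ∀ y ∈ S, f x + ζ (y - x) + m / 2 * ‖y - x‖ ^ 2 ≤ f y) :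
    StrongConvexOn S m f := by
  refine ⟨hS, fun x hx y hy a b ha hb hab => ?_⟩
  obtain ⟨ζ, hζ⟩ := h _ (hS hx hy ha hb hab)
  have h1 := hζ x hx
  have h2 := hζ y hy
  have e1 : x - (a • x + b • y) = b • (x - y) := by
    have : x = (a + b) • x := by rw [hab, one_smul]
    nth_rewrite 1 [this]; rw [add_smul, smul_sub]; abel
  have e2 : y - (a • x + b • y) = a • (y - x) := by
    have : y = (a + b) • y := by rw [hab, one_smul]
    nth_rewrite 1 [this]; rw [add_smul, smul_sub]; abel
  rw [e1, norm_smul, map_smul, mul_pow, Real.norm_eq_abs, sq_abs] at h1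
  rw [e2, norm_smul, map_smul, mul_pow, Real.norm_eq_abs, sq_abs, norm_sub_rev y x,
    ← neg_sub x y, map_neg] at h2
  simp only [smul_eq_mul] at *
  have h3 := mul_le_mul_of_nonneg_left h1 ha
  have h4 := mul_le_mul_of_nonneg_left h2 hb
  have hb' : b = 1 - a := by linarith
  subst hb'
  nlinarith

theorem strongConvexOn_sq_norm_sub {E : Type*} [NormedAddCommGroup E] [InnerProductSpace ℝ E]
    {S : Set E} (hS : Convex ℝ S) (c : ℝ) (p : E) :
    StrongConvexOn S (2 * c) fun x => c * ‖x - p‖ ^ 2 := by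
  refine StrongConvexOn.of_convex_comb_ge hS fun x _ => ⟨(2 * c) • innerSL ℝ (x - p), ?_⟩
  intro y _
  have h : ‖y - p‖ ^ 2 = ‖x - p‖ ^ 2 + 2 * inner ℝ (x - p) (y - x) + ‖y - x‖ ^ 2 := by
    rw [← norm_add_sq_real]; congr 2; abel
  rw [h]
  simp only [smul_apply, innerSL_apply_apply, smul_eq_mul]
  nlinarith

theorem strongConvexOn_congr {f' : V → ℝ} (hf : StrongConvexOn S m f)
    (h : ∀ x, f x = f' x) : StrongConvexOn S m f' := by
  have : f = f' := funext h
  exact this ▸ hf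

end Strong

/-! ### Subgradients, Bregman divergences and proximal optimality. -/

section Subgradient

variable {V : Type*} [NormedAddCommGroup V] [NormedSpace ℝ V]

theorem mem_subdiff_of_forall {h : V → EReal} {x : V} {a : ℝ} (hx : h x = a) {ζ : V →L[ℝ] ℝ}
    (hζ : ∀ x', ((a + ζ (x' - x) : ℝ) : EReal) ≤ h x') : ζ ∈ subdiff h x := by
  refine ⟨by rw [hx]; exact EReal.coe_ne_top _, by rw [hx]; exact EReal.coe_ne_bot _,
    fun c hc => Filter.Eventually.of_forall fun x' => ?_⟩
  refine le_trans ?_ (hζ x')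
  rw [hx, ← EReal.coe_add]
  have : 0 ≤ c * ‖x' - x‖ := by positivity
  exact_mod_cast (by linarith)

/-- Lets weak convexity, which is stated for Fréchet subgradients, be applied to the gradients of f.
-/
theorem fderiv_mem_subdiff {h : V → ℝ} {x : V} (hd : DifferentiableAt ℝ h x) :
    fderiv ℝ h x ∈ subdiff (fun z => (h z : EReal)) x := by
  refine ⟨EReal.coe_ne_top _, EReal.coe_ne_bot _, fun c hc => ?_⟩
  have := hd.hasFDerivAt.isLittleO.def hc
  filter_upwards [this] with z hz
  rw [← EReal.coe_add]
  rw [Real.norm_eq_abs] at hz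
  have := (abs_le.1 hz).1
  exact_mod_cast (by linarith)

variable {Y : Set V} {d : V → ℝ} {d' : V → V →L[ℝ] ℝ}

theorem mem_subdom_of_forall {y0 : V} (hy0 : y0 ∈ Y) {ζ : V →L[ℝ] ℝ}
    (h : ∀ y ∈ Y, d y0 + ζ (y - y0) ≤ d y) : y0 ∈ subdom Y d := by
  classical
  refine ⟨hy0, ζ, mem_subdiff_of_forall (a := d y0) (by simp [extendTop, hy0]) fun x' => ?_⟩
  by_cases hx : x' ∈ Y
  · simp only [extendTop, hx, if_true]
    exact_mod_cast h x' hx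
  · simp [extendTop, hx]

/-- Proximal points land in 𝒴ᵒ by themselves: minimality splits into opposite subgradients of a • d
and k, and dividing the former by a > 0 gives a subgradient of d, continuous because the dimension
is finite. -/
theorem mem_subdom_of_isMin [FiniteDimensional ℝ V] (hd : ConvexOn ℝ Y d) {k : V → ℝ}
    (hk : ConvexOn ℝ Y k) {a : ℝ} (ha : 0 < a) {y0 : V} (hy0 : y0 ∈ Y)
    (hmin : ∀ y ∈ Y, k y0 + a * d y0 ≤ k y + a * d y) : y0 ∈ subdom Y d := by
  obtain ⟨g, hg, -⟩ := exists_linear_of_isMin_add (hd.smul ha.le) hk hy0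
    (fun y hy => by have := hmin y hy; simp only [smul_eq_mul]; linarith)
  refine mem_subdom_of_forall hy0 (ζ := LinearMap.toContinuousLinearMap (a⁻¹ • g)) fun y hy => ?_
  have := hg y hy
  simp only [smul_eq_mul] at this
  have h2 : a⁻¹ * (a * d y0 + g (y - y0)) ≤ a⁻¹ * (a * d y) :=
    mul_le_mul_of_nonneg_left this (by positivity)
  rw [mul_add, ← mul_assoc, ← mul_assoc, inv_mul_cancel₀ ha.ne', one_mul, one_mul] at h2
  simpa using h2

namespace IsDistGen

theorem sq_le_bregman (h : IsDistGen Y d d') {y y' : V} (hy : y ∈ Y) (hy' : y' ∈ subdom Y d) :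
    1 / 2 * ‖y - y'‖ ^ 2 ≤ bregman d d' y y' := by
  have := h.strong y hy y' hy'
  unfold bregman; linarith

theorem bregman_nonneg (h : IsDistGen Y d d') {y y' : V} (hy : y ∈ Y) (hy' : y' ∈ subdom Y d) :
    0 ≤ bregman d d' y y' :=
  le_trans (by positivity) (h.sq_le_bregman hy hy')

/-- First-order optimality in the direction of the distance generating function. -/
theorem le_add_of_isMin (h : IsDistGen Y d d') {k : V → ℝ} (hk : ConvexOn ℝ Y k) {a : ℝ}
    (ha : 0 < a) {y0 : V} (hy0 : y0 ∈ subdom Y d)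
    (hmin : ∀ y ∈ Y, k y0 + a * d y0 ≤ k y + a * d y) {y : V} (hy : y ∈ Y) :
    k y0 ≤ k y + a * d' y0 (y - y0) := by
  have := le_of_hasFDerivWithinAt hk.1 (h.hasGrad y0 hy0) hy0.1 hy
    (A := a⁻¹ * (k y0 - k y)) (B := 0) (fun s hs => by
      have h1 := hk.2 hy0.1 hy (sub_nonneg.2 hs.2) hs.1.le (by ring)
      have h2 := hmin _ (hk.1 hy0.1 hy (sub_nonneg.2 hs.2) hs.1.le (by ring))
      simp only [smul_eq_mul] at h1
      have h3 : s * (k y0 - k y) ≤ a * (d ((1 - s) • y0 + s • y) - d y0) := by linarith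
      have h4 := mul_le_mul_of_nonneg_left h3 (inv_nonneg.2 ha.le)
      rw [← mul_assoc a⁻¹ a, inv_mul_cancel₀ ha.ne'] at h4
      linarith)
  have h2 := mul_le_mul_of_nonneg_left this ha.le
  rw [← mul_assoc, mul_inv_cancel₀ ha.ne'] at h2
  linarith

/-- The minimizer of the distance generating function lies in `Yᵒ`, with nonnegative directional
derivatives. -/
theorem mem_subdom_of_isMinOn {y0 : V} (hy0 : y0 ∈ Y) (hmin : ∀ y ∈ Y, d y0 ≤ d y) :
    y0 ∈ subdom Y d :=
  mem_subdom_of_forall hy0 (ζ := 0) (by simpa using hmin)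

/-- The derivative of d at its minimizer is nonnegative towards every point of the set, so it may be
dropped from the divergence. -/
theorem bregman_le_of_isMinOn (h : IsDistGen Y d d') {y0 : V} (hy0 : y0 ∈ Y)
    (hmin : ∀ y ∈ Y, d y0 ≤ d y) {y : V} (hy : y ∈ Y) : bregman d d' y y0 ≤ d y - d y0 := by
  have := h.le_add_of_isMin (k := fun _ => 0) (convexOn_const 0 h.convex.1) zero_lt_one
    (mem_subdom_of_isMinOn hy0 hmin) (by simpa using hmin) hy
  simp only [zero_add, one_mul] at this
  unfold bregman; linarith

end IsDistGen

/-- Turns the gradient terms of a proximal optimality condition into differences of divergences,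
which telescope. -/
theorem bregman_three_point {y y1 y2 : V} :
    (d' y2 - d' y1) (y - y2)
      = bregman d d' y y1 - bregman d d' y2 y1 - bregman d d' y y2 := by
  unfold bregman
  have : y - y1 = (y - y2) + (y2 - y1) := by abel
  rw [this, map_add, sub_apply]
  ring

variable [FiniteDimensional ℝ V] {r : V → EReal} {μ : ℝ}

/-- Optimality of a Bregman proximal point. -/
theorem StronglyConvexBregman.prox_le (hr : StronglyConvexBregman μ d d' r)
    (hbot : ∀ y, r y ≠ ⊥) (hd : IsDistGen (dom r) d d') {a : ℝ} (ha : 0 < a) {lin : V →L[ℝ] ℝ}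
    {y0 : V} (hy0 : y0 ∈ dom r)
    (hmin : ∀ y ∈ dom r, (r y0).toReal + lin y0 + a * d y0 ≤ (r y).toReal + lin y + a * d y) :
    y0 ∈ subdom (dom r) d ∧ ∀ y ∈ dom r,
      (r y0).toReal + μ * bregman d d' y y0 ≤ (r y).toReal + lin (y - y0) + a * d' y0 (y - y0) := by
  have hk : ConvexOn ℝ (dom r) fun y => (r y).toReal + lin y :=
    hr.convex.add ((lin : V →ₗ[ℝ] ℝ).convexOn hr.convex.1)
  have hy0' := mem_subdom_of_isMin hd.convex hk ha hy0 hmin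
  refine ⟨hy0', ?_⟩
  -- First-order optimality along 𝒴 yields a global subgradient of r at a point of 𝒴ᵒ, exactly what
  -- the Bregman strong convexity of r requires.
  have hsub : -lin - a • d' y0 ∈ subdiff r y0 := by
    refine mem_subdiff_of_forall (coe_toReal_of_mem_dom hbot hy0).symm fun y => ?_
    by_cases hy : y ∈ dom r
    · rw [← coe_toReal_of_mem_dom hbot hy]
      have := hd.le_add_of_isMin hk ha hy0' hmin hy
      rw [EReal.coe_le_coe_iff]
      simp only [sub_apply, neg_apply,
        smul_apply, smul_eq_mul, map_sub] at this ⊢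
      linarith
    · have : r y = ⊤ := by simpa [dom] using hy
      rw [this]; exact le_top
  intro y hy
  have := hr.strong y hy y0 hy0' _ hsub
  simp only [sub_apply, neg_apply,
        smul_apply, smul_eq_mul] at this
  linarith

end Subgradient

end PGSVRG

namespace PGSVRG

/-! ### From Bregman strong convexity to norm strong convexity. -/

section Regularizer

theorem lowerSemicontinuousOn_const_mul {V : Type*} [TopologicalSpace V] {d : V → ℝ} {Y : Set V} (hd : LowerSemicontinuousOn d Y) {a : ℝ}
    (ha : 0 ≤ a) : LowerSemicontinuousOn (fun y => a * d y) Y :=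
  (continuous_const_mul a).comp_lowerSemicontinuousOn hd (monotone_mul_left_of_nonneg ha)

theorem IsProperClosed.lsc_toReal {V : Type*} [TopologicalSpace V] {r : V → EReal}
    (hr : IsProperClosed r) :
    LowerSemicontinuousOn (fun y => (r y).toReal) (dom r) := by
  intro y hy q hq
  have h1 : (q : EReal) < r y := by
    rw [← coe_toReal_of_mem_dom hr.ne_bot hy]; exact_mod_cast hq
  filter_upwards [mem_nhdsWithin_of_mem_nhds (hr.lsc y _ h1), self_mem_nhdsWithin] with z hz hzd
  rw [← coe_toReal_of_mem_dom hr.ne_bot hzd] at hz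
  exact_mod_cast hz

theorem convexOn_mul_sq_norm_sub {V : Type*} [NormedAddCommGroup V] [NormedSpace ℝ V]
    {Y : Set V} (hY : Convex ℝ Y) {a : ℝ} (ha : 0 ≤ a) (m : V) :
    ConvexOn ℝ Y fun y => a * ‖y - m‖ ^ 2 := by
  have h := ((convexOn_dist m hY).pow (fun _ _ => dist_nonneg) 2).smul ha
  simpa only [dist_eq_norm, smul_eq_mul, Pi.pow_apply] using h

variable {V : Type*} [NormedAddCommGroup V] [NormedSpace ℝ V] [FiniteDimensional ℝ V]
  {d : V → ℝ} {d' : V → V →L[ℝ] ℝ} {r : V → EReal} {μ b B : ℝ}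

/-- Every point of the domain is approximated by points of `Yᵒ` at which the regularizer has a
subgradient that is nearly nonnegative in the direction of the given point. -/
theorem StronglyConvexBregman.exists_approx (hr : StronglyConvexBregman μ d d' r)
    (hc : IsProperClosed r) (hd : IsDistGen (dom r) d d') (hbdd : Bornology.IsBounded (dom r))
    (hB : ∀ y ∈ dom r, ∀ y' ∈ dom r, d y - d y' ≤ B) (hb : 0 ≤ b) {ε : ℝ} (hε : 0 < ε) {m : V}
    (hm : m ∈ dom r) :
    ∃ q ∈ subdom (dom r) d, (∃ ζ : V →L[ℝ] ℝ, -(ε * B) ≤ ζ (m - q) ∧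
      ∀ y ∈ dom r, (r q).toReal + b * d q + ζ (y - q) + (μ + b) * bregman d d' y q
        ≤ (r y).toReal + b * d y) ∧
      (r q).toReal + (b + ε) * d q + ε⁻¹ * ‖q - m‖ ^ 2 ≤ (r m).toReal + (b + ε) * d m := by
  have hbε : 0 < b + ε := by linarith
  have hsq : ConvexOn ℝ (dom r) fun y => ε⁻¹ * ‖y - m‖ ^ 2 :=
    convexOn_mul_sq_norm_sub hr.convex.1 (by positivity) m
  -- The penalty ε⁻¹‖· − m‖² pulls the minimizer to `m`; the extra ε d forces it into 𝒴ᵒ even when b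
  -- = 0.
  obtain ⟨q, hq, hmin⟩ := exists_isMinOn_dom_add hc hbdd
    (k := fun y => (b + ε) * d y + ε⁻¹ * ‖y - m‖ ^ 2)
    ((lowerSemicontinuousOn_const_mul hd.lsc hbε.le).add
      ((Continuous.lowerSemicontinuous (f := fun y => ε⁻¹ * ‖y - m‖ ^ 2)
        (by fun_prop)).lowerSemicontinuousOn _))
    (m := (b + ε) * (d m - B)) (fun z hz => by
      have h1 := hB m hm z hz
      have h2 : (b + ε) * (d m - B) ≤ (b + ε) * d z :=
        mul_le_mul_of_nonneg_left (by linarith) hbε.le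
      have h3 : 0 ≤ ε⁻¹ * ‖z - m‖ ^ 2 := by positivity
      linarith)
  have hmin' : ∀ y ∈ dom r, ((r q).toReal + ε⁻¹ * ‖q - m‖ ^ 2) + (b + ε) * d q
      ≤ ((r y).toReal + ε⁻¹ * ‖y - m‖ ^ 2) + (b + ε) * d y := fun y hy => by
    have := hmin y hy; linarith
  have hk : ConvexOn ℝ (dom r) fun y => (r y).toReal + ε⁻¹ * ‖y - m‖ ^ 2 := hr.convex.add hsq
  have hqo := mem_subdom_of_isMin hd.convex hk hbε hq hmin'
  have hopt := fun y hy => hd.le_add_of_isMin hk hbε hqo hmin' (y := y) hy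
  -- Since −g is a subgradient at q of the penalty, which vanishes at m, testing at m gives g(m − q)
  -- ≥ 0. Only −ε d'(q)(m − q) can spoil the sign, by at most εB.
  obtain ⟨g, hg1, hg2⟩ := exists_linear_of_isMin_add
    (f1 := fun y => (r y).toReal + ((b + ε) • d' q) y) (f2 := fun y => ε⁻¹ * ‖y - m‖ ^ 2)
    (hr.convex.add ((((b + ε) • d' q : V →L[ℝ] ℝ) : V →ₗ[ℝ] ℝ).convexOn hr.convex.1)) hsq hq
    (fun y hy => by
      have := hopt y hy
      simp only [map_sub, smul_apply, smul_eq_mul] at this ⊢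
      linarith)
  set G : V →L[ℝ] ℝ := LinearMap.toContinuousLinearMap g with hG
  have hGg : ∀ v, G v = g v := fun v => rfl
  have hsub : G - (b + ε) • d' q ∈ subdiff r q := by
    refine mem_subdiff_of_forall (coe_toReal_of_mem_dom hc.ne_bot hq).symm fun y => ?_
    by_cases hy : y ∈ dom r
    · rw [← coe_toReal_of_mem_dom hc.ne_bot hy]
      have := hg1 y hy
      rw [EReal.coe_le_coe_iff]
      simp only [sub_apply, smul_apply, smul_eq_mul, map_sub, hGg] at this ⊢
      linarith
    · have : r y = ⊤ := by simpa [dom] using hy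
      rw [this]; exact le_top
  refine ⟨q, hqo, ⟨G - ε • d' q, ?_, fun y hy => ?_⟩, ?_⟩
  · have h1 := hg2 m hm
    have h2 := hd.strong m hm q hqo
    have h3 := hB m hm q hq
    have h4 : 0 ≤ ‖m - q‖ ^ 2 := by positivity
    have h5 : 0 ≤ ε⁻¹ * ‖q - m‖ ^ 2 := by positivity
    have h6 : ε * d' q (m - q) ≤ ε * B := mul_le_mul_of_nonneg_left (by linarith) hε.le
    simp only [sub_apply, smul_apply, smul_eq_mul, hGg, sub_self, norm_zero] at *
    linarith
  · have h1 := hr.strong y hy q hqo _ hsub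
    simp only [sub_apply, smul_apply, smul_eq_mul] at *
    have h2 : bregman d d' y q = d y - d q - d' q (y - q) := rfl
    have h3 : b * bregman d d' y q = b * d y - b * d q - b * d' q (y - q) := by rw [h2]; ring
    linarith
  · have := hmin m hm
    simp only [sub_self, norm_zero] at this
    linarith

/-- Strong convexity with respect to the Bregman divergence, which only speaks about base points in
`Yᵒ`, implies strong convexity with respect to the norm on the whole domain. -/
theorem StronglyConvexBregman.strongConvexOn (hr : StronglyConvexBregman μ d d' r)
    (hc : IsProperClosed r) (hd : IsDistGen (dom r) d d') (hbdd : Bornology.IsBounded (dom r))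
    (hB : ∀ y ∈ dom r, ∀ y' ∈ dom r, d y - d y' ≤ B) (hb : 0 ≤ b) (hμb : 0 ≤ μ + b) :
    StrongConvexOn (dom r) (μ + b) fun y => (r y).toReal + b * d y := by
  refine ⟨hr.convex.1, fun u hu w hw α β hα hβ hαβ => ?_⟩
  set m := α • u + β • w with hm_def
  have hm : m ∈ dom r := hr.convex.1 hu hw hα hβ hαβ
  have hB0 : 0 ≤ B := by simpa using hB m hm m hm
  set H : V → ℝ := fun y => (r y).toReal + b * d y with hH
  have hlsc : LowerSemicontinuousOn H (dom r) :=
    hc.lsc_toReal.add (lowerSemicontinuousOn_const_mul hd.lsc hb)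
  obtain ⟨y1, hy1, hr1⟩ := exists_isMinOn_dom_add hc hbdd (k := fun _ => 0) (m := 0)
    lowerSemicontinuousOn_const (fun _ _ => le_rfl)
  simp only [add_zero] at hr1
  have hε : ∀ k : ℕ, (0 : ℝ) < 1 / ((k : ℝ) + 1) := fun k => by positivity
  choose q hqo hζ hqm using fun k : ℕ => hr.exists_approx hc hd hbdd hB hb (hε k) hm
  choose ζ hζ1 hζ2 using hζ
  have hε0 : Filter.Tendsto (fun k : ℕ => 1 / ((k : ℝ) + 1)) Filter.atTop (𝓝 0) :=
    tendsto_one_div_add_atTop_nhds_zero_nat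
  set K := (r m).toReal - (r y1).toReal + (b + 1) * B with hK
  have hbound : ∀ k, ‖q k - m‖ ^ 2 ≤ 1 / ((k : ℝ) + 1) * K := by
    intro k
    have h1 := hqm k
    have h2 := hr1 (q k) (hqo k).1
    have h3 := hB m hm (q k) (hqo k).1
    have h4 : 1 / ((k : ℝ) + 1) ≤ 1 := by
      rw [div_le_one (by positivity)]; have : (0 : ℝ) ≤ k := k.cast_nonneg; linarith
    have h5 : (b + 1 / ((k : ℝ) + 1)) * (d m - d (q k)) ≤ (b + 1) * B :=
      (mul_le_mul_of_nonneg_left h3 (by have := hε k; linarith)).trans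
        (mul_le_mul_of_nonneg_right (by linarith) hB0)
    have h6 : (1 / ((k : ℝ) + 1))⁻¹ * ‖q k - m‖ ^ 2 ≤ K := by rw [hK]; linarith
    have h7 := mul_le_mul_of_nonneg_left h6 (hε k).le
    rwa [← mul_assoc, mul_inv_cancel₀ (hε k).ne', one_mul] at h7
  have hq : Filter.Tendsto q Filter.atTop (𝓝 m) := by
    rw [tendsto_iff_norm_sub_tendsto_zero]
    have h1 : Filter.Tendsto (fun k => ‖q k - m‖ ^ 2) Filter.atTop (𝓝 0) :=
      squeeze_zero (fun _ => by positivity) hbound (by simpa using hε0.mul_const K)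
    have h2 := h1.sqrt
    simpa [Real.sqrt_sq (norm_nonneg _)] using h2
  have hqY : Filter.Tendsto q Filter.atTop (𝓝[dom r] m) :=
    tendsto_nhdsWithin_iff.2 ⟨hq, Filter.Eventually.of_forall fun k => (hqo k).1⟩
  -- Weight the strong inequalities at q_k for u and w and let q_k → m. The linear terms combine to
  -- ζ_k(m − q_k), which is bounded below by −B/(k+1), and η absorbs that H is only lower
  -- semicontinuous at m.
  have key : ∀ η : ℝ, 0 < η → H m - η - 0 * B
      + (μ + b) / 2 * (α * ‖u - m‖ ^ 2 + β * ‖w - m‖ ^ 2) ≤ α * H u + β * H w := by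
    intro η hη
    have hlim : Filter.Tendsto (fun k : ℕ => H m - η - 1 / ((k : ℝ) + 1) * B
        + (μ + b) / 2 * (α * ‖u - q k‖ ^ 2 + β * ‖w - q k‖ ^ 2)) Filter.atTop
        (𝓝 (H m - η - 0 * B + (μ + b) / 2 * (α * ‖u - m‖ ^ 2 + β * ‖w - m‖ ^ 2))) :=
      ((tendsto_const_nhds.sub (hε0.mul_const B)).add
        (((((tendsto_const_nhds.sub hq).norm.pow 2).const_mul α).add
          (((tendsto_const_nhds.sub hq).norm.pow 2).const_mul β)).const_mul _))
    refine le_of_tendsto hlim ?_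
    filter_upwards [hqY.eventually (hlsc m hm (H m - η) (by linarith))] with k hk
    have h1 := mul_le_mul_of_nonneg_left (hζ2 k u hu) hα
    have h2 := mul_le_mul_of_nonneg_left (hζ2 k w hw) hβ
    have h3 := mul_le_mul_of_nonneg_left (mul_le_mul_of_nonneg_left
      (hd.sq_le_bregman hu (hqo k)) hμb) hα
    have h4 := mul_le_mul_of_nonneg_left (mul_le_mul_of_nonneg_left
      (hd.sq_le_bregman hw (hqo k)) hμb) hβ
    have h5 := hζ1 k
    have h6 : ζ k (m - q k) = α * ζ k (u - q k) + β * ζ k (w - q k) := by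
      have : m - q k = α • (u - q k) + β • (w - q k) := by
        rw [hm_def, smul_sub, smul_sub]
        nth_rewrite 1 [← one_smul ℝ (q k)]
        rw [← hαβ, add_smul]; abel
      rw [this, map_add, map_smul, map_smul, smul_eq_mul, smul_eq_mul]
    have h7 : α * H (q k) + β * H (q k) = H (q k) := by rw [← add_mul, hαβ, one_mul]
    simp only [hH] at hk h7 ⊢
    linarith
  have hu' : u - m = β • (u - w) := by
    rw [hm_def, smul_sub]
    nth_rewrite 1 [← one_smul ℝ u]
    rw [← hαβ, add_smul]; abel
  have hw' : w - m = α • (w - u) := by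
    rw [hm_def, smul_sub]
    nth_rewrite 1 [← one_smul ℝ w]
    rw [← hαβ, add_smul]; abel
  rw [hu', hw', norm_smul, norm_smul, mul_pow, mul_pow, Real.norm_eq_abs, Real.norm_eq_abs, sq_abs,
    sq_abs, norm_sub_rev w u] at key
  have e : α * (β ^ 2 * ‖u - w‖ ^ 2) + β * (α ^ 2 * ‖u - w‖ ^ 2) = α * β * ‖u - w‖ ^ 2 := by
    linear_combination (α * β * ‖u - w‖ ^ 2) * hαβ
  rw [e] at key
  simp only [smul_eq_mul]
  refine le_of_forall_pos_le_add fun η hη => ?_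
  have := key η hη
  simp only [hH] at this ⊢
  linarith

end Regularizer

end PGSVRG

namespace PGSVRG

theorem exists_le_of_isBounded {V : Type*} [NormedAddCommGroup V] [NormedSpace ℝ V]
    [FiniteDimensional ℝ V] {S : Set V} (hS : Bornology.IsBounded S) {k : V → ℝ}
    (hk : Continuous k) : ∃ m, ∀ z ∈ S, m ≤ k z := by
  have : ProperSpace V := FiniteDimensional.proper ℝ V
  obtain ⟨m, hm⟩ := hS.isCompact_closure.bddBelow_image hk.continuousOn
  exact ⟨m, fun z hz => hm ⟨z, subset_closure hz, rfl⟩⟩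

/-! ### Consequences of the standing assumptions; the two proximal steps. -/

section Problem

variable {E F : Type*} [NormedAddCommGroup E] [InnerProductSpace ℝ E]
  [NormedAddCommGroup F] [NormedSpace ℝ F] {n : ℕ}

namespace Problem

/-- The `y`-regularizer of a subproblem. -/
noncomputable def regY (D : Problem E F n) (b : ℝ) (y : F) : ℝ :=
  (D.r y).toReal + b * bregman D.d D.d' y (yBar D)

/-- The `x`-regularizer of a subproblem. -/
noncomputable def regX (D : Problem E F n) (γ : ℝ) (xb x : E) : ℝ :=
  (D.g x).toReal + 1 / (2 * γ) * ‖x - xb‖ ^ 2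

namespace Assumptions

variable {D : Problem E F n} {P : Params}

theorem convex_X (hA : D.Assumptions P) : Convex ℝ D.X := hA.g_convex.1

theorem convex_Y (hA : D.Assumptions P) : Convex ℝ D.Y := hA.r_strong.convex.1

theorem yBar_spec (hA : D.Assumptions P) : yBar D ∈ D.Y ∧ ∀ y ∈ D.Y, D.d (yBar D) ≤ D.d y := by
  classical
  obtain ⟨y0, hy0, hmin⟩ := hA.d_min
  have hle := argmin_le (h := extendTop D.Y D.d) ⟨y0, fun w => by
    by_cases hw : w ∈ D.Y
    · simp only [extendTop, hy0, hw, if_true]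
      exact_mod_cast hmin hw
    · simp [extendTop, hw]⟩
  change ∀ w, extendTop D.Y D.d (yBar D) ≤ _ at hle
  have hmem : yBar D ∈ D.Y := by
    by_contra hcon
    have := hle y0
    simp only [extendTop, hcon, hy0, if_true, if_false, top_le_iff] at this
    exact EReal.coe_ne_top _ this
  refine ⟨hmem, fun y hy => ?_⟩
  have := hle y
  simp only [extendTop, hmem, hy, if_true] at this
  exact_mod_cast this

theorem yBar_mem_subdom (hA : D.Assumptions P) : yBar D ∈ subdom D.Y D.d :=
  IsDistGen.mem_subdom_of_isMinOn hA.yBar_spec.1 hA.yBar_spec.2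

theorem d_sub_le (hA : D.Assumptions P) {y y' : F} (hy : y ∈ D.Y) (hy' : y' ∈ D.Y) :
    D.d y - D.d y' ≤ P.Dy ^ 2 / 2 := by
  have hbb : BddBelow (D.d '' D.Y) :=
    ⟨D.d (yBar D), by rintro _ ⟨z, hz, rfl⟩; exact hA.yBar_spec.2 z hz⟩
  have h1 := le_csSup hA.d_bddAbove ⟨y, hy, rfl⟩
  have h2 := csInf_le hbb ⟨y', hy', rfl⟩
  have h3 := csInf_le hbb ⟨y, hy, rfl⟩
  rw [hA.Dy_eq, Real.sq_sqrt (by linarith)]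
  linarith

theorem bregman_yBar_le (hA : D.Assumptions P) {y : F} (hy : y ∈ D.Y) :
    bregman D.d D.d' y (yBar D) ≤ P.Dy ^ 2 / 2 :=
  (hA.distGen.bregman_le_of_isMinOn hA.yBar_spec.1 hA.yBar_spec.2 hy).trans
    (hA.d_sub_le hy hA.yBar_spec.1)

theorem bregman_yBar_nonneg (hA : D.Assumptions P) {y : F} (hy : y ∈ D.Y) :
    0 ≤ bregman D.d D.d' y (yBar D) :=
  hA.distGen.bregman_nonneg hy hA.yBar_mem_subdom

/-- Since ½‖y − ȳ‖² ≤ V(y, ȳ) ≤ D_y²/2, the bounded variation of d bounds 𝒴. -/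
theorem bounded_Y (hA : D.Assumptions P) : Bornology.IsBounded D.Y := by
  refine (Metric.isBounded_closedBall (x := yBar D) (r := |P.Dy|)).subset fun y hy => ?_
  have h1 := hA.distGen.sq_le_bregman hy hA.yBar_mem_subdom
  have h2 := hA.bregman_yBar_le hy
  rw [Metric.mem_closedBall, dist_eq_norm]
  refine le_trans (le_abs_self _) (sq_le_sq.1 ?_)
  linarith

theorem norm_sub_le_diam (hA : D.Assumptions P) {x x' : E} (hx : x ∈ D.X) (hx' : x' ∈ D.X) :
    ‖x - x'‖ ≤ P.Dx := by
  rw [hA.Dx_eq, ← dist_eq_norm]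
  exact Metric.dist_le_diam_of_mem hA.bounded_X hx hx'

theorem differentiable_fi_x (hA : D.Assumptions P) (i : Fin n) (y : F) :
    Differentiable ℝ fun x => D.fi i x y :=
  (hA.differentiable i).comp (differentiable_id.prodMk (differentiable_const y))

theorem differentiable_fi_y (hA : D.Assumptions P) (i : Fin n) (x : E) :
    Differentiable ℝ fun y => D.fi i x y :=
  (hA.differentiable i).comp ((differentiable_const x).prodMk differentiable_id)

theorem differentiable_f_x (hA : D.Assumptions P) (y : F) : Differentiable ℝ fun x => D.f x y :=
  (Differentiable.fun_sum fun i _ => hA.differentiable_fi_x i y).const_mul _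

theorem differentiable_f_y (hA : D.Assumptions P) (x : E) : Differentiable ℝ fun y => D.f x y :=
  (Differentiable.fun_sum fun i _ => hA.differentiable_fi_y i x).const_mul _

theorem gradX_f (hA : D.Assumptions P) (x : E) (y : F) :
    gradX D.f x y = (1 / (n : ℝ)) • ∑ i, gradX (D.fi i) x y := by
  unfold gradX Problem.f
  rw [fderiv_const_mul (DifferentiableAt.fun_sum fun i _ => hA.differentiable_fi_x i y x),
    fderiv_fun_sum fun i _ => hA.differentiable_fi_x i y x]

theorem gradY_f (hA : D.Assumptions P) (x : E) (y : F) :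
    gradY D.f x y = (1 / (n : ℝ)) • ∑ i, gradY (D.fi i) x y := by
  unfold gradY Problem.f
  rw [fderiv_const_mul (DifferentiableAt.fun_sum fun i _ => hA.differentiable_fi_y i x y),
    fderiv_fun_sum fun i _ => hA.differentiable_fi_y i x y]

theorem norm_avg_le {G : Type*} [NormedAddCommGroup G] [NormedSpace ℝ G] (hn : 0 < n)
    {v : Fin n → G} {c : ℝ} (h : ∀ i, ‖v i‖ ≤ c) : ‖(1 / (n : ℝ)) • ∑ i, v i‖ ≤ c := by
  have hn' : (0 : ℝ) < n := by exact_mod_cast hn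
  rw [norm_smul, Real.norm_eq_abs, abs_of_pos (by positivity)]
  have h1 : ‖∑ i, v i‖ ≤ n * c := by
    refine (norm_sum_le _ _).trans ((Finset.sum_le_sum fun i _ => h i).trans ?_)
    simp
  calc _ ≤ 1 / (n : ℝ) * (n * c) := by gcongr
    _ = c := by field_simp

theorem lipschitz_gradX_f (hA : D.Assumptions P) (hn : 0 < n) {x x' : E} {y y' : F}
    (hx : x ∈ D.X) (hx' : x' ∈ D.X) (hy : y ∈ D.Y) (hy' : y' ∈ D.Y) :
    ‖gradX D.f x y - gradX D.f x' y'‖ ≤ P.Lx * √(‖x - x'‖ ^ 2 + ‖y - y'‖ ^ 2) := by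
  have e : gradX D.f x y - gradX D.f x' y'
      = (1 / (n : ℝ)) • ∑ i, (gradX (D.fi i) x y - gradX (D.fi i) x' y') := by
    rw [hA.gradX_f, hA.gradX_f, Finset.sum_sub_distrib]
    exact (smul_sub _ _ _).symm
  rw [e]
  exact norm_avg_le hn fun i => hA.lipschitz_gradX i x hx x' hx' y hy y' hy'

theorem lipschitz_gradY_f (hA : D.Assumptions P) (hn : 0 < n) {x x' : E} {y y' : F}
    (hx : x ∈ D.X) (hx' : x' ∈ D.X) (hy : y ∈ D.Y) (hy' : y' ∈ D.Y) :
    ‖gradY D.f x y - gradY D.f x' y'‖ ≤ P.Ly * √(‖x - x'‖ ^ 2 + ‖y - y'‖ ^ 2) := by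
  have e : gradY D.f x y - gradY D.f x' y'
      = (1 / (n : ℝ)) • ∑ i, (gradY (D.fi i) x y - gradY (D.fi i) x' y') := by
    rw [hA.gradY_f, hA.gradY_f, Finset.sum_sub_distrib]
    exact (smul_sub _ _ _).symm
  rw [e]
  exact norm_avg_le hn fun i => hA.lipschitz_gradY i x hx x' hx' y hy y' hy'

theorem f_x_ge (hA : D.Assumptions P) {x x' : E} {y : F} (hx : x ∈ D.X) (hx' : x' ∈ D.X)
    (hy : y ∈ D.Y) :
    D.f x' y + gradX D.f x' y (x - x') - P.ρ / 2 * ‖x - x'‖ ^ 2 ≤ D.f x y :=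
  hA.weakly_convex y hy x hx x' hx' _ (fderiv_mem_subdiff (hA.differentiable_f_x y x'))

/-- Weak convexity is recorded with the negative modulus −ρ, so that adding the proximal term just
adds moduli: −ρ + 1/γ = μ_x. -/
theorem strongConvexOn_f (hA : D.Assumptions P) {y : F} (hy : y ∈ D.Y) :
    StrongConvexOn D.X (-P.ρ) fun x => D.f x y :=
  StrongConvexOn.of_convex_comb_ge hA.convex_X fun x hx => ⟨gradX D.f x y, fun x' hx' => by
    have := hA.f_x_ge hx' hx hy
    linarith⟩

theorem f_y_le (hA : D.Assumptions P) {x : E} {y y' : F} (hx : x ∈ D.X) (hy : y ∈ D.Y)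
    (hy' : y' ∈ D.Y) : D.f x y' ≤ D.f x y + gradY D.f x y (y' - y) :=
  ConcaveOn.le_add_fderiv (hA.concave x hx) (hA.differentiable_f_y x) hy hy'

/-- Mixed second-order bound for the coupling function. -/
theorem f_mixed_le (hA : D.Assumptions P) (hn : 0 < n) {x x' : E} {y y' : F}
    (hx : x ∈ D.X) (hx' : x' ∈ D.X) (hy : y ∈ D.Y) (hy' : y' ∈ D.Y) :
    D.f x y - D.f x y' - (D.f x' y - D.f x' y') ≤ P.Ly * ‖x - x'‖ * ‖y - y'‖ := by
  -- Mean value inequality in y for f(x, ·) − f(x', ·), whose gradient has norm at most L_y ‖x −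
  -- x'‖.
  have h := Convex.norm_image_sub_le_of_norm_hasFDerivWithin_le (𝕜 := ℝ)
    (f := fun z => D.f x z - D.f x' z) (f' := fun z => gradY D.f x z - gradY D.f x' z)
    (s := D.Y) (C := P.Ly * ‖x - x'‖)
    (fun z _ => (((hA.differentiable_f_y x z).hasFDerivAt).sub
      ((hA.differentiable_f_y x' z).hasFDerivAt)).hasFDerivWithinAt)
    (fun z hz => by
      have := hA.lipschitz_gradY_f hn hx hx' hz hz
      simpa [Real.sqrt_sq (norm_nonneg _)] using this) hA.convex_Y hy' hy
  have := (abs_le.1 h).2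
  linarith

theorem strongConvexOn_regX (hA : D.Assumptions P) (γ : ℝ) (xb : E) :
    StrongConvexOn D.X (1 / γ) (D.regX γ xb) := by
  have h := strongConvexOn_add (strongConvexOn_of_convexOn hA.g_convex)
    (strongConvexOn_sq_norm_sub hA.convex_X (1 / (2 * γ)) xb)
  have e : 0 + 2 * (1 / (2 * γ)) = 1 / γ := by ring
  rw [e] at h
  exact h

theorem strongConvexOn_f_add_regX (hA : D.Assumptions P) (γ : ℝ) (xb : E) {y : F}
    (hy : y ∈ D.Y) : StrongConvexOn D.X (muX P γ) fun x => D.f x y + D.regX γ xb x := by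
  have h := strongConvexOn_add (hA.strongConvexOn_f hy) (hA.strongConvexOn_regX γ xb)
  have e : -P.ρ + 1 / γ = muX P γ := by unfold muX; ring
  rwa [e] at h

variable [FiniteDimensional ℝ F]

/-- V(·, ȳ) differs from d by an affine function, so the modulus of r + b d carries over. -/
theorem strongConvexOn_regY (hA : D.Assumptions P) (hμ : 0 ≤ P.μ) {b : ℝ} (hb : 0 ≤ b) :
    StrongConvexOn D.Y (muY P b) (D.regY b) := by
  have h := hA.r_strong.strongConvexOn hA.r_closed hA.distGen hA.bounded_Y
    (B := P.Dy ^ 2 / 2) (fun y hy y' hy' => hA.d_sub_le hy hy') hb (by linarith)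
  set L : F →L[ℝ] ℝ := -(b • D.d' (yBar D)) with hL
  have h2 : ConvexOn ℝ D.Y fun y => L y + (b * D.d' (yBar D) (yBar D) - b * D.d (yBar D)) :=
    ((L : F →ₗ[ℝ] ℝ).convexOn hA.convex_Y).add_const _
  have h3 := strongConvexOn_add h (strongConvexOn_of_convexOn h2)
  have e : P.μ + b + 0 = muY P b := by unfold muY; ring
  rw [e] at h3
  refine strongConvexOn_congr h3 fun y => ?_
  simp only [regY, bregman, hL, neg_apply, smul_apply, smul_eq_mul, map_sub]
  ring

theorem strongConvexOn_regY_sub_f (hA : D.Assumptions P) (hμ : 0 ≤ P.μ) {b : ℝ} (hb : 0 ≤ b)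
    {x : E} (hx : x ∈ D.X) : StrongConvexOn D.Y (muY P b) fun y => D.regY b y - D.f x y := by
  have h := strongConvexOn_add (hA.strongConvexOn_regY hμ hb)
    (strongConvexOn_of_convexOn (hA.concave x hx).neg)
  rw [add_zero] at h
  refine strongConvexOn_congr h fun y => ?_
  simp [sub_eq_add_neg]

/-- The proximal step in `y`. -/
theorem proxY_spec (hA : D.Assumptions P) {b η : ℝ} (hb : 0 ≤ b) (hη : 0 < η) (gy : F →L[ℝ] ℝ)
    (yj : F) {yp : F}
    (hyp : yp = argmin fun z => ((-gy z + 1 / η * bregman D.d D.d' z yj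
        + b * bregman D.d D.d' z (yBar D) : ℝ) : EReal) + D.r z) :
    yp ∈ subdom D.Y D.d ∧ ∀ y ∈ D.Y, D.regY b yp - D.regY b y - gy (yp - y)
      ≤ 1 / η * (bregman D.d D.d' y yj - bregman D.d D.d' yp yj - bregman D.d D.d' y yp)
        - muY P b * bregman D.d D.d' y yp := by
  have ha : 0 < 1 / η + b := by positivity
  -- Up to a constant, the two divergences and the linear term merge into `lin` plus a single
  -- multiple of d.
  set lin : F →L[ℝ] ℝ := -gy - (1 / η) • D.d' yj - b • D.d' (yBar D) with hlin
  have hk : ∀ z, -gy z + 1 / η * bregman D.d D.d' z yj + b * bregman D.d D.d' z (yBar D)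
      = (lin z + (1 / η + b) * D.d z) + (1 / η * (D.d' yj yj - D.d yj)
        + b * (D.d' (yBar D) (yBar D) - D.d (yBar D))) := by
    intro z
    simp only [bregman, hlin, sub_apply, neg_apply, smul_apply, smul_eq_mul, map_sub]
    ring
  obtain ⟨m, hm⟩ := exists_le_of_isBounded hA.bounded_Y lin.continuous
  have hex := exists_isMinOn_dom_add hA.r_closed hA.bounded_Y
    (k := fun z => lin z + (1 / η + b) * D.d z)
    ((lin.continuous.lowerSemicontinuous.lowerSemicontinuousOn _).add
      (lowerSemicontinuousOn_const_mul hA.distGen.lsc ha.le))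
    (m := m + (1 / η + b) * D.d (yBar D)) (fun z hz =>
      add_le_add (hm z hz) (mul_le_mul_of_nonneg_left (hA.yBar_spec.2 z hz) ha.le))
  obtain ⟨hyp1, hyp2⟩ := argmin_coe_add hA.r_closed.ne_bot
    (k := fun z => -gy z + 1 / η * bregman D.d D.d' z yj + b * bregman D.d D.d' z (yBar D)) (by
      obtain ⟨y, hy, hmin⟩ := hex
      refine ⟨y, hy, fun z hz => ?_⟩
      rw [hk, hk]
      linarith [hmin z hz])
  rw [← hyp] at hyp1 hyp2
  obtain ⟨hyo, hle⟩ := hA.r_strong.prox_le hA.r_closed.ne_bot hA.distGen ha (lin := lin) hyp1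
    (fun y hy => by
      have := hyp2 y hy
      rw [hk, hk] at this
      linarith)
  refine ⟨hyo, fun y hy => ?_⟩
  have h1 := hle y hy
  have t1 := bregman_three_point (d := D.d) (d' := D.d') (y := y) (y1 := yj) (y2 := yp)
  have t2 := bregman_three_point (d := D.d) (d' := D.d') (y := y) (y1 := yBar D) (y2 := yp)
  have t1' := congrArg (fun w => 1 / η * w) t1
  have t2' := congrArg (fun w => b * w) t2
  have e1 : gy (y - yp) = -gy (yp - y) := by rw [← map_neg, neg_sub]
  simp only [hlin, regY, muY, sub_apply, neg_apply, smul_apply, smul_eq_mul] at *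
  linarith

end Assumptions

end Problem

end Problem

section ProxX

variable {E F : Type*} [NormedAddCommGroup E] [InnerProductSpace ℝ E] [FiniteDimensional ℝ E]
  [NormedAddCommGroup F] [NormedSpace ℝ F] {n : ℕ} {D : Problem E F n} {P : Params}

/-- The proximal step in `x`. -/
theorem Problem.Assumptions.proxX_spec (hA : D.Assumptions P) (γ η : ℝ) (gx : E →L[ℝ] ℝ)
    (xb xj : E) {xp : E}
    (hxp : xp = argmin fun z => ((gx z + 1 / (2 * η) * ‖z - xj‖ ^ 2
        + 1 / (2 * γ) * ‖z - xb‖ ^ 2 : ℝ) : EReal) + D.g z) :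
    xp ∈ D.X ∧ ∀ x ∈ D.X, D.regX γ xb xp - D.regX γ xb x + gx (xp - x)
      ≤ 1 / (2 * η) * (‖x - xj‖ ^ 2 - ‖xp - xj‖ ^ 2 - ‖x - xp‖ ^ 2)
        - 1 / (2 * γ) * ‖x - xp‖ ^ 2 := by
  have hcont : Continuous fun z => gx z + 1 / (2 * η) * ‖z - xj‖ ^ 2
        + 1 / (2 * γ) * ‖z - xb‖ ^ 2 := by fun_prop
  obtain ⟨m, hm⟩ := exists_le_of_isBounded hA.bounded_X hcont
  obtain ⟨hx1, hx2⟩ := argmin_coe_add hA.g_closed.ne_bot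
    (exists_isMinOn_dom_add hA.g_closed hA.bounded_X
      (hcont.lowerSemicontinuous.lowerSemicontinuousOn _) hm)
  rw [← hxp] at hx1 hx2
  refine ⟨hx1, fun x hx => ?_⟩
  have hlin : ConvexOn ℝ D.X fun z => gx z := (gx : E →ₗ[ℝ] ℝ).convexOn hA.convex_X
  have hs := strongConvexOn_add (strongConvexOn_add (hA.strongConvexOn_regX γ xb)
    (strongConvexOn_of_convexOn hlin)) (strongConvexOn_sq_norm_sub hA.convex_X (1 / (2 * η)) xj)
  have h := StrongConvexOn.add_sq_le_of_isMin hs hx1 (fun z hz => by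
    have := hx2 z hz
    simp only [Problem.regX] at this ⊢
    linarith) hx
  have e : (1 / γ + 0 + 2 * (1 / (2 * η))) / 2 = 1 / (2 * γ) + 1 / (2 * η) := by ring
  rw [e] at h
  rw [map_sub]
  linarith

end ProxX

end PGSVRG

namespace PGSVRG

/-! ### Saddle points of the regularized subproblem. -/

section Saddle

variable {E F : Type*} [NormedAddCommGroup E] [InnerProductSpace ℝ E]
  [NormedAddCommGroup F] [NormedSpace ℝ F] {n : ℕ}

/-- `(xs, ys)` is the saddle point of the regularized problem, with quadratic growth. -/
structure IsSaddle (D : Problem E F n) (P : Params) (γ b : ℝ) (xb xs : E) (ys : F) : Prop where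
  mem_X : xs ∈ D.X
  mem_Y : ys ∈ D.Y
  growth_x : ∀ x ∈ D.X, D.f xs ys + D.regX γ xb xs + muX P γ / 2 * ‖x - xs‖ ^ 2
    ≤ D.f x ys + D.regX γ xb x
  growth_y : ∀ y ∈ D.Y, D.regY b ys - D.f xs ys + muY P b / 2 * ‖y - ys‖ ^ 2
    ≤ D.regY b y - D.f xs y

variable {D : Problem E F n} {P : Params} {γ b : ℝ} {xb : E}

theorem Problem.Assumptions.exists_best_response [FiniteDimensional ℝ F] (hA : D.Assumptions P)
    (hμ : 0 ≤ P.μ) (hb : 0 ≤ b) {x : E} (hx : x ∈ D.X) :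
    ∃ ys ∈ D.Y, ∀ y ∈ D.Y, D.regY b ys - D.f x ys + muY P b / 2 * ‖y - ys‖ ^ 2
      ≤ D.regY b y - D.f x y := by
  have hcont : Continuous fun y => -(b * D.d' (yBar D) (y - yBar D)) - b * D.d (yBar D) - D.f x y :=
    ((by fun_prop : Continuous fun y => -(b * D.d' (yBar D) (y - yBar D)) - b * D.d (yBar D))).sub
      (hA.differentiable_f_y x).continuous
  obtain ⟨m, hm⟩ := exists_le_of_isBounded hA.bounded_Y hcont
  obtain ⟨ys, hys, hmin⟩ := exists_isMinOn_dom_add hA.r_closed hA.bounded_Y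
    (k := fun y => b * D.d y
      + (-(b * D.d' (yBar D) (y - yBar D)) - b * D.d (yBar D) - D.f x y))
    ((lowerSemicontinuousOn_const_mul hA.distGen.lsc hb).add
      (hcont.lowerSemicontinuous.lowerSemicontinuousOn _))
    (m := b * D.d (yBar D) + m) (fun z hz =>
      add_le_add (mul_le_mul_of_nonneg_left (hA.yBar_spec.2 z hz) hb) (hm z hz))
  refine ⟨ys, hys, fun y hy => ?_⟩
  exact StrongConvexOn.add_sq_le_of_isMin (hA.strongConvexOn_regY_sub_f hμ hb hx) hys
    (fun z hz => by
      have := hmin z hz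
      simp only [Problem.regY, bregman]
      linarith) hy

/-- In place of a minimax theorem, let xs minimize the value function and take the best response
there. That xs is optimal against this fixed response is a Danskin-type argument based on the
continuity of best responses. -/
theorem Problem.Assumptions.exists_saddle [FiniteDimensional ℝ E] [FiniteDimensional ℝ F]
    (hA : D.Assumptions P) (hn : 0 < n) (hμ : 0 ≤ P.μ) (hb : 0 ≤ b) (hμY : 0 < muY P b)
    (hμX : 0 ≤ muX P γ) (xb : E) : ∃ xs ys, IsSaddle D P γ b xb xs ys := by
  classical
  have hbr : ∀ x : E, ∃ ys ∈ D.Y, x ∈ D.X → ∀ y ∈ D.Y,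
      D.regY b ys - D.f x ys + muY P b / 2 * ‖y - ys‖ ^ 2 ≤ D.regY b y - D.f x y := by
    intro x
    by_cases hx : x ∈ D.X
    · obtain ⟨ys, hys, h⟩ := hA.exists_best_response hμ hb hx
      exact ⟨ys, hys, fun _ => h⟩
    · exact ⟨yBar D, hA.yBar_spec.1, fun h => absurd h hx⟩
  choose ρ hρY hρ using hbr
  have hbest : ∀ x ∈ D.X, ∀ y ∈ D.Y, D.f x y - D.regY b y ≤ D.f x (ρ x) - D.regY b (ρ x) := by
    intro x hx y hy
    have h1 := hρ x hx y hy
    have : 0 ≤ muY P b / 2 * ‖y - ρ x‖ ^ 2 := by positivity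
    linarith
  have hquad : Continuous fun x : E => 1 / (2 * γ) * ‖x - xb‖ ^ 2 := by fun_prop
  -- The value function is a supremum of functions continuous in x.
  have hlsc : LowerSemicontinuousOn
      (fun x => D.f x (ρ x) - D.regY b (ρ x) + 1 / (2 * γ) * ‖x - xb‖ ^ 2) D.X := by
    refine LowerSemicontinuousOn.add ?_ (hquad.lowerSemicontinuous.lowerSemicontinuousOn _)
    intro x hx q hq
    have hc : ContinuousAt (fun z => D.f z (ρ x) - D.regY b (ρ x)) x :=
      ((hA.differentiable_f_x (ρ x)).continuous.sub continuous_const).continuousAt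
    filter_upwards [mem_nhdsWithin_of_mem_nhds (hc.eventually (lt_mem_nhds hq)),
      self_mem_nhdsWithin] with z hz hzX
    exact lt_of_lt_of_le hz (hbest z hzX _ (hρY x))
  obtain ⟨m, hm⟩ := exists_le_of_isBounded hA.bounded_X
    (((hA.differentiable_f_x (yBar D)).continuous.sub
      (continuous_const (y := D.regY b (yBar D)))).add hquad)
  obtain ⟨xs, hxs, hmin⟩ := exists_isMinOn_dom_add hA.g_closed hA.bounded_X hlsc
    (m := m) (fun z hz => by
      have h1 := hm z hz
      have h2 := hbest z hz _ hA.yBar_spec.1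
      simp only [Pi.add_apply, Pi.sub_apply] at h1
      linarith)
  change xs ∈ D.X at hxs
  refine ⟨xs, ρ xs, hxs, hρY xs, ?_, hρ xs hxs⟩
  -- Approach xs along the segment from x. Against the response at x_k, moving from xs to x_k does
  -- not decrease the objective; convexity extends this comparison to x, and k → ∞ replaces the
  -- response by the one at xs.
  have hopt : ∀ x ∈ D.X, D.f xs (ρ xs) + D.regX γ xb xs ≤ D.f x (ρ xs) + D.regX γ xb x := by
    intro x hx
    set s : ℕ → ℝ := fun k => 1 / ((k : ℝ) + 1) with hs
    have hs0 : ∀ k, 0 < s k := fun k => by simp only [hs]; positivity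
    have hs1 : ∀ k, s k ≤ 1 := fun k => by
      simp only [hs]
      rw [div_le_one (by positivity)]; have : (0 : ℝ) ≤ k := k.cast_nonneg; linarith
    have hslim : Filter.Tendsto s Filter.atTop (𝓝 0) := tendsto_one_div_add_atTop_nhds_zero_nat
    set xk : ℕ → E := fun k => (1 - s k) • xs + s k • x with hxk
    have hxkX : ∀ k, xk k ∈ D.X := fun k =>
      hA.convex_X hxs hx (sub_nonneg.2 (hs1 k)) (hs0 k).le (by ring)
    have hdist : ∀ k, ‖xk k - xs‖ = s k * ‖x - xs‖ := fun k => by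
      have : xk k - xs = s k • (x - xs) := by
        simp only [hxk, sub_smul, one_smul, smul_sub]; abel
      rw [this, norm_smul, Real.norm_eq_abs, abs_of_pos (hs0 k)]
    -- The two growth inequalities added, with one factor ‖ρ(x_k) − ρ(x_s)‖ cancelled: best
    -- responses are Lipschitz along the segment.
    have hy : ∀ k, muY P b * ‖ρ (xk k) - ρ xs‖ ≤ P.Ly * (s k * ‖x - xs‖) := by
      intro k
      have h1 := hρ xs hxs _ (hρY (xk k))
      have h2 := hρ (xk k) (hxkX k) _ (hρY xs)
      have h3 := hA.f_mixed_le hn (hxkX k) hxs (hρY (xk k)) (hρY xs)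
      rw [norm_sub_rev (ρ xs)] at h2
      rw [hdist] at h3
      rcases (norm_nonneg (ρ (xk k) - ρ xs)).eq_or_lt with h0 | h0
      · have hk : ρ (xk k) = ρ xs := sub_eq_zero.1 (norm_eq_zero.1 h0.symm)
        -- Used only to see that the right-hand side is nonnegative, as no sign of `P.Ly` is assumed
        -- here.
        have h4 := hA.lipschitz_gradY_f hn (hxkX k) hxs (hρY xs) (hρY xs)
        have h5 := (norm_nonneg _).trans h4
        rwa [sub_self (ρ xs), norm_zero, hdist, zero_pow two_ne_zero, add_zero,
          Real.sqrt_sq (mul_nonneg (hs0 k).le (norm_nonneg _)), ← mul_zero (muY P b), h0] at h5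
      · refine le_of_mul_le_mul_right ?_ h0
        linarith
    have hylim : Filter.Tendsto (fun k => ρ (xk k)) Filter.atTop (𝓝 (ρ xs)) := by
      rw [tendsto_iff_norm_sub_tendsto_zero]
      refine squeeze_zero (fun _ => norm_nonneg _)
        (g := fun k => (muY P b)⁻¹ * (P.Ly * (s k * ‖x - xs‖))) (fun k => ?_) ?_
      · rw [le_inv_mul_iff₀ hμY]; exact hy k
      · simpa using ((hslim.mul_const ‖x - xs‖).const_mul P.Ly).const_mul (muY P b)⁻¹
    have hineq : ∀ k, D.f xs (ρ (xk k)) + D.regX γ xb xs ≤ D.f x (ρ (xk k)) + D.regX γ xb x := by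
      intro k
      have hge := hmin (xk k) (hxkX k)
      have hb1 := hbest xs hxs _ (hρY (xk k))
      have h1 : D.f xs (ρ (xk k)) + D.regX γ xb xs ≤ D.f (xk k) (ρ (xk k)) + D.regX γ xb (xk k) := by
        simp only [Problem.regX]
        linarith
      have hconv := (hA.strongConvexOn_f_add_regX γ xb (hρY (xk k))).2 hxs hx
        (sub_nonneg.2 (hs1 k)) (hs0 k).le (by ring)
      simp only [smul_eq_mul] at hconv
      change D.f (xk k) _ + D.regX γ xb (xk k) ≤ _ at hconv
      have h4 : s k * (D.f xs (ρ (xk k)) + D.regX γ xb xs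
          + (1 - s k) * (muX P γ / 2 * ‖xs - x‖ ^ 2))
          ≤ s k * (D.f x (ρ (xk k)) + D.regX γ xb x) := by nlinarith
      have h5 := le_of_mul_le_mul_left h4 (hs0 k)
      have h6 : 0 ≤ (1 - s k) * (muX P γ / 2 * ‖xs - x‖ ^ 2) :=
        mul_nonneg (sub_nonneg.2 (hs1 k)) (by positivity)
      linarith
    have hc1 : Continuous fun y => D.f xs y + D.regX γ xb xs :=
      (hA.differentiable_f_y xs).continuous.add continuous_const
    have hc2 : Continuous fun y => D.f x y + D.regX γ xb x :=
      (hA.differentiable_f_y x).continuous.add continuous_const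
    exact le_of_tendsto_of_tendsto' ((hc1.tendsto _).comp hylim) ((hc2.tendsto _).comp hylim) hineq
  exact fun x hx => StrongConvexOn.add_sq_le_of_isMin
    (hA.strongConvexOn_f_add_regX γ xb (hρY xs)) hxs hopt hx

end Saddle

end PGSVRG

namespace PGSVRG

/-! ### Potential, gap and the deterministic one-step inequality. -/

section Step

/-- Averages minimize the mean square deviation. -/
theorem sum_norm_sub_avg_sq_le {H : Type*} [NormedAddCommGroup H] [InnerProductSpace ℝ H] {n : ℕ}
    (hn : 0 < n) (v : Fin n → H) :
    ∑ i, ‖(1 / (n : ℝ)) • ∑ j, v j - v i‖ ^ 2 ≤ ∑ i, ‖v i‖ ^ 2 := by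
  have hn' : (n : ℝ) ≠ 0 := by exact_mod_cast hn.ne'
  set c := (1 / (n : ℝ)) • ∑ j, v j with hc
  have hsum : ∑ j, v j = (n : ℝ) • c := by rw [hc, smul_smul, mul_one_div_cancel hn', one_smul]
  have h1 : ∀ i, ‖c - v i‖ ^ 2 = ‖c‖ ^ 2 - 2 * inner ℝ c (v i) + ‖v i‖ ^ 2 := fun i =>
    norm_sub_sq_real c (v i)
  simp only [h1, Finset.sum_add_distrib, Finset.sum_sub_distrib, ← Finset.mul_sum, ← inner_sum]
  rw [hsum, inner_smul_right, real_inner_self_eq_norm_sq]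
  simp only [Finset.sum_const, Finset.card_univ, Fintype.card_fin, nsmul_eq_mul]
  have : 0 ≤ (n : ℝ) * ‖c‖ ^ 2 := by positivity
  linarith

/-- The Riesz isometry carries the variance inequality over to gradients in x. For y, with an
arbitrary norm, it may fail. -/
theorem sum_dual_norm_sub_avg_sq_le {H : Type*} [NormedAddCommGroup H] [InnerProductSpace ℝ H]
    [CompleteSpace H] {n : ℕ} (hn : 0 < n) (v : Fin n → H →L[ℝ] ℝ) :
    ∑ i, ‖(1 / (n : ℝ)) • ∑ j, v j - v i‖ ^ 2 ≤ ∑ i, ‖v i‖ ^ 2 := by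
  have h := sum_norm_sub_avg_sq_le hn fun i => (InnerProductSpace.toDual ℝ H).symm (v i)
  have e : ∀ i, (1 / (n : ℝ)) • ∑ j, (InnerProductSpace.toDual ℝ H).symm (v j)
      - (InnerProductSpace.toDual ℝ H).symm (v i)
      = (InnerProductSpace.toDual ℝ H).symm ((1 / (n : ℝ)) • ∑ j, v j - v i) := fun i => by
    rw [map_sub, map_smulₛₗ, map_sum]; simp
  simpa only [e, LinearIsometryEquiv.norm_map] using h

variable {E F : Type*} [NormedAddCommGroup E] [InnerProductSpace ℝ E]
  [NormedAddCommGroup F] [NormedSpace ℝ F] {n : ℕ}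

/-- Weighted Bregman distance to the saddle point. -/
noncomputable def pot (D : Problem E F n) (P : Params) (γ b : ℝ) (xs : E) (ys : F) (x : E) (y : F) :
    ℝ :=
  muX P γ / 2 * ‖xs - x‖ ^ 2 + muY P b * bregman D.d D.d' ys y

/-- Primal-dual gap relative to the saddle point. -/
noncomputable def gap (D : Problem E F n) (γ b : ℝ) (xb xs : E) (ys : F) (x : E) (y : F) : ℝ :=
  D.f x ys - D.f xs y + D.regX γ xb x - D.regX γ xb xs + D.regY b y - D.regY b ys

variable {D : Problem E F n} {P : Params} {γ b : ℝ} {xb xs : E} {ys : F}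

theorem IsSaddle.le_gap (h : IsSaddle D P γ b xb xs ys) {x : E} {y : F} (hx : x ∈ D.X)
    (hy : y ∈ D.Y) :
    muX P γ / 2 * ‖x - xs‖ ^ 2 + muY P b / 2 * ‖y - ys‖ ^ 2 ≤ gap D γ b xb xs ys x y := by
  have h1 := h.growth_x x hx
  have h2 := h.growth_y y hy
  unfold gap; linarith

theorem IsSaddle.gap_nonneg (h : IsSaddle D P γ b xb xs ys) (hμX : 0 ≤ muX P γ)
    (hμY : 0 ≤ muY P b) {x : E} {y : F} (hx : x ∈ D.X) (hy : y ∈ D.Y) :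
    0 ≤ gap D γ b xb xs ys x y :=
  le_trans (by positivity) (h.le_gap hx hy)

theorem Problem.Assumptions.le_pot (hA : D.Assumptions P) (hμY : 0 ≤ muY P b) (hys : ys ∈ D.Y)
    {x : E} {y : F} (hy : y ∈ subdom D.Y D.d) :
    muX P γ / 2 * ‖xs - x‖ ^ 2 + muY P b / 2 * ‖ys - y‖ ^ 2 ≤ pot D P γ b xs ys x y := by
  have := mul_le_mul_of_nonneg_left (hA.distGen.sq_le_bregman hys hy) hμY
  unfold pot; linarith

theorem Problem.Assumptions.pot_nonneg (hA : D.Assumptions P) (hμX : 0 ≤ muX P γ)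
    (hμY : 0 ≤ muY P b) (hys : ys ∈ D.Y) {x : E} {y : F} (hy : y ∈ subdom D.Y D.d) :
    0 ≤ pot D P γ b xs ys x y :=
  le_trans (by positivity) (hA.le_pot hμY hys hy)

/-- The primal suboptimality is controlled by the gap and the potential at the saddle point. -/
theorem IsSaddle.primal_le (hA : D.Assumptions P) (hn : 0 < n) (h : IsSaddle D P γ b xb xs ys)
    (hμY : 0 < muY P b) {x : E} {y y' : F} (hx : x ∈ D.X) (hy : y ∈ D.Y) (hy' : y' ∈ D.Y) :
    D.f x y - D.regY b y + D.regX γ xb x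
      ≤ D.f xs ys - D.regY b ys + D.regX γ xb xs + gap D γ b xb xs ys x y'
        + P.Ly ^ 2 / (2 * muY P b) * ‖xs - x‖ ^ 2 := by
  -- Growth in y at the saddle point absorbs the mixed second-order term by Young's inequality; y'
  -- enters only through the nonnegative dual part of the gap.
  have h1 := h.growth_y y hy
  have h1' := h.growth_y y' hy'
  have h0 : 0 ≤ muY P b / 2 * ‖y' - ys‖ ^ 2 := by positivity
  have h2 := hA.f_mixed_le hn hx h.mem_X hy h.mem_Y
  have h3 : P.Ly * ‖x - xs‖ * ‖y - ys‖
      ≤ P.Ly ^ 2 / (2 * muY P b) * ‖xs - x‖ ^ 2 + muY P b / 2 * ‖y - ys‖ ^ 2 := by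
    rw [norm_sub_rev xs x]
    have e : P.Ly ^ 2 / (2 * muY P b) * ‖x - xs‖ ^ 2 + muY P b / 2 * ‖y - ys‖ ^ 2
        - P.Ly * ‖x - xs‖ * ‖y - ys‖
        = (P.Ly * ‖x - xs‖ - muY P b * ‖y - ys‖) ^ 2 / (2 * muY P b) := by
      field_simp; ring
    have : 0 ≤ (P.Ly * ‖x - xs‖ - muY P b * ‖y - ys‖) ^ 2 / (2 * muY P b) := by positivity
    linarith
  unfold gap; linarith

/-- Deterministic part of the analysis of one inner iteration. -/
theorem IsSaddle.step_le (hA : D.Assumptions P) (h : IsSaddle D P γ b xb xs ys)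
    {xj xp : E} {yj yp : F} {gx : E →L[ℝ] ℝ} {gy : F →L[ℝ] ℝ} {Λ : ℝ} (hxp : xp ∈ D.X)
    (hyp : yp ∈ D.Y)
    (hX : ∀ x ∈ D.X, D.regX γ xb xp - D.regX γ xb x + gx (xp - x)
      ≤ muX P γ * Λ / 2 * (‖x - xj‖ ^ 2 - ‖xp - xj‖ ^ 2 - ‖x - xp‖ ^ 2)
        - 1 / (2 * γ) * ‖x - xp‖ ^ 2)
    (hY : ∀ y ∈ D.Y, D.regY b yp - D.regY b y - gy (yp - y)
      ≤ muY P b * Λ * (bregman D.d D.d' y yj - bregman D.d D.d' yp yj - bregman D.d D.d' y yp)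
        - muY P b * bregman D.d D.d' y yp) :
    (Λ + 1) * pot D P γ b xs ys xp yp + gap D γ b xb xs ys xp yp
        + Λ * (muX P γ / 2 * ‖xp - xj‖ ^ 2 + muY P b * bregman D.d D.d' yp yj)
      ≤ Λ * pot D P γ b xs ys xj yj + (gradX D.f xp yp - gx) (xp - xs)
        + (gradY D.f xp yp - gy) (ys - yp) := by
  -- Both proximal inequalities are tested at the saddle point; the ρ/2 lost by weak convexity turns
  -- 1/(2γ) into μ_x/2.
  have h1 := hX xs h.mem_X
  have h2 := hY ys h.mem_Y
  have h3 := hA.f_x_ge h.mem_X hxp hyp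
  have h4 := hA.f_y_le hxp hyp h.mem_Y
  have e1 : gradX D.f xp yp (xs - xp) = -gradX D.f xp yp (xp - xs) := by rw [← map_neg, neg_sub]
  have e2 : gy (yp - ys) = -gy (ys - yp) := by rw [← map_neg, neg_sub]
  have e3 : muX P γ / 2 = 1 / (2 * γ) - P.ρ / 2 := by unfold muX; ring
  have e4 : muX P γ / 2 * ‖xs - xp‖ ^ 2
      = 1 / (2 * γ) * ‖xs - xp‖ ^ 2 - P.ρ / 2 * ‖xs - xp‖ ^ 2 := by rw [e3]; ring
  rw [sub_apply, sub_apply]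
  unfold pot gap
  linarith

end Step

end PGSVRG

namespace PGSVRG

/-! ### One inner iteration, averaged over the sampled index. -/

section AveragedStep

/-- The moduli and Lipschitz constants entering the step sizes. -/
structure StepConst (P : Params) (γ b M m : ℝ) : Prop where
  M_pos : 0 < M
  m_pos : 0 < m
  Lx_le : P.Lx ≤ M
  Ly_le : P.Ly ≤ M
  le_muX : m ≤ muX P γ
  le_muY : m ≤ muY P b
  eq : 52 * M ^ 2 = bigLam P γ b * m ^ 2

theorem exists_stepConst {P : Params} {γ b : ℝ} (hLx : 0 ≤ P.Lx) (hLy : 0 ≤ P.Ly)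
    (hL : 0 < max P.Lx P.Ly) (hX : 0 < muX P γ) (hY : 0 < muY P b) :
    ∃ M m, StepConst P γ b M m := by
  have hm : 0 < min (muX P γ) (muY P b) := lt_min hX hY
  refine ⟨max P.Lx P.Ly, min (muX P γ) (muY P b), hL, hm, le_max_left _ _, le_max_right _ _,
    min_le_left _ _, min_le_right _ _, ?_⟩
  have e1 : max (P.Lx ^ 2) (P.Ly ^ 2) = max P.Lx P.Ly ^ 2 := by
    rcases le_total P.Lx P.Ly with h | h
    · rw [max_eq_right h, max_eq_right (pow_le_pow_left₀ hLx h 2)]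
    · rw [max_eq_left h, max_eq_left (pow_le_pow_left₀ hLy h 2)]
  have e2 : min (muX P γ ^ 2) (muY P b ^ 2) = min (muX P γ) (muY P b) ^ 2 := by
    rcases le_total (muX P γ) (muY P b) with h | h
    · rw [min_eq_left h, min_eq_left (pow_le_pow_left₀ hX.le h 2)]
    · rw [min_eq_right h, min_eq_right (pow_le_pow_left₀ hY.le h 2)]
  unfold bigLam
  rw [e1, e2]
  field_simp

theorem StepConst.bigLam_pos {P : Params} {γ b M m : ℝ} (h : StepConst P γ b M m) :
    0 < bigLam P γ b := by
  have h1 : 0 < bigLam P γ b * m ^ 2 := by rw [← h.eq]; have := h.M_pos; positivity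
  exact pos_of_mul_pos_left h1 (by positivity)

theorem mul_le_sq_add_sq_div {p : ℝ} (hp : 0 < p) (s t : ℝ) :
    s * t ≤ p * s ^ 2 + t ^ 2 / (4 * p) := by
  have e : p * s ^ 2 + t ^ 2 / (4 * p) - s * t = (2 * p * s - t) ^ 2 / (4 * p) := by
    field_simp; ring
  have : 0 ≤ (2 * p * s - t) ^ 2 / (4 * p) := by positivity
  linarith

theorem sum_avg_sub_apply {G : Type*} [NormedAddCommGroup G] [NormedSpace ℝ G] {n : ℕ}
    (hn : 0 < n) (v : Fin n → G →L[ℝ] ℝ) (w : G) :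
    ∑ l, ((1 / (n : ℝ)) • ∑ j, v j - v l) w = 0 := by
  have hn' : (n : ℝ) ≠ 0 := by exact_mod_cast hn.ne'
  simp only [sub_apply, smul_apply, smul_eq_mul, Finset.sum_sub_distrib, Finset.sum_const,
    Finset.card_univ, Fintype.card_fin, nsmul_eq_mul, sum_apply]
  field_simp
  ring

theorem norm_sub_sq_le {G : Type*} [NormedAddCommGroup G] (u w z : G) :
    ‖u - w‖ ^ 2 ≤ 2 * (‖z - u‖ ^ 2 + ‖z - w‖ ^ 2) := by
  have h1 : ‖u - w‖ ≤ ‖z - u‖ + ‖z - w‖ := by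
    have : u - w = (z - w) - (z - u) := by abel
    rw [this]
    linarith [norm_sub_le (z - w) (z - u)]
  nlinarith [sq_nonneg (‖z - u‖ - ‖z - w‖), norm_nonneg (u - w)]

variable {E F : Type*} [NormedAddCommGroup E] [InnerProductSpace ℝ E]
  [NormedAddCommGroup F] [NormedSpace ℝ F] {n : ℕ}
  {D : Problem E F n} {P : Params} {γ b M m : ℝ} {xb xs : E} {ys : F}

theorem dual_apply_le {V : Type*} [NormedAddCommGroup V] [NormedSpace ℝ V] (φ : V →L[ℝ] ℝ) (v : V) :
    φ v ≤ ‖φ‖ * ‖v‖ :=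
  (le_abs_self _).trans (φ.le_opNorm v)

/-- The movement term of `IsSaddle.step_le` pays for the gradient change along the step and for the
noise acting on the displacement; half of the gap pays for the distance to the saddle point. The
remaining linear noise terms are evaluated at the old iterate, where they average to zero. -/
theorem IsSaddle.noisy_step_le (hA : D.Assumptions P) (hn : 0 < n)
    (h : IsSaddle D P γ b xb xs ys) (hc : StepConst P γ b M m)
    {xj xp : E} {yj yp : F} {gx : E →L[ℝ] ℝ} {gy : F →L[ℝ] ℝ}
    (hxj : xj ∈ D.X) (hyj : yj ∈ subdom D.Y D.d) (hxp : xp ∈ D.X) (hyp : yp ∈ D.Y)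
    (hX : ∀ x ∈ D.X, D.regX γ xb xp - D.regX γ xb x + gx (xp - x)
      ≤ muX P γ * bigLam P γ b / 2 * (‖x - xj‖ ^ 2 - ‖xp - xj‖ ^ 2 - ‖x - xp‖ ^ 2)
        - 1 / (2 * γ) * ‖x - xp‖ ^ 2)
    (hY : ∀ y ∈ D.Y, D.regY b yp - D.regY b y - gy (yp - y)
      ≤ muY P b * bigLam P γ b *
          (bregman D.d D.d' y yj - bregman D.d D.d' yp yj - bregman D.d D.d' y yp)
        - muY P b * bregman D.d D.d' y yp) :
    (bigLam P γ b + 1) * pot D P γ b xs ys xp yp + 1 / 2 * gap D γ b xb xs ys xp yp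
      ≤ bigLam P γ b * pot D P γ b xs ys xj yj
        + 13 / (24 * (bigLam P γ b * m))
          * (‖gradX D.f xj yj - gx‖ ^ 2 + ‖gradY D.f xj yj - gy‖ ^ 2)
        + (gradX D.f xj yj - gx) (xj - xs) + (gradY D.f xj yj - gy) (ys - yj) := by
  have hΛ := hc.bigLam_pos
  set Λ := bigLam P γ b with hΛdef
  have hm := hc.m_pos
  have hM := hc.M_pos
  -- Uses up the movement budget Λm/2 exactly: the two gradient changes cost Λm/52 each, the noise
  -- costs 1/(4p) = 6Λm/13, and 1/26 + 12/26 = 1/2.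
  set p := 13 / (24 * (Λ * m)) with hp
  have hp0 : 0 < p := by positivity
  have h0 := h.step_le hA hxp hyp hX hY
  set a := ‖xp - xj‖ with ha
  set c := ‖yp - yj‖ with hcdef
  set δ := √(a ^ 2 + c ^ 2) with hδ
  have hδ2 : δ ^ 2 = a ^ 2 + c ^ 2 := Real.sq_sqrt (by positivity)
  have hδ0 : 0 ≤ δ := Real.sqrt_nonneg _
  have ex : (gradX D.f xp yp - gx) (xp - xs) = (gradX D.f xp yp - gradX D.f xj yj) (xp - xs)
      + (gradX D.f xj yj - gx) (xp - xj) + (gradX D.f xj yj - gx) (xj - xs) := by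
    simp only [sub_apply, map_sub]; ring
  have ey : (gradY D.f xp yp - gy) (ys - yp) = (gradY D.f xp yp - gradY D.f xj yj) (ys - yp)
      + (gradY D.f xj yj - gy) (yj - yp) + (gradY D.f xj yj - gy) (ys - yj) := by
    simp only [sub_apply, map_sub]; ring
  have bx1 : (gradX D.f xp yp - gradX D.f xj yj) (xp - xs)
      ≤ 1 / m * (M * δ) ^ 2 + ‖xp - xs‖ ^ 2 / (4 * (1 / m)) := by
    refine (dual_apply_le _ _).trans (le_trans ?_ (mul_le_sq_add_sq_div (by positivity) _ _))
    refine mul_le_mul_of_nonneg_right ?_ (norm_nonneg _)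
    exact (hA.lipschitz_gradX_f hn hxp hxj hyp hyj.1).trans
      (mul_le_mul_of_nonneg_right hc.Lx_le hδ0)
  have by1 : (gradY D.f xp yp - gradY D.f xj yj) (ys - yp)
      ≤ 1 / m * (M * δ) ^ 2 + ‖ys - yp‖ ^ 2 / (4 * (1 / m)) := by
    refine (dual_apply_le _ _).trans (le_trans ?_ (mul_le_sq_add_sq_div (by positivity) _ _))
    refine mul_le_mul_of_nonneg_right ?_ (norm_nonneg _)
    exact (hA.lipschitz_gradY_f hn hxp hxj hyp hyj.1).trans
      (mul_le_mul_of_nonneg_right hc.Ly_le hδ0)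
  have bx2 : (gradX D.f xj yj - gx) (xp - xj)
      ≤ p * ‖gradX D.f xj yj - gx‖ ^ 2 + a ^ 2 / (4 * p) :=
    (dual_apply_le _ _).trans (mul_le_sq_add_sq_div hp0 _ _)
  have by2 : (gradY D.f xj yj - gy) (yj - yp)
      ≤ p * ‖gradY D.f xj yj - gy‖ ^ 2 + c ^ 2 / (4 * p) := by
    refine (dual_apply_le _ _).trans ?_
    rw [norm_sub_rev yj yp]
    exact mul_le_sq_add_sq_div hp0 _ _
  have e1 : 1 / m * (M * δ) ^ 2 = Λ * m / 52 * (a ^ 2 + c ^ 2) := by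
    have : M ^ 2 = Λ * m ^ 2 / 52 := by linarith [hc.eq]
    rw [mul_pow, this, hδ2]; field_simp
  have e2 : ∀ t : ℝ, t / (4 * (1 / m)) = m / 4 * t := fun t => by field_simp
  have e3 : ∀ t : ℝ, t / (4 * p) = 6 * (Λ * m) / 13 * t := fun t => by
    rw [hp]; field_simp; ring
  rw [e1, e2] at bx1 by1
  rw [e3] at bx2 by2
  have g1 := h.le_gap hxp hyp
  have g2 : m / 2 * ‖xp - xs‖ ^ 2 ≤ muX P γ / 2 * ‖xp - xs‖ ^ 2 :=
    mul_le_mul_of_nonneg_right (by linarith [hc.le_muX]) (by positivity)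
  have g3 : m / 2 * ‖yp - ys‖ ^ 2 ≤ muY P b / 2 * ‖yp - ys‖ ^ 2 :=
    mul_le_mul_of_nonneg_right (by linarith [hc.le_muY]) (by positivity)
  have k1 : m / 2 * a ^ 2 ≤ muX P γ / 2 * a ^ 2 :=
    mul_le_mul_of_nonneg_right (by linarith [hc.le_muX]) (by positivity)
  have k2 : m * (1 / 2 * c ^ 2) ≤ muY P b * bregman D.d D.d' yp yj :=
    mul_le_mul hc.le_muY (hA.distGen.sq_le_bregman hyp hyj) (by positivity)
      (hm.le.trans hc.le_muY)
  have k3 : Λ * (m / 2 * a ^ 2 + m * (1 / 2 * c ^ 2))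
      ≤ Λ * (muX P γ / 2 * a ^ 2 + muY P b * bregman D.d D.d' yp yj) :=
    mul_le_mul_of_nonneg_left (add_le_add k1 k2) hΛ.le
  rw [ex, ey] at h0
  rw [norm_sub_rev ys yp] at by1
  linarith

variable [FiniteDimensional ℝ E] [FiniteDimensional ℝ F]

theorem innerStep_mem (hA : D.Assumptions P) (hc : StepConst P γ b M m) (hb : 0 ≤ b) (xh : E)
    (yh : F) (l : Fin n) (s : State E F) :
    (innerStep D P γ b xb xh yh l s).x ∈ D.X
      ∧ (innerStep D P γ b xb xh yh l s).y ∈ subdom D.Y D.d := by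
  have hη : 0 < etaY P γ b := by
    have h1 := hc.bigLam_pos
    have h2 : 0 < muY P b := hc.m_pos.trans_le hc.le_muY
    unfold etaY; positivity
  exact ⟨(hA.proxX_spec γ (etaX P γ b) _ xb s.x rfl).1, (hA.proxY_spec hb hη _ s.y rfl).1⟩

/-- One inner iteration, averaged over the sampled index. -/
theorem IsSaddle.avg_innerStep_le (hA : D.Assumptions P) (hn : 0 < n) (hb : 0 ≤ b)
    (h : IsSaddle D P γ b xb xs ys) (hc : StepConst P γ b M m) {xh : E} {yh : F} {s : State E F}
    (hxh : xh ∈ D.X) (hyh : yh ∈ subdom D.Y D.d) (hx : s.x ∈ D.X) (hy : s.y ∈ subdom D.Y D.d) :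
    1 / (n : ℝ) * ∑ l, ((bigLam P γ b + 1) * pot D P γ b xs ys
        (innerStep D P γ b xb xh yh l s).x (innerStep D P γ b xb xh yh l s).y
      + 1 / 2 * gap D γ b xb xs ys
        (innerStep D P γ b xb xh yh l s).x (innerStep D P γ b xb xh yh l s).y)
      ≤ (bigLam P γ b + 5 / 24) * pot D P γ b xs ys s.x s.y
        + 5 / 24 * pot D P γ b xs ys xh yh := by
  have hΛ := hc.bigLam_pos
  have hm := hc.m_pos
  have hM := hc.M_pos
  have hμX : 0 < muX P γ := hm.trans_le hc.le_muX
  have hμY : 0 < muY P b := hm.trans_le hc.le_muY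
  have hn' : (0 : ℝ) < n := by exact_mod_cast hn
  have hη : 0 < etaY P γ b := by unfold etaY; positivity
  set ax : Fin n → E →L[ℝ] ℝ := fun l => gradX (D.fi l) s.x s.y - gradX (D.fi l) xh yh with hax
  set ay : Fin n → F →L[ℝ] ℝ := fun l => gradY (D.fi l) s.x s.y - gradY (D.fi l) xh yh with hay
  set dist2 := ‖s.x - xh‖ ^ 2 + ‖s.y - yh‖ ^ 2 with hdist
  have hd0 : 0 ≤ dist2 := by positivity
  have hax2 : ∀ l, ‖ax l‖ ≤ M * √dist2 := fun l =>
    (hA.lipschitz_gradX l _ hx _ hxh _ hy.1 _ hyh.1).trans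
      (mul_le_mul_of_nonneg_right hc.Lx_le (Real.sqrt_nonneg _))
  have hay2 : ∀ l, ‖ay l‖ ≤ M * √dist2 := fun l =>
    (hA.lipschitz_gradY l _ hx _ hxh _ hy.1 _ hyh.1).trans
      (mul_le_mul_of_nonneg_right hc.Ly_le (Real.sqrt_nonneg _))
  set ξx : Fin n → E →L[ℝ] ℝ := fun l => (1 / (n : ℝ)) • ∑ j, ax j - ax l with hξx
  set ξy : Fin n → F →L[ℝ] ℝ := fun l => (1 / (n : ℝ)) • ∑ j, ay j - ay l with hξy
  have exi : ∀ l, gradX D.f s.x s.y - (gradX D.f xh yh - gradX (D.fi l) xh yh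
      + gradX (D.fi l) s.x s.y) = ξx l := by
    intro l
    have e : (1 / (n : ℝ)) • ∑ j, ax j = gradX D.f s.x s.y - gradX D.f xh yh := by
      rw [hA.gradX_f, hA.gradX_f, hax, Finset.sum_sub_distrib]
      exact smul_sub _ _ _
    change _ = (1 / (n : ℝ)) • ∑ j, ax j - ax l
    rw [e]
    simp only [hax]
    abel
  have eyi : ∀ l, gradY D.f s.x s.y - (gradY D.f xh yh - gradY (D.fi l) xh yh
      + gradY (D.fi l) s.x s.y) = ξy l := by
    intro l
    have e : (1 / (n : ℝ)) • ∑ j, ay j = gradY D.f s.x s.y - gradY D.f xh yh := by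
      rw [hA.gradY_f, hA.gradY_f, hay, Finset.sum_sub_distrib]
      exact smul_sub _ _ _
    change _ = (1 / (n : ℝ)) • ∑ j, ay j - ay l
    rw [e]
    simp only [hay]
    abel
  have hsq : (M * √dist2) ^ 2 = M ^ 2 * dist2 := by rw [mul_pow, Real.sq_sqrt hd0]
  have hvarx : ∑ l, ‖ξx l‖ ^ 2 ≤ n * (M ^ 2 * dist2) := by
    refine (sum_dual_norm_sub_avg_sq_le hn ax).trans ?_
    refine (Finset.sum_le_sum fun l _ => pow_le_pow_left₀ (norm_nonneg _) (hax2 l) 2).trans ?_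
    simp [hsq]
  -- In a general norm the mean need not minimize the squared deviation; the triangle inequality
  -- costs a factor 4 instead of 1.
  have hvary : ∑ l, ‖ξy l‖ ^ 2 ≤ n * (4 * (M ^ 2 * dist2)) := by
    have h1 : ∀ l, ‖ξy l‖ ≤ 2 * (M * √dist2) := fun l => by
      refine (norm_sub_le _ _).trans ?_
      have := Problem.Assumptions.norm_avg_le hn hay2
      linarith [hay2 l]
    refine (Finset.sum_le_sum fun l _ => pow_le_pow_left₀ (norm_nonneg _) (h1 l) 2).trans ?_
    rw [mul_pow 2, hsq]
    simp
    linarith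
  have hstep : ∀ l, (bigLam P γ b + 1) * pot D P γ b xs ys
        (innerStep D P γ b xb xh yh l s).x (innerStep D P γ b xb xh yh l s).y
      + 1 / 2 * gap D γ b xb xs ys
        (innerStep D P γ b xb xh yh l s).x (innerStep D P γ b xb xh yh l s).y
      ≤ bigLam P γ b * pot D P γ b xs ys s.x s.y
        + 13 / (24 * (bigLam P γ b * m)) * (‖ξx l‖ ^ 2 + ‖ξy l‖ ^ 2)
        + ξx l (s.x - xs) + ξy l (ys - s.y) := by
    intro l
    obtain ⟨hx1, hx2⟩ := hA.proxX_spec γ (etaX P γ b) (gradX D.f xh yh - gradX (D.fi l) xh yh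
      + gradX (D.fi l) s.x s.y) xb s.x (xp := (innerStep D P γ b xb xh yh l s).x) rfl
    obtain ⟨hy1, hy2⟩ := hA.proxY_spec hb hη (gradY D.f xh yh - gradY (D.fi l) xh yh
      + gradY (D.fi l) s.x s.y) s.y (yp := (innerStep D P γ b xb xh yh l s).y) rfl
    have e1 : 1 / (2 * etaX P γ b) = muX P γ * bigLam P γ b / 2 := by
      unfold etaX; field_simp
    have e2 : 1 / etaY P γ b = muY P b * bigLam P γ b := by
      unfold etaY; field_simp
    rw [e1] at hx2
    rw [e2] at hy2
    have := h.noisy_step_le hA hn hc hx hy hx1 hy1.1 hx2 hy2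
    rwa [exi, eyi] at this
  have hsum := Finset.sum_le_sum fun l (_ : l ∈ Finset.univ) => hstep l
  have hR : ∑ l, (bigLam P γ b * pot D P γ b xs ys s.x s.y
        + 13 / (24 * (bigLam P γ b * m)) * (‖ξx l‖ ^ 2 + ‖ξy l‖ ^ 2)
        + ξx l (s.x - xs) + ξy l (ys - s.y))
      ≤ n * (bigLam P γ b * pot D P γ b xs ys s.x s.y + 5 * m / 96 * dist2) := by
    rw [Finset.sum_add_distrib, Finset.sum_add_distrib, sum_avg_sub_apply hn ax, sum_avg_sub_apply hn ay,
      Finset.sum_add_distrib]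
    simp only [← Finset.mul_sum, Finset.sum_add_distrib]
    have h1 : 13 / (24 * (bigLam P γ b * m)) * (∑ l, ‖ξx l‖ ^ 2 + ∑ l, ‖ξy l‖ ^ 2)
        ≤ 13 / (24 * (bigLam P γ b * m)) * (n * (5 * (M ^ 2 * dist2))) :=
      mul_le_mul_of_nonneg_left (by linarith) (by positivity)
    -- Here 5 = 1 + 4 collects both variances, and the 52 in Λ leaves 13·5/(24·52) = 5/96;
    -- multiplied by the 4 of `hdist2` it becomes 5/24.
    have h2 : 13 / (24 * (bigLam P γ b * m)) * (n * (5 * (M ^ 2 * dist2)))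
        = n * (5 * m / 96 * dist2) := by
      have : M ^ 2 = bigLam P γ b * m ^ 2 / 52 := by linarith [hc.eq]
      rw [this]; field_simp; ring
    simp only [Finset.sum_const, Finset.card_univ, Fintype.card_fin, nsmul_eq_mul]
    linarith
  have hdist2 : m * dist2 ≤ 4 * (pot D P γ b xs ys s.x s.y + pot D P γ b xs ys xh yh) := by
    have p1 := norm_sub_sq_le s.x xh xs
    have p2 := norm_sub_sq_le s.y yh ys
    have q : ∀ (x : E) (y : F), y ∈ subdom D.Y D.d →
        m / 2 * (‖xs - x‖ ^ 2 + ‖ys - y‖ ^ 2) ≤ pot D P γ b xs ys x y := by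
      intro x y hy
      refine le_trans ?_ (hA.le_pot hμY.le h.mem_Y hy)
      rw [mul_add]
      exact add_le_add
        (mul_le_mul_of_nonneg_right (by linarith [hc.le_muX]) (by positivity))
        (mul_le_mul_of_nonneg_right (by linarith [hc.le_muY]) (by positivity))
    have q1 := q s.x s.y hy
    have q2 := q xh yh hyh
    have q3 : m * dist2 ≤ m * (2 * (‖xs - s.x‖ ^ 2 + ‖xs - xh‖ ^ 2)
        + 2 * (‖ys - s.y‖ ^ 2 + ‖ys - yh‖ ^ 2)) :=
      mul_le_mul_of_nonneg_left (by linarith) hm.le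
    linarith
  have hfin := mul_le_mul_of_nonneg_left (hsum.trans hR) (by positivity : 0 ≤ 1 / (n : ℝ))
  have e : 1 / (n : ℝ) * (n * (bigLam P γ b * pot D P γ b xs ys s.x s.y + 5 * m / 96 * dist2))
      = bigLam P γ b * pot D P γ b xs ys s.x s.y + 5 * m / 96 * dist2 := by field_simp
  rw [e] at hfin
  linarith

end AveragedStep

end PGSVRG

namespace PGSVRG

/-! ### Abstract expectations over the sampled indices. -/

section Expectation

/-- A normalized positive linear functional on functions of the sampled indices for which the
indices in `I` are uniform and independent of the others. -/
structure IsExp {n : ℕ} (Ex : ((ℕ × ℕ × ℕ → Fin n) → ℝ) → ℝ) (I : Set (ℕ × ℕ × ℕ)) : Prop where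
  mono : ∀ {h h' : (ℕ × ℕ × ℕ → Fin n) → ℝ}, (∀ l, h l ≤ h' l) → Ex h ≤ Ex h'
  add : ∀ h h' : (ℕ × ℕ × ℕ → Fin n) → ℝ, Ex (fun l => h l + h' l) = Ex h + Ex h'
  const_mul : ∀ (c : ℝ) (h : (ℕ × ℕ × ℕ → Fin n) → ℝ), Ex (fun l => c * h l) = c * Ex h
  const : ∀ c : ℝ, Ex (fun _ => c) = c
  resample : ∀ i ∈ I, ∀ h : (ℕ × ℕ × ℕ → Fin n) → ℝ,
    Ex h = Ex fun l => 1 / (n : ℝ) * ∑ b, h (Function.update l i b)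

/-- Integrating out one index reduces an inequality of expectations to a pointwise inequality for
the average over that index. -/
theorem IsExp.le_of_resample {n : ℕ} {Ex : ((ℕ × ℕ × ℕ → Fin n) → ℝ) → ℝ}
    {I : Set (ℕ × ℕ × ℕ)} (hE : IsExp Ex I) {i : ℕ × ℕ × ℕ} (hi : i ∈ I)
    {h h' : (ℕ × ℕ × ℕ → Fin n) → ℝ}
    (hle : ∀ l, 1 / (n : ℝ) * ∑ b, h (Function.update l i b) ≤ h' l) : Ex h ≤ Ex h' := by
  rw [hE.resample i hi]; exact hE.mono hle

theorem iter_congr {S : Type*} {f g : ℕ → S → S} {s : S} {m : ℕ}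
    (h : ∀ i < m, f i = g i) : iter f s m = iter g s m := by
  induction m with
  | zero => rfl
  | succ k ih =>
    simp only [iter]
    rw [ih fun i hi => h i (hi.trans k.lt_succ_self), h k k.lt_succ_self]

end Expectation

/-! ### The contraction over one stage. -/

section Rate

theorem one_add_le_stageLen {P : Params} {γ b : ℝ} :
    (1 + (3 / 2 + 3 * bigLam P γ b) * Real.log 4 : ℝ) ≤ stageLen P γ b :=
  Nat.le_ceil _

theorem two_le_stageLen {P : Params} {γ b : ℝ} (hΛ : 0 < bigLam P γ b) : 2 ≤ stageLen P γ b := by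
  have h1 : 0 < Real.log 4 := Real.log_pos (by norm_num)
  have h2 := one_add_le_stageLen (P := P) (γ := γ) (b := b)
  have h3 : (1 : ℝ) < stageLen P γ b := lt_of_lt_of_le (by nlinarith [mul_pos hΛ h1]) h2
  exact_mod_cast h3

/-- From 1 − x ≤ e^(−x) with x = (19/24)/(Λ+1), and J − 1 ≥ (3/2 + 3Λ) log 4. -/
theorem contraction_pow_le {P : Params} {γ b : ℝ} (hΛ : 0 < bigLam P γ b) :
    ((bigLam P γ b + 5 / 24) / (bigLam P γ b + 1)) ^ (stageLen P γ b - 1) ≤ 1 / 4 := by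
  set Λ := bigLam P γ b with hΛd
  set m := stageLen P γ b - 1 with hm
  have hlog : 0 < Real.log 4 := Real.log_pos (by norm_num)
  have hm1 : (3 / 2 + 3 * Λ) * Real.log 4 ≤ m := by
    have h1 := one_add_le_stageLen (P := P) (γ := γ) (b := b)
    rw [hm, Nat.cast_sub (by linarith [two_le_stageLen hΛ])]
    push_cast; linarith
  have hρ : (Λ + 5 / 24) / (Λ + 1) ≤ Real.exp (-(19 / 24 / (Λ + 1))) := by
    have h1 := Real.add_one_le_exp (-(19 / 24 / (Λ + 1)))
    have e : (Λ + 5 / 24) / (Λ + 1) = -(19 / 24 / (Λ + 1)) + 1 := by field_simp; ring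
    rw [e]; exact h1
  calc _ ≤ Real.exp (-(19 / 24 / (Λ + 1))) ^ m := pow_le_pow_left₀ (by positivity) hρ m
    _ = Real.exp (-(m * (19 / 24 / (Λ + 1)))) := by rw [← Real.exp_nat_mul]; congr 1; ring
    _ ≤ Real.exp (-Real.log 4) := by
      apply Real.exp_le_exp.2
      apply neg_le_neg
      have h1 : (3 / 2 + 3 * Λ) * Real.log 4 * (19 / 24 / (Λ + 1)) ≤ m * (19 / 24 / (Λ + 1)) :=
        mul_le_mul_of_nonneg_right hm1 (by positivity)
      have h2 : 1 ≤ (3 / 2 + 3 * Λ) * (19 / 24 / (Λ + 1)) := by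
        rw [mul_div_assoc', le_div_iff₀ (by positivity)]; linarith
      have h3 := mul_le_mul_of_nonneg_right h2 hlog.le
      linarith
    _ = 1 / 4 := by rw [Real.exp_neg, Real.exp_log (by norm_num)]; norm_num

end Rate

/-! ### Expected progress of one stage. -/

section Svrg

variable {E F : Type*} [NormedAddCommGroup E] [InnerProductSpace ℝ E] [FiniteDimensional ℝ E]
  [NormedAddCommGroup F] [NormedSpace ℝ F] [FiniteDimensional ℝ F] {n : ℕ}
  {D : Problem E F n} {P : Params} {γ b M m : ℝ}

/-- The state is feasible: its dual component is a point where the divergence is defined. -/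
def State.Feasible (D : Problem E F n) (s : State E F) : Prop := s.x ∈ D.X ∧ s.y ∈ subdom D.Y D.d

/-- The states inside a stage. -/
noncomputable def stageState (D : Problem E F n) (P : Params) (γ b : ℝ) (xb : E) (l : ℕ → Fin n)
    (s : State E F) (j : ℕ) : State E F :=
  iter (fun j => innerStep D P γ b xb s.x s.y (l j)) ⟨s.x, s.y, s.cost + n⟩ j

theorem stageState_feasible (hA : D.Assumptions P) (hc : StepConst P γ b M m) (hb : 0 ≤ b)
    (xb : E) (l : ℕ → Fin n) {s : State E F} (hs : s.Feasible D) (j : ℕ) :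
    (stageState D P γ b xb l s j).Feasible D := by
  induction j with
  | zero => exact hs
  | succ k _ => exact innerStep_mem hA hc hb _ _ _ _

/-- The states between the stages of SVRG. -/
noncomputable def svrgState (D : Problem E F n) (P : Params) (γ b : ℝ) (xb : E)
    (l : ℕ → ℕ → Fin n) (k : ℕ) : State E F :=
  iter (fun k => stage D P γ b xb (l k)) ⟨xb, yBar D, 0⟩ k

theorem svrgState_feasible (hA : D.Assumptions P) (hc : StepConst P γ b M m) (hb : 0 ≤ b)
    {xb : E} (hxb : xb ∈ D.X) (l : ℕ → ℕ → Fin n) (k : ℕ) :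
    (svrgState D P γ b xb l k).Feasible D := by
  induction k with
  | zero => exact ⟨hxb, hA.yBar_mem_subdom⟩
  | succ k ih => exact stageState_feasible hA hc hb _ _ ih _

variable {Ex : ((ℕ × ℕ × ℕ → Fin n) → ℝ) → ℝ} {I : Set (ℕ × ℕ × ℕ)} {xs : E → E} {ys : E → F}
  {xb : (ℕ × ℕ × ℕ → Fin n) → E} {s : (ℕ × ℕ × ℕ → Fin n) → State E F} {t k : ℕ}

theorem IsExp.inner_le (hE : IsExp Ex I) (hA : D.Assumptions P) (hn : 0 < n) (hb : 0 ≤ b)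
    (hc : StepConst P γ b M m) (hsad : ∀ x, IsSaddle D P γ b x (xs x) (ys x))
    (hxb : ∀ l j c, xb (Function.update l (t, k, j) c) = xb l)
    (hs : ∀ l j c, s (Function.update l (t, k, j) c) = s l) (hsf : ∀ l, (s l).Feasible D)
    {j : ℕ} (hj : (t, k, j) ∈ I) :
    (bigLam P γ b + 1) * Ex (fun l => pot D P γ b (xs (xb l)) (ys (xb l))
          (stageState D P γ b (xb l) (fun j => l (t, k, j)) (s l) (j + 1)).x
          (stageState D P γ b (xb l) (fun j => l (t, k, j)) (s l) (j + 1)).y)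
        + 1 / 2 * Ex (fun l => gap D γ b (xb l) (xs (xb l)) (ys (xb l))
          (stageState D P γ b (xb l) (fun j => l (t, k, j)) (s l) (j + 1)).x
          (stageState D P γ b (xb l) (fun j => l (t, k, j)) (s l) (j + 1)).y)
      ≤ (bigLam P γ b + 5 / 24) * Ex (fun l => pot D P γ b (xs (xb l)) (ys (xb l))
          (stageState D P γ b (xb l) (fun j => l (t, k, j)) (s l) j).x
          (stageState D P γ b (xb l) (fun j => l (t, k, j)) (s l) j).y)
        + 5 / 24 * Ex (fun l => pot D P γ b (xs (xb l)) (ys (xb l)) (s l).x (s l).y) := by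
  rw [← hE.const_mul, ← hE.const_mul, ← hE.const_mul, ← hE.const_mul, ← hE.add, ← hE.add]
  refine hE.le_of_resample hj fun l => ?_
  -- The first j states do not read index j, so resampling it changes the last step only.
  have e : ∀ c, stageState D P γ b (xb l) (fun j' => Function.update l (t, k, j) c (t, k, j'))
      (s l) (j + 1) = innerStep D P γ b (xb l) (s l).x (s l).y c
        (stageState D P γ b (xb l) (fun j => l (t, k, j)) (s l) j) := by
    intro c
    have e1 : stageState D P γ b (xb l) (fun j' => Function.update l (t, k, j) c (t, k, j'))
        (s l) j = stageState D P γ b (xb l) (fun j => l (t, k, j)) (s l) j := by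
      refine iter_congr fun i hi => ?_
      beta_reduce
      rw [Function.update_of_ne]
      simp only [ne_eq, Prod.mk.injEq, true_and]
      exact hi.ne
    rw [← e1]
    simp only [stageState, iter, Function.update_self]
  simp only [hxb, hs, e]
  have hf := stageState_feasible hA hc hb (xb l) (fun j => l (t, k, j)) (hsf l) j
  exact (hsad (xb l)).avg_innerStep_le hA hn hb hc (hsf l).1 (hsf l).2 hf.1 hf.2

/-- Without the gap, the one-step inequality is a linear recursion forced by the reference point.
Kept in the last step only, the gap is bounded at the final iterate, and no averaged iterate is
needed. -/
theorem IsExp.stage_le (hE : IsExp Ex I) (hA : D.Assumptions P) (hn : 0 < n) (hb : 0 ≤ b)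
    (hc : StepConst P γ b M m) (hsad : ∀ x, IsSaddle D P γ b x (xs x) (ys x))
    (hxb : ∀ l j c, xb (Function.update l (t, k, j) c) = xb l)
    (hs : ∀ l j c, s (Function.update l (t, k, j) c) = s l) (hsf : ∀ l, (s l).Feasible D)
    (hI : ∀ j < stageLen P γ b - 1, (t, k, j) ∈ I) :
    Ex (fun l => pot D P γ b (xs (xb l)) (ys (xb l))
          (stage D P γ b (xb l) (fun j => l (t, k, j)) (s l)).x
          (stage D P γ b (xb l) (fun j => l (t, k, j)) (s l)).y)
        ≤ 17 / 38 * Ex (fun l => pot D P γ b (xs (xb l)) (ys (xb l)) (s l).x (s l).y) ∧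
    Ex (fun l => gap D γ b (xb l) (xs (xb l)) (ys (xb l))
          (stage D P γ b (xb l) (fun j => l (t, k, j)) (s l)).x
          (stage D P γ b (xb l) (fun j => l (t, k, j)) (s l)).y)
        ≤ (2 * bigLam P γ b + 5 / 6)
          * Ex (fun l => pot D P γ b (xs (xb l)) (ys (xb l)) (s l).x (s l).y) := by
  have hΛ := hc.bigLam_pos
  have hμX : 0 < muX P γ := hc.m_pos.trans_le hc.le_muX
  have hμY : 0 < muY P b := hc.m_pos.trans_le hc.le_muY
  set Λ := bigLam P γ b with hΛd
  set q : ℕ → ℝ := fun j => Ex (fun l => pot D P γ b (xs (xb l)) (ys (xb l))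
          (stageState D P γ b (xb l) (fun j => l (t, k, j)) (s l) j).x
          (stageState D P γ b (xb l) (fun j => l (t, k, j)) (s l) j).y) with hq
  set w : ℕ → ℝ := fun j => Ex (fun l => gap D γ b (xb l) (xs (xb l)) (ys (xb l))
          (stageState D P γ b (xb l) (fun j => l (t, k, j)) (s l) j).x
          (stageState D P γ b (xb l) (fun j => l (t, k, j)) (s l) j).y) with hw
  have hq00 : 0 ≤ q 0 := by
    have h0 := hE.const 0
    rw [← h0]
    exact hE.mono fun l => hA.pot_nonneg hμX.le hμY.le (hsad _).mem_Y (hsf l).2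
  have hw0 : ∀ j, 0 ≤ w j := fun j => by
    have h0 := hE.const 0
    rw [← h0]
    refine hE.mono fun l => ?_
    have hf := stageState_feasible hA hc hb (xb l) (fun j => l (t, k, j)) (hsf l) j
    exact (hsad _).gap_nonneg hμX.le hμY.le hf.1 hf.2.1
  have hstep : ∀ j < stageLen P γ b - 1,
      (Λ + 1) * q (j + 1) + 1 / 2 * w (j + 1) ≤ (Λ + 5 / 24) * q j + 5 / 24 * q 0 := fun j hj =>
    hE.inner_le hA hn hb hc hsad hxb hs hsf (hI j hj)
  set r := (Λ + 5 / 24) / (Λ + 1) with hr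
  have hr0 : 0 ≤ r := by positivity
  have hr1 : r ≤ 1 := by rw [hr, div_le_one (by positivity)]; linarith
  -- 5/19 is the fixed point of the recursion relative to q 0. With r^(J−1) ≤ 1/4 the factor becomes
  -- 5/19 + 14/76 = 17/38.
  have hbound : ∀ j ≤ stageLen P γ b - 1, q j ≤ (5 / 19 + 14 / 19 * r ^ j) * q 0 := by
    intro j hj
    induction j with
    | zero => rw [pow_zero]; linarith
    | succ j ih =>
      have h1 := hstep j hj
      have h2 := ih (Nat.le_of_succ_le hj)
      have h3 := hw0 (j + 1)
      have h4 : (Λ + 1) * q (j + 1) ≤ (Λ + 5 / 24) * ((5 / 19 + 14 / 19 * r ^ j) * q 0)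
          + 5 / 24 * q 0 := by
        have := mul_le_mul_of_nonneg_left h2 (by positivity : 0 ≤ Λ + 5 / 24)
        linarith
      have h5 : (Λ + 5 / 24) * ((5 / 19 + 14 / 19 * r ^ j) * q 0) + 5 / 24 * q 0
          = (Λ + 1) * ((5 / 19 + 14 / 19 * r ^ (j + 1)) * q 0) := by
        have : Λ + 5 / 24 = (Λ + 1) * r := by rw [hr]; field_simp
        rw [pow_succ]
        linear_combination (14 / 19 * r ^ j * q 0) * this
      rw [h5] at h4
      exact le_of_mul_le_mul_left h4 (by positivity)
  have hJ := two_le_stageLen hΛ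
  refine ⟨?_, ?_⟩
  · refine (hbound _ le_rfl).trans (mul_le_mul_of_nonneg_right ?_ hq00)
    have := contraction_pow_le hΛ
    linarith
  · obtain ⟨j, hj⟩ : ∃ j, stageLen P γ b - 1 = j + 1 := ⟨stageLen P γ b - 2, by omega⟩
    have h1 := hstep j (by omega)
    have h2 := hbound j (by omega)
    have h3 : q j ≤ q 0 := by
      refine h2.trans ?_
      have := pow_le_one₀ hr0 hr1 (n := j)
      have h4 : (5 / 19 + 14 / 19 * r ^ j) * q 0 ≤ 1 * q 0 :=
        mul_le_mul_of_nonneg_right (by linarith) hq00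
      linarith
    have h5 : 0 ≤ q (j + 1) := by
      have h0 := hE.const 0
      rw [← h0]
      refine hE.mono fun l => ?_
      have hf := stageState_feasible hA hc hb (xb l) (fun j => l (t, k, j)) (hsf l) (j + 1)
      exact hA.pot_nonneg hμX.le hμY.le (hsad _).mem_Y hf.2
    have h6 : 0 ≤ (Λ + 1) * q (j + 1) := by positivity
    have h7 := mul_le_mul_of_nonneg_left h3 (by positivity : 0 ≤ Λ + 5 / 24)
    change Ex (fun l => gap D γ b (xb l) (xs (xb l)) (ys (xb l))
          (stageState D P γ b (xb l) (fun j => l (t, k, j)) (s l) (stageLen P γ b - 1)).x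
          (stageState D P γ b (xb l) (fun j => l (t, k, j)) (s l) (stageLen P γ b - 1)).y) ≤ _
    rw [hj]
    change w (j + 1) ≤ _ * q 0
    linarith

end Svrg

end PGSVRG

namespace PGSVRG

/-! ### Accuracy of a call of SVRG. -/

section SvrgRate

variable {E F : Type*} [NormedAddCommGroup E] [InnerProductSpace ℝ E] [FiniteDimensional ℝ E]
  [NormedAddCommGroup F] [NormedSpace ℝ F] [FiniteDimensional ℝ F] {n : ℕ}
  {D : Problem E F n} {P : Params} {γ b c M m : ℝ}
  {Ex : ((ℕ × ℕ × ℕ → Fin n) → ℝ) → ℝ} {I : Set (ℕ × ℕ × ℕ)} {xs : E → E} {ys : E → F}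
  {xb : (ℕ × ℕ × ℕ → Fin n) → E} {t : ℕ}

theorem svrgState_update (hxb : ∀ l k j c, xb (Function.update l (t, k, j) c) = xb l) {k k' : ℕ}
    (hk : k ≤ k') (l : ℕ × ℕ × ℕ → Fin n) (j : ℕ) (i : Fin n) :
    svrgState D P γ b (xb (Function.update l (t, k', j) i))
        (fun k j' => Function.update l (t, k', j) i (t, k, j')) k
      = svrgState D P γ b (xb l) (fun k j => l (t, k, j)) k := by
  rw [hxb]
  refine iter_congr fun a ha => ?_
  have : (fun j' => Function.update l (t, k', j) i (t, a, j')) = fun j' => l (t, a, j') := by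
    funext j'
    rw [Function.update_of_ne]
    simp only [ne_eq, Prod.mk.injEq, true_and, not_and]
    intro h; omega
  beta_reduce
  rw [this]

theorem pot_init_le (hA : D.Assumptions P) (hμX : 0 ≤ muX P γ) (hμY : 0 ≤ muY P b) {x x' : E}
    {y : F} (hx : x ∈ D.X) (hx' : x' ∈ D.X) (hy : y ∈ D.Y) :
    pot D P γ b x y x' (yBar D) ≤ 1 / 2 * (muX P γ * P.Dx ^ 2 + muY P b * P.Dy ^ 2) := by
  have h1 := mul_le_mul_of_nonneg_left (pow_le_pow_left₀ (norm_nonneg _)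
    (hA.norm_sub_le_diam hx hx') 2) hμX
  have h2 := mul_le_mul_of_nonneg_left (hA.bregman_yBar_le hy) hμY
  unfold pot; linarith

/-- Suboptimality of a primal-dual pair in the regularized problem, up to regularization. -/
noncomputable def excess (D : Problem E F n) (P : Params) (γ b : ℝ) (xb xs : E) (ys : F)
    (s : State E F) : ℝ :=
  gap D γ b xb xs ys s.x s.y + P.Ly ^ 2 / (2 * muY P b) * ‖xs - s.x‖ ^ 2

/-- Of the K + 1 stages, K contract the potential and the last one also converts it into a gap,
hence the exponent K. -/
theorem IsExp.svrg_le (hE : IsExp Ex I) (hA : D.Assumptions P) (hn : 0 < n) (hb : 0 ≤ b)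
    (hLy : 0 ≤ P.Ly)
    (hc : StepConst P γ b M m) (hsad : ∀ x, IsSaddle D P γ b x (xs x) (ys x))
    (hxb : ∀ l k j c, xb (Function.update l (t, k, j) c) = xb l) (hxbX : ∀ l, xb l ∈ D.X)
    {K : ℕ} (hI : ∀ k < K + 1, ∀ j < stageLen P γ b - 1, (t, k, j) ∈ I) :
    Ex (fun l => excess D P γ b (xb l) (xs (xb l)) (ys (xb l))
        (svrgState D P γ b (xb l) (fun k j => l (t, k, j)) (K + 1)))
      ≤ 3 * ((1 / 4 + bigLam P γ b / 2) * (muX P γ * P.Dx ^ 2 + muY P b * P.Dy ^ 2))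
        * (17 / 38) ^ K := by
  have hΛ := hc.bigLam_pos
  have hμX : 0 < muX P γ := hc.m_pos.trans_le hc.le_muX
  have hμY : 0 < muY P b := hc.m_pos.trans_le hc.le_muY
  set q : ℕ → ℝ := fun k => Ex (fun l => pot D P γ b (xs (xb l)) (ys (xb l))
          (svrgState D P γ b (xb l) (fun k j => l (t, k, j)) k).x
          (svrgState D P γ b (xb l) (fun k j => l (t, k, j)) k).y) with hq
  set Q := 1 / 2 * (muX P γ * P.Dx ^ 2 + muY P b * P.Dy ^ 2) with hQ
  have hQ0 : 0 ≤ Q := by positivity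
  have hstage := fun k (hk : k < K + 1) => hE.stage_le hA hn hb hc hsad
    (s := fun l => svrgState D P γ b (xb l) (fun k j => l (t, k, j)) k)
    (fun l j c => hxb l k j c) (fun l j c => svrgState_update hxb le_rfl l j c)
    (fun l => svrgState_feasible hA hc hb (hxbX l) _ k) (hI k hk)
  have hq0 : q 0 ≤ Q := by
    rw [← hE.const Q]
    exact hE.mono fun l => pot_init_le hA hμX.le hμY.le (hsad _).mem_X (hxbX l) (hsad _).mem_Y
  have hqk : ∀ k ≤ K + 1, q k ≤ (17 / 38) ^ k * Q := by
    intro k hk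
    induction k with
    | zero => simpa using hq0
    | succ k ih =>
      have h1 : q (k + 1) ≤ 17 / 38 * q k := (hstage k (by omega)).1
      have h2 := ih (by omega)
      rw [pow_succ]
      linarith
  have hgap : Ex (fun l => gap D γ b (xb l) (xs (xb l)) (ys (xb l))
          (svrgState D P γ b (xb l) (fun k j => l (t, k, j)) (K + 1)).x
          (svrgState D P γ b (xb l) (fun k j => l (t, k, j)) (K + 1)).y)
        ≤ (2 * bigLam P γ b + 5 / 6) * q K := (hstage K (by omega)).2
  -- From L_y² ≤ M² and 52 M² = Λ m² ≤ Λ μ_x μ_y.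
  have hcoef : P.Ly ^ 2 / (2 * muY P b) ≤ bigLam P γ b / 52 * (muX P γ / 2) := by
    rw [div_le_iff₀ (by positivity)]
    have h1 : P.Ly ^ 2 ≤ M ^ 2 := pow_le_pow_left₀ hLy hc.Ly_le 2
    have h2 : m ^ 2 ≤ muX P γ * muY P b := by
      rw [sq]; exact mul_le_mul hc.le_muX hc.le_muY hc.m_pos.le hμX.le
    have h3 := mul_le_mul_of_nonneg_left h2 hΛ.le
    have h4 := hc.eq
    linarith
  have hdist : Ex (fun l => P.Ly ^ 2 / (2 * muY P b) * ‖xs (xb l)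
        - (svrgState D P γ b (xb l) (fun k j => l (t, k, j)) (K + 1)).x‖ ^ 2)
      ≤ bigLam P γ b / 52 * q (K + 1) := by
    rw [hq, ← hE.const_mul]
    refine hE.mono fun l => ?_
    have hf := svrgState_feasible hA hc hb (hxbX l) (fun k j => l (t, k, j)) (K + 1)
    have h1 := hA.le_pot (γ := γ) (xs := xs (xb l)) hμY.le (hsad (xb l)).mem_Y hf.2
      (x := (svrgState D P γ b (xb l) (fun k j => l (t, k, j)) (K + 1)).x)
    have h2 : 0 ≤ muY P b / 2 * ‖ys (xb l)
        - (svrgState D P γ b (xb l) (fun k j => l (t, k, j)) (K + 1)).y‖ ^ 2 := by positivity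
    have h3 := mul_le_mul_of_nonneg_right hcoef (sq_nonneg ‖xs (xb l)
        - (svrgState D P γ b (xb l) (fun k j => l (t, k, j)) (K + 1)).x‖)
    have h4 := mul_le_mul_of_nonneg_left (le_trans (le_add_of_nonneg_right h2) h1)
        (by positivity : 0 ≤ bigLam P γ b / 52)
    linarith
  unfold excess
  rw [hE.add]
  have a1 := mul_le_mul_of_nonneg_left (hqk K (by omega))
    (by positivity : 0 ≤ 2 * bigLam P γ b + 5 / 6)
  have a2 := mul_le_mul_of_nonneg_left (hqk (K + 1) le_rfl)
    (by positivity : 0 ≤ bigLam P γ b / 52)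
  have hpow : (17 / 38 : ℝ) ^ (K + 1) ≤ (17 / 38) ^ K := by
    rw [pow_succ]
    have : (0 : ℝ) < (17 / 38) ^ K := by positivity
    linarith
  have a3 := mul_le_mul_of_nonneg_left (mul_le_mul_of_nonneg_right hpow hQ0)
    (by positivity : 0 ≤ bigLam P γ b / 52)
  have hR : 0 ≤ Q * (17 / 38) ^ K := by positivity
  have a4 : (2 * bigLam P γ b + 5 / 6) * ((17 / 38) ^ K * Q)
      + bigLam P γ b / 52 * ((17 / 38) ^ K * Q)
      ≤ 3 * ((1 / 4 + bigLam P γ b / 2) * (2 * Q)) * (17 / 38) ^ K := by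
    nlinarith [mul_nonneg hΛ.le hR]
  have e : muX P γ * P.Dx ^ 2 + muY P b * P.Dy ^ 2 = 2 * Q := by rw [hQ]; ring
  rw [e]
  linarith

/-- The rate 3/4 is the one that matches c ≥ 4/3. It amounts to e³ ≤ (38/17)⁴. -/
theorem pow_le_exp_neg (K : ℕ) : (17 / 38 : ℝ) ^ K ≤ Real.exp (-(3 / 4 * K)) := by
  have h1 : (17 / 38 : ℝ) ≤ Real.exp (-(3 / 4)) := by
    have h2 : Real.exp (-(3 / 4)) = (Real.exp (3 / 4))⁻¹ := Real.exp_neg _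
    rw [h2, le_inv_comm₀ (by norm_num) (Real.exp_pos _)]
    have h3 : Real.exp (3 / 4) ^ 4 = Real.exp 1 ^ 3 := by
      rw [← Real.exp_nat_mul, ← Real.exp_nat_mul]; norm_num
    have h4 : Real.exp 1 ^ 3 ≤ (2.7182818286 : ℝ) ^ 3 :=
      pow_le_pow_left₀ (Real.exp_pos _).le Real.exp_one_lt_d9.le 3
    refine le_of_pow_le_pow_left₀ (n := 4) (by norm_num) (by norm_num) ?_
    rw [h3]
    refine h4.trans ?_
    norm_num
  calc (17 / 38 : ℝ) ^ K ≤ Real.exp (-(3 / 4)) ^ K := pow_le_pow_left₀ (by norm_num) h1 K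
    _ = _ := by rw [← Real.exp_nat_mul]; congr 1; ring

/-- The number of stages is large enough. -/
theorem stageCount_error_le (hc : 4 / 3 ≤ c) (hγ : 0 < γ) (hμX : 0 < muX P γ)
    (hμY : 0 ≤ muY P (invLamSeq P t)) (hΛ : 0 ≤ bigLam P γ (invLamSeq P t)) :
    3 * ((1 / 4 + bigLam P γ (invLamSeq P t) / 2)
      * (muX P γ * P.Dx ^ 2 + muY P (invLamSeq P t) * P.Dy ^ 2))
        * (17 / 38) ^ (stageCount P γ c t - 2) ≤ 9 / ((t : ℝ) + 1) ^ 2 := by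
  set B := (1 / 4 + bigLam P γ (invLamSeq P t) / 2)
      * (muX P γ * P.Dx ^ 2 + muY P (invLamSeq P t) * P.Dy ^ 2) with hB
  have hB0 : 0 ≤ B := by positivity
  set A := ((t : ℝ) + 1) ^ 2 * (4 / (γ * muX P γ) + 1)
    * (1 / 4 + bigLam P γ (invLamSeq P t) / 2)
    * (muX P γ * P.Dx ^ 2 + muY P (invLamSeq P t) * P.Dy ^ 2) with hAdef
  have hA : A = ((t : ℝ) + 1) ^ 2 * (4 / (γ * muX P γ) + 1) * B := by rw [hAdef, hB]; ring
  have ht : (0 : ℝ) < ((t : ℝ) + 1) ^ 2 := by positivity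
  have hAB : ((t : ℝ) + 1) ^ 2 * B ≤ A := by
    rw [hA]
    have : 0 ≤ 4 / (γ * muX P γ) := by positivity
    have h2 : 0 ≤ ((t : ℝ) + 1) ^ 2 * B * (4 / (γ * muX P γ)) := by positivity
    linarith
  have hK2 : 2 ≤ stageCount P γ c t := le_max_left _ _
  obtain ⟨k, hk⟩ : ∃ k, stageCount P γ c t = k + 2 := ⟨_, (Nat.sub_add_cancel hK2).symm⟩
  have hkc : 1 + c * Real.log A ≤ ((k + 2 : ℕ) : ℝ) := by
    rw [← hk]
    refine (Nat.le_ceil _).trans ?_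
    exact_mod_cast le_max_right 2 _
  rw [hk, Nat.add_sub_cancel, le_div_iff₀ ht]
  have hpow0 : (0 : ℝ) < (17 / 38) ^ k := by positivity
  -- If A ≤ 1, including the degenerate A = 0, the logarithm may force no stages beyond the minimum,
  -- but the prefactor is then already small.
  rcases le_or_gt A 1 with hA1 | hA1
  · have hpow1 : (17 / 38 : ℝ) ^ k ≤ 1 := pow_le_one₀ (by norm_num) (by norm_num)
    have : ((t : ℝ) + 1) ^ 2 * B * (17 / 38) ^ k ≤ 1 * 1 :=
      mul_le_mul (hAB.trans hA1) hpow1 hpow0.le zero_le_one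
    linarith
  · have hlog : 0 < Real.log A := Real.log_pos hA1
    have h1 : Real.log A ≤ 3 / 4 * ((k + 1 : ℕ) : ℝ) := by
      push_cast at hkc ⊢
      nlinarith
    have h2 : (17 / 38 : ℝ) ^ (k + 1) ≤ A⁻¹ := by
      refine (pow_le_exp_neg (k + 1)).trans ?_
      calc Real.exp (-(3 / 4 * ((k + 1 : ℕ) : ℝ))) ≤ Real.exp (-Real.log A) :=
            Real.exp_le_exp.2 (by linarith)
        _ = A⁻¹ := by rw [Real.exp_neg, Real.exp_log (by linarith : 0 < A)]
    -- The logarithm controls the power k + 1 while the error carries k; the lost factor costs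
    -- 3·38/17 < 9.
    rw [pow_succ] at h2
    have h3 : A * ((17 / 38 : ℝ) ^ k * (17 / 38)) ≤ 1 := by
      have := mul_le_mul_of_nonneg_left h2 (by linarith : 0 ≤ A)
      rwa [mul_inv_cancel₀ (by linarith : A ≠ 0)] at this
    have h4 := mul_le_mul_of_nonneg_right hAB hpow0.le
    linarith

end SvrgRate

end PGSVRG

namespace PGSVRG

/-! ### The primal function, its proximal points and one outer step. -/

section Primal

variable {E F : Type*} [NormedAddCommGroup E] [InnerProductSpace ℝ E] [FiniteDimensional ℝ E]
  [NormedAddCommGroup F] [NormedSpace ℝ F] [FiniteDimensional ℝ F] {n : ℕ}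
  {D : Problem E F n} {P : Params} {γ b : ℝ}

namespace Problem.Assumptions

theorem iSup_ne_bot (hA : D.Assumptions P) (x : E) :
    (⨆ y, ((D.f x y : EReal) - D.r y)) ≠ ⊥ := by
  obtain ⟨y, hy⟩ := hA.r_closed.nonempty_dom
  have h1 : ((D.f x y - (D.r y).toReal : ℝ) : EReal) ≤ ⨆ y, ((D.f x y : EReal) - D.r y) := by
    refine le_trans (le_of_eq ?_) (le_iSup (fun y => (D.f x y : EReal) - D.r y) y)
    rw [EReal.coe_sub, coe_toReal_of_mem_dom hA.r_closed.ne_bot hy]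
  exact fun h => EReal.coe_ne_bot _ (le_bot_iff.1 (h ▸ h1))

theorem ψ_ne_bot (hA : D.Assumptions P) (x : E) : D.ψ x ≠ ⊥ := by
  unfold Problem.ψ
  rw [Ne, EReal.add_eq_bot_iff, not_or]
  exact ⟨hA.iSup_ne_bot x, hA.g_closed.ne_bot x⟩

theorem ψ_le_coe (hA : D.Assumptions P) {x : E} (hx : x ∈ D.X) {c : ℝ}
    (h : ∀ y ∈ D.Y, D.f x y - (D.r y).toReal + (D.g x).toReal ≤ c) : D.ψ x ≤ c := by
  have h1 : (⨆ y, ((D.f x y : EReal) - D.r y)) ≤ ((c - (D.g x).toReal : ℝ) : EReal) := by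
    refine iSup_le fun y => ?_
    by_cases hy : y ∈ D.Y
    · rw [← coe_toReal_of_mem_dom hA.r_closed.ne_bot hy, ← EReal.coe_sub, EReal.coe_le_coe_iff]
      linarith [h y hy]
    · have : D.r y = ⊤ := by simpa [Problem.Y, dom] using hy
      rw [this, EReal.sub_top]; exact bot_le
  unfold Problem.ψ
  rw [← coe_toReal_of_mem_dom hA.g_closed.ne_bot hx]
  refine (add_le_add_left h1 _).trans (le_of_eq ?_)
  rw [← EReal.coe_add]; congr 1; ring

theorem coe_le_ψ (hA : D.Assumptions P) {x : E} (hx : x ∈ D.X) {y : F} (hy : y ∈ D.Y) :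
    ((D.f x y - (D.r y).toReal + (D.g x).toReal : ℝ) : EReal) ≤ D.ψ x := by
  unfold Problem.ψ
  rw [EReal.coe_add, coe_toReal_of_mem_dom hA.g_closed.ne_bot hx]
  refine add_le_add_left ?_ _
  refine le_trans (le_of_eq ?_) (le_iSup (fun y => (D.f x y : EReal) - D.r y) y)
  rw [EReal.coe_sub, coe_toReal_of_mem_dom hA.r_closed.ne_bot hy]

/-- Finiteness of the supremum over y: f(x, ·) is continuous, 𝒴 is bounded, and the closed function
r has a minimum there. -/
theorem exists_bound (hA : D.Assumptions P) (x : E) :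
    ∃ c, ∀ y ∈ D.Y, D.f x y - (D.r y).toReal ≤ c := by
  obtain ⟨y0, -, h0⟩ := exists_isMinOn_dom_add hA.r_closed hA.bounded_Y (k := fun _ => 0) (m := 0)
    lowerSemicontinuousOn_const (fun _ _ => le_rfl)
  obtain ⟨m, hm⟩ := exists_le_of_isBounded hA.bounded_Y (hA.differentiable_f_y x).continuous.neg
  refine ⟨-m - (D.r y0).toReal, fun y hy => ?_⟩
  have h1 := h0 y hy
  have h2 : m ≤ -D.f x y := hm y hy
  linarith

theorem dom_ψ (hA : D.Assumptions P) : dom D.ψ = D.X := by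
  ext x
  constructor
  · intro hx hg
    refine hx ?_
    unfold Problem.ψ
    rw [hg]
    exact EReal.add_top_of_ne_bot (hA.iSup_ne_bot x)
  · intro hx
    obtain ⟨c, hc⟩ := hA.exists_bound x
    have := hA.ψ_le_coe hx (c := c + (D.g x).toReal) (fun y hy => by linarith [hc y hy])
    exact ne_top_of_le_ne_top (EReal.coe_ne_top _) this

theorem coe_ψ (hA : D.Assumptions P) {x : E} (hx : x ∈ D.X) : ((D.ψ x).toReal : EReal) = D.ψ x :=
  coe_toReal_of_mem_dom hA.ψ_ne_bot (by rw [hA.dom_ψ]; exact hx)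

theorem ψ_toReal_le (hA : D.Assumptions P) {x : E} (hx : x ∈ D.X) {c : ℝ}
    (h : ∀ y ∈ D.Y, D.f x y - (D.r y).toReal + (D.g x).toReal ≤ c) : (D.ψ x).toReal ≤ c := by
  have := hA.ψ_le_coe hx h
  rw [← hA.coe_ψ hx] at this
  exact_mod_cast this

theorem le_ψ_toReal (hA : D.Assumptions P) {x : E} (hx : x ∈ D.X) {y : F} (hy : y ∈ D.Y) :
    D.f x y - (D.r y).toReal + (D.g x).toReal ≤ (D.ψ x).toReal := by
  have := hA.coe_le_ψ hx hy
  rw [← hA.coe_ψ hx] at this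
  exact_mod_cast this

/-- A common modulus, even a negative one, survives a supremum over y and the addition of the convex
g. -/
theorem strongConvexOn_ψ (hA : D.Assumptions P) :
    StrongConvexOn D.X (-P.ρ) fun x => (D.ψ x).toReal := by
  refine ⟨hA.convex_X, fun u hu w hw α β hα hβ hαβ => ?_⟩
  refine hA.ψ_toReal_le (hA.convex_X hu hw hα hβ hαβ) fun y hy => ?_
  have h1 := (hA.strongConvexOn_f hy).2 hu hw hα hβ hαβ
  have h2 := hA.g_convex.2 hu hw hα hβ hαβ
  have h3 := mul_le_mul_of_nonneg_left (hA.le_ψ_toReal hu hy) hα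
  have h4 := mul_le_mul_of_nonneg_left (hA.le_ψ_toReal hw hy) hβ
  have h5 : α * (D.r y).toReal + β * (D.r y).toReal = (D.r y).toReal := by
    rw [← add_mul, hαβ, one_mul]
  simp only [smul_eq_mul] at *
  linarith

/-- The proximal point exists and is a point of quadratic growth. -/
theorem prox_spec (hA : D.Assumptions P) (γ : ℝ) (x : E) :
    D.prox γ x ∈ D.X ∧ ∀ z ∈ D.X, (D.ψ (D.prox γ x)).toReal
      + 1 / (2 * γ) * ‖D.prox γ x - x‖ ^ 2 + muX P γ / 2 * ‖z - D.prox γ x‖ ^ 2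
      ≤ (D.ψ z).toReal + 1 / (2 * γ) * ‖z - x‖ ^ 2 := by
  have hquad : Continuous fun z : E => 1 / (2 * γ) * ‖z - x‖ ^ 2 := by fun_prop
  have hlsc : LowerSemicontinuousOn
      (fun z => ((D.ψ z).toReal - (D.g z).toReal) + 1 / (2 * γ) * ‖z - x‖ ^ 2) D.X := by
    refine LowerSemicontinuousOn.add ?_ (hquad.lowerSemicontinuous.lowerSemicontinuousOn _)
    intro z hz q hq
    obtain ⟨y, hy, hlt⟩ : ∃ y ∈ D.Y, q < D.f z y - (D.r y).toReal := by
      by_contra! hcon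
      have := hA.ψ_toReal_le hz (c := q + (D.g z).toReal) fun y hy => by linarith [hcon y hy]
      linarith
    have hc : ContinuousAt (fun w => D.f w y - (D.r y).toReal) z :=
      ((hA.differentiable_f_x y).continuous.sub continuous_const).continuousAt
    filter_upwards [mem_nhdsWithin_of_mem_nhds (hc.eventually (lt_mem_nhds hlt)),
      self_mem_nhdsWithin] with w hw hwX
    have := hA.le_ψ_toReal hwX hy
    linarith
  obtain ⟨y0, hy0⟩ := hA.r_closed.nonempty_dom
  obtain ⟨m, hm⟩ := exists_le_of_isBounded hA.bounded_X
    (((hA.differentiable_f_x y0).continuous.sub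
      (continuous_const (y := (D.r y0).toReal))).add hquad)
  obtain ⟨z0, hz0, hmin⟩ := exists_isMinOn_dom_add hA.g_closed hA.bounded_X hlsc (m := m)
    (fun z hz => by
      have h1 := hm z hz
      have h2 := hA.le_ψ_toReal hz hy0
      simp only [Pi.add_apply, Pi.sub_apply] at h1
      linarith)
  have hspec := argmin_coe_add hA.ψ_ne_bot (k := fun z => 1 / (2 * γ) * ‖z - x‖ ^ 2) (by
    refine ⟨z0, by rw [hA.dom_ψ]; exact hz0, fun z hz => ?_⟩
    rw [hA.dom_ψ] at hz
    linarith [hmin z hz])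
  have e : (fun z => ((1 / (2 * γ) * ‖z - x‖ ^ 2 : ℝ) : EReal) + D.ψ z)
      = fun z => D.ψ z + ((1 / (2 * γ) * ‖z - x‖ ^ 2 : ℝ) : EReal) := by
    funext z; rw [add_comm]
  rw [e, hA.dom_ψ] at hspec
  change D.prox γ x ∈ D.X ∧ ∀ z ∈ D.X, (D.ψ (D.prox γ x)).toReal
    + 1 / (2 * γ) * ‖D.prox γ x - x‖ ^ 2 ≤ _ at hspec
  refine ⟨hspec.1, fun z hz => ?_⟩
  have hs := strongConvexOn_add hA.strongConvexOn_ψ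
    (strongConvexOn_sq_norm_sub hA.convex_X (1 / (2 * γ)) x)
  have e2 : -P.ρ + 2 * (1 / (2 * γ)) = muX P γ := by unfold muX; ring
  rw [e2] at hs
  exact StrongConvexOn.add_sq_le_of_isMin hs hspec.1 hspec.2 hz

/-- The distance to the proximal point controls the distance of the subdifferential to `0`. -/
theorem infEDist_subdiff_le (hA : D.Assumptions P) (hγ : 0 < γ) (hμX : 0 ≤ muX P γ) (x : E) :
    Metric.infEDist 0 (subdiff D.ψ (D.prox γ x))
      ≤ ENNReal.ofReal (1 / γ) * edist (D.prox γ x) x := by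
  obtain ⟨hp, hmin⟩ := hA.prox_spec γ x
  set p := D.prox γ x with hpdef
  have hmem : -((1 / γ) • innerSL ℝ (p - x)) ∈ subdiff D.ψ p := by
    have hp' : p ∈ dom D.ψ := by rw [hA.dom_ψ]; exact hp
    refine ⟨hp', hA.ψ_ne_bot p, fun c hc => ?_⟩
    -- The remainder ‖z − p‖²/(2γ) left by completing the square is below c‖z − p‖ near p, as a
    -- Fréchet subgradient allows.
    have hnear : ∀ᶠ z in 𝓝 p, 1 / (2 * γ) * ‖z - p‖ < c := by
      have hcont : Continuous fun z => 1 / (2 * γ) * ‖z - p‖ := by fun_prop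
      have := hcont.tendsto p
      simp only [sub_self, norm_zero, mul_zero] at this
      exact this.eventually (gt_mem_nhds hc)
    filter_upwards [hnear] with z hz
    by_cases hzX : z ∈ D.X
    · rw [← hA.coe_ψ hp, ← hA.coe_ψ hzX, ← EReal.coe_add, EReal.coe_le_coe_iff]
      have h1 := hmin z hzX
      have h2 : 0 ≤ muX P γ / 2 * ‖z - p‖ ^ 2 := by positivity
      have h3 : ‖z - x‖ ^ 2 = ‖p - x‖ ^ 2 + 2 * inner ℝ (p - x) (z - p) + ‖z - p‖ ^ 2 := by
        rw [← norm_add_sq_real]; congr 2; abel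
      rw [h3] at h1
      have h4 := mul_le_mul_of_nonneg_right hz.le (norm_nonneg (z - p))
      have h5 : (-((1 / γ) • innerSL ℝ (p - x))) (z - p) = -(1 / γ * inner ℝ (p - x) (z - p)) := by
        rw [neg_apply, smul_apply, innerSL_apply_apply, smul_eq_mul]
      rw [h5]
      have h6 : 1 / (2 * γ) * (2 * inner ℝ (p - x) (z - p)) = 1 / γ * inner ℝ (p - x) (z - p) := by
        field_simp
      linarith
    · have : D.ψ z = ⊤ := by
        by_contra hcon
        exact hzX (by rw [← hA.dom_ψ]; exact hcon)
      rw [this]; exact le_top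
  refine (Metric.infEDist_le_edist_of_mem hmem).trans ?_
  rw [edist_dist, edist_dist, ← ENNReal.ofReal_mul (by positivity)]
  refine ENNReal.ofReal_le_ofReal (le_of_eq ?_)
  rw [dist_eq_norm, dist_eq_norm, zero_sub, neg_neg, norm_smul, innerSL_apply_norm,
    Real.norm_eq_abs, abs_of_pos (by positivity)]

/-- One outer iteration decreases the objective up to the error of the subproblem. -/
theorem outer_step_le (hA : D.Assumptions P) (hn : 0 < n) (hγ : 0 < γ) (hb : 0 ≤ b)
    (hμY : 0 < muY P b) {xb xs : E} {ys : F} (hxb : xb ∈ D.X)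
    (hsad : IsSaddle D P γ b xb xs ys) (hμX : 0 ≤ muX P γ) {s : State E F} (hs : s.Feasible D) :
    muX P γ / 2 * ‖D.prox γ xb - xb‖ ^ 2 + (D.ψ s.x).toReal
      ≤ (D.ψ xb).toReal + (excess D P γ b xb xs ys s + b * (P.Dy ^ 2 / 2)) := by
  obtain ⟨hp, hmin⟩ := hA.prox_spec γ xb
  -- Quadratic growth at the proximal point, tested at its center, produces the residual; the saddle
  -- value is in turn at most the proximal objective at that point.
  have h1 := hmin xb hxb
  rw [sub_self, norm_zero, norm_sub_rev xb] at h1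
  have h2 : (D.ψ s.x).toReal ≤ D.f xs ys - D.regY b ys + D.regX γ xb xs
      + excess D P γ b xb xs ys s + b * (P.Dy ^ 2 / 2) := by
    refine hA.ψ_toReal_le hs.1 fun y hy => ?_
    have h3 := hsad.primal_le hA hn hμY hs.1 hy hs.2.1
    have h4 := mul_le_mul_of_nonneg_left (hA.bregman_yBar_le hy) hb
    have h5 : 0 ≤ 1 / (2 * γ) * ‖s.x - xb‖ ^ 2 := by positivity
    unfold excess
    simp only [Problem.regY, Problem.regX] at h3 ⊢
    linarith
  have h3 := hsad.growth_x _ hp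
  have h4 := hA.le_ψ_toReal hp hsad.mem_Y
  have h5 := mul_nonneg hb (hA.bregman_yBar_nonneg hsad.mem_Y)
  have h6 : 0 ≤ muX P γ / 2 * ‖D.prox γ xb - xs‖ ^ 2 := by positivity
  simp only [Problem.regY, Problem.regX] at h2 h3
  linarith

end Problem.Assumptions

end Primal

end PGSVRG

namespace PGSVRG

/-! ### The outer recursion and its cost. -/

section InvLam

variable {P : Params}

theorem invLamSeq_nonneg (P : Params) (t : ℕ) : 0 ≤ invLamSeq P t := by
  unfold invLamSeq; split_ifs <;> positivity

theorem invLamSeq_le (P : Params) (t : ℕ) : invLamSeq P t ≤ 1 / ((t : ℝ) + 2) := by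
  unfold invLamSeq; split_ifs
  · positivity
  · exact le_rfl

theorem muY_invLamSeq_pos (hμ : 0 ≤ P.μ) (t : ℕ) : 0 < muY P (invLamSeq P t) := by
  unfold muY invLamSeq; split_ifs with h
  · linarith
  · positivity

end InvLam

section Outer

variable {E F : Type*} [NormedAddCommGroup E] [InnerProductSpace ℝ E]
  [NormedAddCommGroup F] [NormedSpace ℝ F] {n : ℕ}
  {D : Problem E F n} {P : Params} {γ c : ℝ} {x0 : E}

theorem pgsvrg_succ (l : ℕ × ℕ × ℕ → Fin n) (t : ℕ) :
    pgsvrg D P γ c x0 l (t + 1)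
      = ((svrgState D P γ (invLamSeq P t) (pgsvrg D P γ c x0 l t).1 (fun k j => l (t, k, j))
          (stageCount P γ c t - 1)).x,
        (pgsvrg D P γ c x0 l t).2
          + (svrgState D P γ (invLamSeq P t) (pgsvrg D P γ c x0 l t).1 (fun k j => l (t, k, j))
          (stageCount P γ c t - 1)).cost) :=
  rfl

theorem svrgState_congr {b : ℝ} {xb : E} {l l' : ℕ → ℕ → Fin n} {k : ℕ}
    (h : ∀ i < k, ∀ j < stageLen P γ b - 1, l i j = l' i j) :
    svrgState D P γ b xb l k = svrgState D P γ b xb l' k := by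
  refine iter_congr fun i hi => funext fun s => ?_
  refine iter_congr fun j hj => ?_
  rw [h i hi j hj]

/-- The iterates depend only on the indices sampled so far. -/
theorem pgsvrg_congr {l l' : ℕ × ℕ × ℕ → Fin n} {t : ℕ}
    (h : ∀ s < t, ∀ k < stageCount P γ c s - 1, ∀ j < stageLen P γ (invLamSeq P s) - 1,
      l (s, k, j) = l' (s, k, j)) :
    pgsvrg D P γ c x0 l t = pgsvrg D P γ c x0 l' t := by
  induction t with
  | zero => rfl
  | succ t ih =>
    rw [pgsvrg_succ, pgsvrg_succ, ih fun s hs => h s (hs.trans t.lt_succ_self),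
      svrgState_congr (h t t.lt_succ_self)]

theorem pgsvrg_update (l : ℕ × ℕ × ℕ → Fin n) (t k j : ℕ) (i : Fin n) :
    pgsvrg D P γ c x0 (Function.update l (t, k, j) i) t = pgsvrg D P γ c x0 l t := by
  refine pgsvrg_congr fun s hs k' _ j' _ => ?_
  rw [Function.update_of_ne]
  simp only [ne_eq, Prod.mk.injEq, not_and]
  intro h; omega

theorem stageState_cost (b : ℝ) (xb : E) (l : ℕ → Fin n) (s : State E F) (j : ℕ) :
    (stageState D P γ b xb l s j).cost = s.cost + n + j := by
  induction j with
  | zero => rfl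
  | succ j ih =>
    change (stageState D P γ b xb l s j).cost + 1 = _
    rw [ih]; ring

theorem svrgState_cost (b : ℝ) (xb : E) (l : ℕ → ℕ → Fin n) (k : ℕ) :
    (svrgState D P γ b xb l k).cost = k * (n + (stageLen P γ b - 1)) := by
  induction k with
  | zero => simp [svrgState, iter]
  | succ k ih =>
    change (stageState D P γ b xb (l k) (svrgState D P γ b xb l k) (stageLen P γ b - 1)).cost = _
    rw [stageState_cost, ih]; ring

theorem pgsvrg_cost (l : ℕ × ℕ × ℕ → Fin n) (t : ℕ) :
    (pgsvrg D P γ c x0 l t).2 = ∑ s ∈ Finset.range t,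
      (stageCount P γ c s - 1) * (n + (stageLen P γ (invLamSeq P s) - 1)) := by
  induction t with
  | zero => rfl
  | succ t ih => rw [pgsvrg_succ, Finset.sum_range_succ, ih, svrgState_cost]

theorem sum_inv_sq_le (m : ℕ) :
    ∑ t ∈ Finset.range m, 1 / ((t : ℝ) + 1) ^ 2 ≤ 2 - 1 / (m : ℝ) := by
  induction m with
  | zero => simp
  | succ m ih =>
    rw [Finset.sum_range_succ]
    push_cast
    rcases Nat.eq_zero_or_pos m with h | h
    · subst h; norm_num
    · have hm : (0 : ℝ) < m := by exact_mod_cast h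
      have : 1 / ((m : ℝ) + 1) ^ 2 ≤ 1 / (m : ℝ) - 1 / ((m : ℝ) + 1) := by
        rw [div_sub_div _ _ hm.ne' (by positivity), div_le_div_iff₀ (by positivity) (by positivity)]
        nlinarith
      linarith

theorem sum_inv_le_log (m : ℕ) :
    ∑ t ∈ Finset.range m, 1 / ((t : ℝ) + 2) ≤ Real.log ((m : ℝ) + 1) := by
  induction m with
  | zero => simp
  | succ m ih =>
    rw [Finset.sum_range_succ]
    push_cast
    have h1 := Real.one_sub_inv_le_log_of_pos
      (by positivity : (0 : ℝ) < ((m : ℝ) + 1 + 1) / ((m : ℝ) + 1))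
    rw [Real.log_div (by positivity) (by positivity), inv_div] at h1
    have h2 : 1 - ((m : ℝ) + 1) / ((m : ℝ) + 1 + 1) = 1 / ((m : ℝ) + 2) := by
      field_simp; ring
    linarith

variable [FiniteDimensional ℝ E] [FiniteDimensional ℝ F]

theorem pgsvrg_mem (hA : D.Assumptions P) (hγ : 0 < muX P γ) (hμ : 0 ≤ P.μ) (hLx : 0 ≤ P.Lx)
    (hLy : 0 ≤ P.Ly) (hL : 0 < max P.Lx P.Ly) (hx0 : x0 ∈ D.X) (l : ℕ × ℕ × ℕ → Fin n) (t : ℕ) :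
    (pgsvrg D P γ c x0 l t).1 ∈ D.X := by
  induction t with
  | zero => exact hx0
  | succ t ih =>
    obtain ⟨M, m, hc⟩ := exists_stepConst hLx hLy hL hγ (muY_invLamSeq_pos hμ t)
    exact (svrgState_feasible hA hc (invLamSeq_nonneg P t) ih _ _).1

variable {Ex : ((ℕ × ℕ × ℕ → Fin n) → ℝ) → ℝ} {I : Set (ℕ × ℕ × ℕ)}

/-- The saddle point depends on the random x̄^(t), so it is chosen as a function of the center;
x̄^(t) itself is unaffected by the indices of call t. -/
theorem IsExp.outer_step_le (hE : IsExp Ex I) (hA : D.Assumptions P) (hn : 0 < n) (hγ : 0 < γ)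
    (hμX : 0 < muX P γ) (hμ : 0 ≤ P.μ) (hLx : 0 ≤ P.Lx)
    (hLy : 0 ≤ P.Ly) (hL : 0 < max P.Lx P.Ly) (hc : 4 / 3 ≤ c) (hx0 : x0 ∈ D.X) {t : ℕ}
    (hI : ∀ k < stageCount P γ c t - 1, ∀ j < stageLen P γ (invLamSeq P t) - 1, (t, k, j) ∈ I) :
    muX P γ / 2 * Ex (fun l => ‖D.prox γ (pgsvrg D P γ c x0 l t).1
          - (pgsvrg D P γ c x0 l t).1‖ ^ 2)
        + Ex (fun l => (D.ψ (pgsvrg D P γ c x0 l (t + 1)).1).toReal)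
      ≤ Ex (fun l => (D.ψ (pgsvrg D P γ c x0 l t).1).toReal)
        + (9 / ((t : ℝ) + 1) ^ 2 + 1 / ((t : ℝ) + 2) * (P.Dy ^ 2 / 2)) := by
  have hb := invLamSeq_nonneg P t
  have hμY := muY_invLamSeq_pos hμ t
  obtain ⟨M, m, hsc⟩ := exists_stepConst hLx hLy hL hμX hμY
  choose xs ys hsad using fun x =>
    hA.exists_saddle hn hμ hb hμY hμX.le (γ := γ) x
  obtain ⟨k, hk⟩ : ∃ k, stageCount P γ c t = k + 2 :=
    ⟨_, (Nat.sub_add_cancel (le_max_left 2 _)).symm⟩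
  have hkk : stageCount P γ c t - 1 = k + 1 := by omega
  have hmem := fun l => pgsvrg_mem (c := c) hA hμX hμ hLx hLy hL hx0 l t
  have h1 := hE.svrg_le hA hn hb hLy hsc hsad
    (xb := fun l => (pgsvrg D P γ c x0 l t).1) (t := t)
    (fun l k j i => by rw [pgsvrg_update]) hmem (K := k) (by rwa [hkk] at hI)
  have h2 := stageCount_error_le (P := P) (t := t) hc hγ hμX hμY.le hsc.bigLam_pos.le
  rw [hk, Nat.add_sub_cancel] at h2
  have h3 : muX P γ / 2 * Ex (fun l => ‖D.prox γ (pgsvrg D P γ c x0 l t).1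
          - (pgsvrg D P γ c x0 l t).1‖ ^ 2)
        + Ex (fun l => (D.ψ (pgsvrg D P γ c x0 l (t + 1)).1).toReal)
      ≤ Ex (fun l => (D.ψ (pgsvrg D P γ c x0 l t).1).toReal)
        + (Ex (fun l => excess D P γ (invLamSeq P t) (pgsvrg D P γ c x0 l t).1
            (xs (pgsvrg D P γ c x0 l t).1) (ys (pgsvrg D P γ c x0 l t).1)
            (svrgState D P γ (invLamSeq P t) (pgsvrg D P γ c x0 l t).1
              (fun k j => l (t, k, j)) (k + 1)))
          + invLamSeq P t * (P.Dy ^ 2 / 2)) := by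
    rw [← hE.const (invLamSeq P t * (P.Dy ^ 2 / 2)), ← hE.const_mul, ← hE.add, ← hE.add, ← hE.add]
    refine hE.mono fun l => ?_
    rw [pgsvrg_succ, hkk]
    exact hA.outer_step_le hn hγ hb hμY (hmem l) (hsad _) hμX.le
      (svrgState_feasible hA hsc hb (hmem l) _ _)
  have h4 := mul_le_mul_of_nonneg_right (invLamSeq_le P t)
    (by positivity : 0 ≤ P.Dy ^ 2 / 2)
  linarith

/-- The proximal residuals of all iterates sum to a logarithmic quantity. -/
theorem IsExp.sum_residual_le (hE : IsExp Ex I) (hA : D.Assumptions P) (hn : 0 < n) (hγ : 0 < γ)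
    (hμX : 0 < muX P γ) (hμ : 0 ≤ P.μ) (hLx : 0 ≤ P.Lx)
    (hLy : 0 ≤ P.Ly) (hL : 0 < max P.Lx P.Ly) (hc : 4 / 3 ≤ c) (hx0 : x0 ∈ D.X) {w Δ : ℝ}
    (hw : ∀ z ∈ D.X, w ≤ (D.ψ z).toReal) (hΔ : (D.ψ x0).toReal ≤ w + Δ) {m : ℕ}
    (hI : ∀ t < m, ∀ k < stageCount P γ c t - 1, ∀ j < stageLen P γ (invLamSeq P t) - 1,
      (t, k, j) ∈ I) :
    muX P γ / 2 * ∑ t ∈ Finset.range (m + 1), Ex (fun l => ‖D.prox γ (pgsvrg D P γ c x0 l t).1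
          - (pgsvrg D P γ c x0 l t).1‖ ^ 2)
      ≤ (|Δ| + 18 + P.Dy ^ 2 / 2) * (1 + Real.log ((m : ℝ) + 1)) := by
  set R : ℕ → ℝ := fun t => Ex (fun l => ‖D.prox γ (pgsvrg D P γ c x0 l t).1
          - (pgsvrg D P γ c x0 l t).1‖ ^ 2) with hR
  set U : ℕ → ℝ := fun t => Ex (fun l => (D.ψ (pgsvrg D P γ c x0 l t).1).toReal) with hU
  have hsum : ∀ j ≤ m, muX P γ / 2 * ∑ t ∈ Finset.range j, R t + U j ≤ (D.ψ x0).toReal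
      + (9 * ∑ t ∈ Finset.range j, 1 / ((t : ℝ) + 1) ^ 2
        + (∑ t ∈ Finset.range j, 1 / ((t : ℝ) + 2)) * (P.Dy ^ 2 / 2)) := by
    intro j hj
    induction j with
    | zero =>
      have : U 0 = (D.ψ x0).toReal := hE.const (D.ψ x0).toReal
      simp [this]
    | succ j ih =>
      have h1 := ih (by omega)
      have h2 : muX P γ / 2 * R j + U (j + 1) ≤ U j
          + (9 / ((j : ℝ) + 1) ^ 2 + 1 / ((j : ℝ) + 2) * (P.Dy ^ 2 / 2)) :=
        hE.outer_step_le hA hn hγ hμX hμ hLx hLy hL hc hx0 (hI j hj)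
      have e : 9 / ((j : ℝ) + 1) ^ 2 = 9 * (1 / ((j : ℝ) + 1) ^ 2) := by ring
      rw [Finset.sum_range_succ, Finset.sum_range_succ, Finset.sum_range_succ]
      rw [e] at h2
      linarith
  -- The last iterate has no successor; its residual is bounded directly by the decrease of ψ down
  -- to its lower bound.
  have hlast : muX P γ / 2 * R m + w ≤ U m := by
    rw [hR, hU, ← hE.const w, ← hE.const_mul, ← hE.add]
    refine hE.mono fun l => ?_
    have hmem := pgsvrg_mem (c := c) hA hμX hμ hLx hLy hL hx0 l m
    obtain ⟨hp, hmin⟩ := hA.prox_spec γ (pgsvrg D P γ c x0 l m).1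
    have h1 := hmin _ hmem
    rw [sub_self, norm_zero, norm_sub_rev (pgsvrg D P γ c x0 l m).1] at h1
    have h2 := hw _ hp
    have h3 : 0 ≤ 1 / (2 * γ) * ‖D.prox γ (pgsvrg D P γ c x0 l m).1
      - (pgsvrg D P γ c x0 l m).1‖ ^ 2 := by positivity
    linarith
  have h1 := hsum m le_rfl
  have h2 := sum_inv_sq_le m
  have h3 := mul_le_mul_of_nonneg_right (sum_inv_le_log m) (by positivity : 0 ≤ P.Dy ^ 2 / 2)
  have h4 : (0 : ℝ) ≤ 1 / (m : ℝ) := by positivity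
  have h5 : 0 ≤ Real.log ((m : ℝ) + 1) :=
    Real.log_nonneg (by have : (0 : ℝ) ≤ m := m.cast_nonneg; linarith)
  have h6 : 0 ≤ (|Δ| + 18) * Real.log ((m : ℝ) + 1) := by positivity
  have h7 := le_abs_self Δ
  have h8 : 0 ≤ P.Dy ^ 2 / 2 := by positivity
  rw [Finset.sum_range_succ]
  linarith

end Outer

/-! ### Finite averages as expectations. -/

section FiniteAverage

variable {n : ℕ}

/-- Extension of a family of indices on `I` to all of `ℕ × ℕ × ℕ`. -/
noncomputable def extendIdx (I : Finset (ℕ × ℕ × ℕ)) (l0 : Fin n) (v : I → Fin n) :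
    ℕ × ℕ × ℕ → Fin n :=
  fun i => if h : i ∈ I then v ⟨i, h⟩ else l0

/-- Average over all choices of the indices in `I`. -/
noncomputable def finAvg (I : Finset (ℕ × ℕ × ℕ)) (l0 : Fin n)
    (h : (ℕ × ℕ × ℕ → Fin n) → ℝ) : ℝ :=
  (∑ v : I → Fin n, h (extendIdx I l0 v)) / Fintype.card (I → Fin n)

theorem sum_update {ι : Type*} [DecidableEq ι] [Fintype ι] (i : ι) (H : (ι → Fin n) → ℝ) :
    ∑ v, ∑ b, H (Function.update v i b) = n * ∑ v, H v := by
  rw [← Fintype.sum_prod_type']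
  have : ∑ p : (ι → Fin n) × Fin n, H (Function.update p.1 i p.2)
      = ∑ p : (ι → Fin n) × Fin n, H p.1 := by
    -- Exchanging the new value with the overwritten coordinate is an involution.
    let e : (ι → Fin n) × Fin n → (ι → Fin n) × Fin n := fun p => (Function.update p.1 i p.2, p.1 i)
    have he : Function.Involutive e := fun p => by
      simp [e]
    exact Fintype.sum_equiv he.toPerm _ _ fun p => rfl
  rw [this, Fintype.sum_prod_type, Finset.mul_sum]
  simp

theorem finAvg_isExp (hn : 0 < n) (I : Finset (ℕ × ℕ × ℕ)) (l0 : Fin n) :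
    IsExp (finAvg I l0) (I : Set (ℕ × ℕ × ℕ)) := by
  classical
  have : Nonempty (Fin n) := ⟨l0⟩
  have hcard : (0 : ℝ) < Fintype.card (I → Fin n) := by exact_mod_cast Fintype.card_pos
  have hn' : (n : ℝ) ≠ 0 := by exact_mod_cast hn.ne'
  refine ⟨fun h => ?_, fun h h' => ?_, fun c h => ?_, fun c => ?_, fun i hi h => ?_⟩
  · exact div_le_div_of_nonneg_right (Finset.sum_le_sum fun v _ => h _) hcard.le
  · unfold finAvg
    rw [Finset.sum_add_distrib, add_div]
  · unfold finAvg
    rw [← Finset.mul_sum, mul_div_assoc]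
  · unfold finAvg
    rw [Finset.sum_const, Finset.card_univ, nsmul_eq_mul]
    field_simp
  · unfold finAvg
    congr 1
    have e : ∀ v b, Function.update (extendIdx I l0 v) i b
        = extendIdx I l0 (Function.update v ⟨i, hi⟩ b) := by
      intro v b
      funext j
      by_cases hj : j = i
      · subst hj
        simp only [Function.update_self, extendIdx]
        rw [dif_pos (by exact hi)]
      · rw [Function.update_of_ne hj]
        by_cases hjI : j ∈ I
        · simp only [extendIdx, hjI, dif_pos]
          rw [Function.update_of_ne (fun h => hj (congrArg Subtype.val h))]
        · simp only [extendIdx, hjI, dif_neg, not_false_eq_true]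
    simp only [e]
    rw [← Finset.mul_sum, sum_update ⟨i, hi⟩ fun v => h (extendIdx I l0 v)]
    field_simp

/-- The law of finitely many independent uniform indices and of an independent uniform time. -/
theorem lintegral_eq_sum {Ω : Type*} [MeasurableSpace Ω] {Pr : Measure Ω} [IsProbabilityMeasure Pr]
    {T : ℕ} {l : ℕ × ℕ × ℕ → Ω → Fin n} {τ : Ω → Fin T} (hl : ∀ i, Measurable (l i))
    (hτ : Measurable τ) (hind : iIndepFun l Pr) (hτl : IndepFun τ (fun ω i => l i ω) Pr)
    (hlu : ∀ i b, Pr {ω | l i ω = b} = (n : ℝ≥0∞)⁻¹)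
    (hτu : ∀ s, Pr {ω | τ ω = s} = (T : ℝ≥0∞)⁻¹) (I : Finset (ℕ × ℕ × ℕ))
    (h : Fin T → (I → Fin n) → ℝ≥0∞) :
    ∫⁻ ω, h (τ ω) (fun i => l i ω) ∂Pr
      = ∑ s, ∑ v, h s v * ((T : ℝ≥0∞)⁻¹ * (n : ℝ≥0∞)⁻¹ ^ I.card) := by
  have hR : Measurable fun ω => (fun i : I => l i ω) := measurable_pi_lambda _ fun i => hl i
  have hpair : Measurable fun ω => (τ ω, fun i : I => l i ω) := hτ.prodMk hR
  have h1 : ∫⁻ ω, h (τ ω) (fun i => l i ω) ∂Pr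
      = ∫⁻ p : Fin T × (I → Fin n), h p.1 p.2 ∂(Pr.map fun ω => (τ ω, fun i : I => l i ω)) :=
    (lintegral_map (f := fun p : Fin T × (I → Fin n) => h p.1 p.2) (measurable_of_countable _)
      hpair).symm
  rw [h1, lintegral_fintype, Fintype.sum_prod_type]
  refine Finset.sum_congr rfl fun s _ => Finset.sum_congr rfl fun v _ => ?_
  congr 1
  rw [Measure.map_apply hpair (measurableSet_singleton _)]
  have e1 : (fun ω => (τ ω, fun i : I => l i ω)) ⁻¹' {(s, v)}
      = τ ⁻¹' {s} ∩ (fun ω i => l i ω) ⁻¹' {f | ∀ i : I, f i = v i} := by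
    ext ω
    simp [funext_iff]
  have hms : MeasurableSet {f : ℕ × ℕ × ℕ → Fin n | ∀ i : I, f i = v i} := by
    have : {f : ℕ × ℕ × ℕ → Fin n | ∀ i : I, f i = v i} = ⋂ i : I, (fun f => f i) ⁻¹' {v i} := by
      ext f; simp
    rw [this]
    exact MeasurableSet.iInter fun i => measurable_pi_apply _ (measurableSet_singleton _)
  rw [e1, hτl.measure_inter_preimage_eq_mul _ _ (measurableSet_singleton _) hms]
  congr 1
  · exact hτu s
  · classical
    have e2 : (fun ω i => l i ω) ⁻¹' {f : ℕ × ℕ × ℕ → Fin n | ∀ i : I, f i = v i}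
        = ⋂ i ∈ I, l i ⁻¹' (if hi : i ∈ I then {v ⟨i, hi⟩} else Set.univ) := by
      ext ω
      simp only [Set.mem_preimage, Set.mem_ofPred_eq, Set.mem_iInter]
      constructor
      · intro hω i hi
        simp [hi, hω ⟨i, hi⟩]
      · intro hω i
        have := hω i i.2
        simpa using this
    rw [e2, hind.measure_inter_preimage_eq_mul I (fun i hi => by
      simp only [hi, dif_pos]; exact measurableSet_singleton _)]
    rw [Finset.prod_congr rfl (g := fun _ => (n : ℝ≥0∞)⁻¹) fun i hi => by
      simp only [hi, dif_pos]; exact hlu i _]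
    rw [Finset.prod_const]

end FiniteAverage

end PGSVRG

namespace PGSVRG

/-! ### Growth of the algorithmic parameters. -/

section Complexity

/-- The number of outer iterations. -/
noncomputable def outerCount (B ε : ℝ) : ℕ := ⌈B * ε⁻¹ ^ 2 * (1 + Real.log ε⁻¹)⌉₊

/-- log T appears in the very bound that T must beat. But 1 + log T is at most (3 + log 2B)(1 + log
ε⁻¹), with a factor only logarithmic in B, so a large B wins. -/
theorem exists_outerCount {A : ℝ} (hA : 0 ≤ A) : ∃ B C : ℝ, 1 ≤ B ∧ 1 ≤ C ∧
    ∀ ε : ℝ, 0 < ε → ε ≤ 1 → 0 < outerCount B ε ∧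
      (outerCount B ε : ℝ) ≤ 2 * B * ε⁻¹ ^ 2 * (1 + Real.log ε⁻¹) ∧
      1 + Real.log (outerCount B ε) ≤ C * (1 + Real.log ε⁻¹) ∧
      A * (1 + Real.log (outerCount B ε)) ≤ ε ^ 2 * outerCount B ε := by
  -- With this slope, log(2B) ≤ 2Bδ − 1 − log δ uses at most half of B after multiplication by A;
  -- the second entry of the maximum defining B covers the constants.
  set δ : ℝ := 1 / (4 * (A + 1)) with hδ
  have hδ0 : 0 < δ := by positivity
  set B := max 1 (2 * A * (2 - Real.log δ)) with hB
  have hB1 : 1 ≤ B := le_max_left _ _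
  have hBle : A * (3 + Real.log (2 * B)) ≤ B := by
    have h1 := Real.log_le_sub_one_of_pos (by positivity : 0 < 2 * B * δ)
    rw [Real.log_mul (by positivity) hδ0.ne'] at h1
    have h2 : A * (3 + Real.log (2 * B)) ≤ A * (2 * B * δ + (2 - Real.log δ)) :=
      mul_le_mul_of_nonneg_left (by linarith) hA
    have h3 : A * (2 * B * δ) ≤ B / 2 := by
      have : A * δ ≤ 1 / 4 := by
        rw [hδ, mul_one_div, div_le_div_iff₀ (by positivity) (by norm_num)]; linarith
      nlinarith
    have h4 : 2 * A * (2 - Real.log δ) ≤ B := le_max_right _ _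
    linarith
  have hlogB : 0 ≤ Real.log (2 * B) := Real.log_nonneg (by linarith)
  refine ⟨B, 3 + Real.log (2 * B), hB1, by linarith, fun ε hε hε1 => ?_⟩
  have he1 : 1 ≤ ε⁻¹ := (one_le_inv₀ hε).2 hε1
  have hlog : 0 ≤ Real.log ε⁻¹ := Real.log_nonneg he1
  set L := 1 + Real.log ε⁻¹ with hL
  have hL1 : 1 ≤ L := by linarith
  have he2 : 1 ≤ ε⁻¹ ^ 2 := one_le_pow₀ he1
  set x := B * ε⁻¹ ^ 2 * L with hx
  have hx1 : 1 ≤ x := by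
    rw [hx]
    exact one_le_mul_of_one_le_of_one_le (one_le_mul_of_one_le_of_one_le hB1 he2) hL1
  have hT0 : 0 < outerCount B ε := Nat.ceil_pos.2 (by linarith)
  have hTx : x ≤ outerCount B ε := Nat.le_ceil _
  have hT2 : (outerCount B ε : ℝ) ≤ 2 * x := by
    have := Nat.ceil_lt_add_one (by linarith : 0 ≤ x)
    change (⌈x⌉₊ : ℝ) ≤ _
    linarith
  have hTpos : (0 : ℝ) < outerCount B ε := by exact_mod_cast hT0
  have hlogT : 1 + Real.log (outerCount B ε) ≤ (3 + Real.log (2 * B)) * L := by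
    have h1 := Real.log_le_log hTpos hT2
    have h2 : Real.log (2 * x) = Real.log (2 * B) + 2 * Real.log ε⁻¹ + Real.log L := by
      have : 2 * x = 2 * B * ε⁻¹ ^ 2 * L := by rw [hx]; ring
      rw [this, Real.log_mul (by positivity) (by positivity),
        Real.log_mul (by positivity) (by positivity), Real.log_pow]
      norm_num
    have h3 := Real.log_le_sub_one_of_pos (by linarith : 0 < L)
    nlinarith
  refine ⟨hT0, by rw [hx] at hT2; linarith, hlogT, ?_⟩
  have h1 := mul_le_mul_of_nonneg_left hlogT hA
  have h2 := mul_le_mul_of_nonneg_right hBle (by linarith : 0 ≤ L)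
  have h3 : ε ^ 2 * x = B * L := by
    rw [hx]; field_simp
  have h4 := mul_le_mul_of_nonneg_left hTx (by positivity : 0 ≤ ε ^ 2)
  linarith

/-- For μ > 0 the extra regularization is off and Λ_t is constant; for μ = 0 the modulus 1/(t+2)
enters squared. -/
theorem exists_bigLam_bound (P : Params) {γ : ℝ} (hμ : 0 ≤ P.μ) (hμX : 0 < muX P γ) :
    ∃ C : ℝ, 0 ≤ C ∧ ∀ t : ℕ, bigLam P γ (invLamSeq P t) ≤ C * ((t : ℝ) + 2) ^ 2 ∧
      (0 < P.μ → bigLam P γ (invLamSeq P t) ≤ C) := by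
  set K := 52 * max (P.Lx ^ 2) (P.Ly ^ 2) with hK
  have hK0 : 0 ≤ K := by
    have : (0 : ℝ) ≤ max (P.Lx ^ 2) (P.Ly ^ 2) := le_max_of_le_left (sq_nonneg _)
    positivity
  have hmin : 0 < min (muX P γ ^ 2) 1 := lt_min (by positivity) one_pos
  have hΛ0 : 0 ≤ bigLam P γ 0 :=
    div_nonneg hK0 (le_min (sq_nonneg _) (sq_nonneg _))
  refine ⟨bigLam P γ 0 + K / min (muX P γ ^ 2) 1, by positivity, fun t => ?_⟩
  have hs : (1 : ℝ) ≤ ((t : ℝ) + 2) ^ 2 :=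
    one_le_pow₀ (by have : (0 : ℝ) ≤ t := t.cast_nonneg; linarith)
  have hq : 0 ≤ K / min (muX P γ ^ 2) 1 := by positivity
  rcases hμ.eq_or_lt with h0 | hpos
  · refine ⟨?_, fun h => absurd h0.symm h.ne'⟩
    have hb : muY P (invLamSeq P t) = 1 / ((t : ℝ) + 2) := by
      unfold muY invLamSeq; rw [← h0]; simp
    have h1 : min (muX P γ ^ 2) 1 / ((t : ℝ) + 2) ^ 2
        ≤ min (muX P γ ^ 2) (muY P (invLamSeq P t) ^ 2) := by
      rw [hb, div_pow, one_pow]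
      refine le_min ?_ (div_le_div_of_nonneg_right (min_le_right _ _) (by positivity))
      exact (div_le_self hmin.le hs).trans (min_le_left _ _)
    have h2 : bigLam P γ (invLamSeq P t) ≤ K / (min (muX P γ ^ 2) 1 / ((t : ℝ) + 2) ^ 2) :=
      div_le_div_of_nonneg_left hK0 (by positivity) h1
    have h3 : K / (min (muX P γ ^ 2) 1 / ((t : ℝ) + 2) ^ 2)
        = K / min (muX P γ ^ 2) 1 * ((t : ℝ) + 2) ^ 2 := by field_simp
    have h4 : 0 ≤ bigLam P γ 0 * ((t : ℝ) + 2) ^ 2 := by positivity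
    linarith
  · have hb : invLamSeq P t = 0 := by unfold invLamSeq; rw [if_pos hpos]
    rw [hb]
    have h5 : bigLam P γ 0 ≤ bigLam P γ 0 + K / min (muX P γ ^ 2) 1 := by linarith
    refine ⟨h5.trans (le_mul_of_one_le_right (by positivity) hs), fun _ => h5⟩

theorem stageLen_sub_one_le {P : Params} {γ b C : ℝ} (hC : 0 ≤ C) (h : bigLam P γ b ≤ C) :
    ((stageLen P γ b - 1 : ℕ) : ℝ) ≤ 6 + 9 * C := by
  have hlog0 : 0 ≤ Real.log 4 := Real.log_nonneg (by norm_num)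
  have hlog : Real.log 4 ≤ 3 := by
    have := Real.log_le_sub_one_of_pos (by norm_num : (0 : ℝ) < 4); linarith
  have h1 : stageLen P γ b ≤ ⌈1 + (3 / 2 + 3 * C) * Real.log 4⌉₊ := by
    refine Nat.ceil_le_ceil ?_
    have := mul_le_mul_of_nonneg_right (by linarith : 3 / 2 + 3 * bigLam P γ b ≤ 3 / 2 + 3 * C) hlog0
    linarith
  have h2 := Nat.ceil_lt_add_one (by positivity : 0 ≤ 1 + (3 / 2 + 3 * C) * Real.log 4)
  have h3 : ((stageLen P γ b : ℕ) : ℝ) ≤ (⌈1 + (3 / 2 + 3 * C) * Real.log 4⌉₊ : ℝ) := by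
    exact_mod_cast h1
  have h4 : (3 / 2 + 3 * C) * Real.log 4 ≤ (3 / 2 + 3 * C) * 3 :=
    mul_le_mul_of_nonneg_left hlog (by positivity)
  rcases Nat.eq_zero_or_pos (stageLen P γ b) with h0 | h0
  · rw [h0]; simp; linarith
  · rw [Nat.cast_sub h0]; push_cast; linarith

/-- The quantity whose logarithm determines the number of stages. -/
noncomputable def stageArg (P : Params) (γ : ℝ) (t : ℕ) : ℝ :=
  ((t : ℝ) + 1) ^ 2 * (4 / (γ * muX P γ) + 1) * (1 / 4 + bigLam P γ (invLamSeq P t) / 2)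
    * (muX P γ * P.Dx ^ 2 + muY P (invLamSeq P t) * P.Dy ^ 2)

theorem stageCount_eq (P : Params) (γ c : ℝ) (t : ℕ) :
    stageCount P γ c t = max 2 ⌈1 + c * Real.log (stageArg P γ t)⌉₊ := rfl

theorem stageCount_sub_one_le {P : Params} {γ c Y : ℝ} {t : ℕ} (hY : 1 ≤ Y)
    (h : 1 + c * Real.log (stageArg P γ t) ≤ Y) : ((stageCount P γ c t - 1 : ℕ) : ℝ) ≤ Y := by
  rw [stageCount_eq, Nat.cast_sub (le_trans (by norm_num) (le_max_left 2 _)), Nat.cast_max,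
    sub_le_iff_le_add]
  refine max_le (by push_cast; linarith) ?_
  have h1 := Nat.ceil_lt_add_one (by linarith : 0 ≤ Y)
  have h2 : (⌈1 + c * Real.log (stageArg P γ t)⌉₊ : ℝ) ≤ (⌈Y⌉₊ : ℝ) := by
    exact_mod_cast Nat.ceil_le_ceil h
  push_cast
  linarith

/-- Polynomial growth is enough since only the logarithm matters: one (t+1)² is explicit, the other
comes from Λ_t. -/
theorem exists_stageArg_bound (P : Params) {γ : ℝ} (hμ : 0 ≤ P.μ) (hγ : 0 < γ)
    (hμX : 0 < muX P γ) :
    ∃ C : ℝ, 1 ≤ C ∧ ∀ t : ℕ, 0 ≤ stageArg P γ t ∧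
      stageArg P γ t ≤ C * ((t : ℝ) + 1) ^ 4 := by
  obtain ⟨CΛ, hCΛ, hΛ⟩ := exists_bigLam_bound P hμ hμX
  obtain ⟨G, hG⟩ : ∃ G, G = 4 / (γ * muX P γ) + 1 := ⟨_, rfl⟩
  have hG0 : 0 < G := by rw [hG]; positivity
  obtain ⟨S, hS⟩ : ∃ S, S = muX P γ * P.Dx ^ 2 + (P.μ + 1) * P.Dy ^ 2 := ⟨_, rfl⟩
  have hS0 : 0 ≤ S := by rw [hS]; positivity
  have hCA0 : 0 ≤ G * (1 / 4 + 2 * CΛ) * S := by positivity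
  refine ⟨1 + G * (1 / 4 + 2 * CΛ) * S, by linarith, fun t => ?_⟩
  have ht : (0 : ℝ) ≤ t := t.cast_nonneg
  have hΛ0 : 0 ≤ bigLam P γ (invLamSeq P t) := by
    have : (0 : ℝ) ≤ max (P.Lx ^ 2) (P.Ly ^ 2) := le_max_of_le_left (sq_nonneg _)
    exact div_nonneg (by positivity) (le_min (sq_nonneg _) (sq_nonneg _))
  have hμY0 := (muY_invLamSeq_pos hμ t).le
  have h1 : bigLam P γ (invLamSeq P t) ≤ CΛ * (4 * ((t : ℝ) + 1) ^ 2) :=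
    (hΛ t).1.trans (mul_le_mul_of_nonneg_left (by nlinarith) hCΛ)
  have h2 : 1 / 4 + bigLam P γ (invLamSeq P t) / 2
      ≤ (1 / 4 + 2 * CΛ) * ((t : ℝ) + 1) ^ 2 := by nlinarith
  have h3 : muY P (invLamSeq P t) ≤ P.μ + 1 := by
    have h4 := invLamSeq_le P t
    have h5 : 1 / ((t : ℝ) + 2) ≤ 1 := by rw [div_le_one (by positivity)]; linarith
    unfold muY; linarith
  have h6 : muX P γ * P.Dx ^ 2 + muY P (invLamSeq P t) * P.Dy ^ 2 ≤ S := by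
    have := mul_le_mul_of_nonneg_right h3 (sq_nonneg P.Dy)
    rw [hS]; linarith
  have e : stageArg P γ t = ((t : ℝ) + 1) ^ 2 * G * (1 / 4 + bigLam P γ (invLamSeq P t) / 2)
      * (muX P γ * P.Dx ^ 2 + muY P (invLamSeq P t) * P.Dy ^ 2) := by rw [hG]; rfl
  rw [e]
  refine ⟨by positivity, ?_⟩
  calc _ ≤ ((t : ℝ) + 1) ^ 2 * G * ((1 / 4 + 2 * CΛ) * ((t : ℝ) + 1) ^ 2) * S :=
        mul_le_mul (mul_le_mul_of_nonneg_left h2 (by positivity)) h6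
          (by positivity) (by positivity)
    _ = G * (1 / 4 + 2 * CΛ) * S * ((t : ℝ) + 1) ^ 4 := by ring
    _ ≤ _ := mul_le_mul_of_nonneg_right (by linarith) (by positivity)

theorem exists_stageCount_bound (P : Params) {γ c : ℝ} (hμ : 0 ≤ P.μ) (hγ : 0 < γ)
    (hμX : 0 < muX P γ) (hc : 0 ≤ c) :
    ∃ C : ℝ, 1 ≤ C ∧ ∀ t : ℕ, ((stageCount P γ c t - 1 : ℕ) : ℝ)
      ≤ C * (1 + Real.log ((t : ℝ) + 1)) := by
  obtain ⟨CA, hCA1, hCA⟩ := exists_stageArg_bound P hμ hγ hμX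
  have hlogCA : 0 ≤ Real.log CA := Real.log_nonneg hCA1
  refine ⟨1 + c * (Real.log CA + 4), ?_, fun t => ?_⟩
  · have : 0 ≤ c * (Real.log CA + 4) := by positivity
    linarith
  have ht : (0 : ℝ) ≤ t := t.cast_nonneg
  have hlogt : 0 ≤ Real.log ((t : ℝ) + 1) := Real.log_nonneg (by linarith)
  have hlogA : Real.log (stageArg P γ t) ≤ Real.log CA + 4 * Real.log ((t : ℝ) + 1) := by
    rcases (hCA t).1.eq_or_lt with h | h
    · rw [← h, Real.log_zero]; positivity
    · have := Real.log_le_log h (hCA t).2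
      rw [Real.log_mul (zero_lt_one.trans_le hCA1).ne' (by positivity), Real.log_pow] at this
      exact_mod_cast this
  have h7 : 0 ≤ c * Real.log CA * Real.log ((t : ℝ) + 1) := by positivity
  have h8 := mul_le_mul_of_nonneg_left hlogA hc
  have h9 : 0 ≤ c * (Real.log CA + 4 * Real.log ((t : ℝ) + 1)) := by positivity
  refine (stageCount_sub_one_le (by linarith) (by linarith :
    1 + c * Real.log (stageArg P γ t)
      ≤ 1 + c * (Real.log CA + 4 * Real.log ((t : ℝ) + 1)))).trans ?_
  linarith

end Complexity

end PGSVRG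

namespace PGSVRG

/-! ### Total cost, law of the output and conclusion. -/

section Main

theorem exists_cost_bound (P : Params) {γ c B CL : ℝ} (hμ : 0 ≤ P.μ) (hγ : 0 < γ)
    (hμX : 0 < muX P γ) (hc : 0 ≤ c) (hB : 1 ≤ B) (hCL : 1 ≤ CL) :
    ∃ C : ℝ, 2 * B ≤ C ∧ ∀ (T n : ℕ) (e ℓ : ℝ), 0 < T → 0 < n → 1 ≤ e → 1 ≤ ℓ →
      (T : ℝ) ≤ 2 * B * e ^ 2 * ℓ → 1 + Real.log T ≤ CL * ℓ →
      (0 < P.μ → ((∑ s ∈ Finset.range (T - 1),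
        (stageCount P γ c s - 1) * (n + (stageLen P γ (invLamSeq P s) - 1)) : ℕ) : ℝ)
          ≤ C * (n * e ^ 2) * ℓ ^ 4) ∧
      ((∑ s ∈ Finset.range (T - 1),
        (stageCount P γ c s - 1) * (n + (stageLen P γ (invLamSeq P s) - 1)) : ℕ) : ℝ)
          ≤ C * (n * e ^ 2 + e ^ 6) * ℓ ^ 4 := by
  obtain ⟨CK, hCK, hK⟩ := exists_stageCount_bound P hμ hγ hμX hc
  obtain ⟨CΛ, hCΛ, hΛ⟩ := exists_bigLam_bound P hμ hμX
  obtain ⟨CJ, hCJ⟩ : ∃ CJ, CJ = 6 + 9 * CΛ := ⟨_, rfl⟩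
  have hCJ0 : 0 ≤ CJ := by rw [hCJ]; positivity
  obtain ⟨a, ha⟩ : ∃ a, a = 2 * B * CK * CL := ⟨_, rfl⟩
  have ha0 : 0 ≤ a := by rw [ha]; positivity
  have h1 : 0 ≤ a * CJ := by positivity
  have h2 : 0 ≤ 4 * B ^ 2 * a * CJ := by positivity
  refine ⟨2 * B + a + a * CJ + 4 * B ^ 2 * a * CJ, by linarith, ?_⟩
  intro T n e ℓ hT hn he hℓ hTle hlog
  have hn1 : (1 : ℝ) ≤ n := by exact_mod_cast hn
  have hT1 : (1 : ℝ) ≤ T := by exact_mod_cast hT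
  have hterm : ∀ J : ℝ, 0 ≤ J →
      (∀ s < T - 1, ((stageLen P γ (invLamSeq P s) - 1 : ℕ) : ℝ) ≤ J) →
      ((∑ s ∈ Finset.range (T - 1),
        (stageCount P γ c s - 1) * (n + (stageLen P γ (invLamSeq P s) - 1)) : ℕ) : ℝ)
          ≤ a * e ^ 2 * ℓ ^ 2 * (n + J) := by
    intro J hJ0 hJ
    rw [Nat.cast_sum]
    have hsum := Finset.sum_le_card_nsmul (Finset.range (T - 1))
      (fun s => (((stageCount P γ c s - 1) * (n + (stageLen P γ (invLamSeq P s) - 1)) : ℕ) : ℝ))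
      (CK * (CL * ℓ) * (n + J)) (fun s hs => by
        have hs' := Finset.mem_range.1 hs
        rw [Nat.cast_mul, Nat.cast_add]
        have hsT : (s : ℝ) + 1 ≤ T := by exact_mod_cast (by omega : s + 1 ≤ T)
        have hs0 : (0 : ℝ) ≤ s := s.cast_nonneg
        have hl := Real.log_le_log (by linarith) hsT
        refine mul_le_mul ((hK s).trans (mul_le_mul_of_nonneg_left (by linarith) (by linarith)))
          (by linarith [hJ s hs']) (by positivity) (by positivity))
    refine hsum.trans ?_
    rw [Finset.card_range, nsmul_eq_mul]
    have hT' : ((T - 1 : ℕ) : ℝ) ≤ 2 * B * e ^ 2 * ℓ :=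
      le_trans (by exact_mod_cast Nat.sub_le T 1) hTle
    refine (mul_le_mul_of_nonneg_right hT' (by positivity)).trans (le_of_eq ?_)
    rw [ha]; ring
  have hℓ24 : ℓ ^ 2 ≤ ℓ ^ 4 := pow_le_pow_right₀ hℓ (by norm_num)
  refine ⟨fun hpos => ?_, ?_⟩
  · refine (hterm CJ hCJ0 fun s _ => ?_).trans ?_
    · rw [hCJ]; exact stageLen_sub_one_le hCΛ ((hΛ s).2 hpos)
    · calc a * e ^ 2 * ℓ ^ 2 * (n + CJ) ≤ a * e ^ 2 * ℓ ^ 4 * (n + CJ * n) := by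
            refine mul_le_mul (mul_le_mul_of_nonneg_left hℓ24 (by positivity)) ?_
              (by positivity) (by positivity)
            have := le_mul_of_one_le_right hCJ0 hn1
            linarith
        _ = (a + a * CJ) * (n * e ^ 2) * ℓ ^ 4 := by ring
        _ ≤ _ := by
          refine mul_le_mul_of_nonneg_right (mul_le_mul_of_nonneg_right ?_ (by positivity))
            (by positivity)
          linarith
  · refine (hterm (CJ * (2 * B * e ^ 2 * ℓ) ^ 2) (by positivity) fun s hs => ?_).trans ?_
    · refine (stageLen_sub_one_le (by positivity) (hΛ s).1).trans ?_
      -- Calls run over s ≤ T − 2, so the quadratic growth of Λ_s is bounded by T² itself.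
      have hsT : (s : ℝ) + 2 ≤ T := by exact_mod_cast (by omega : s + 2 ≤ T)
      have hs0 : (0 : ℝ) ≤ s := s.cast_nonneg
      have h3 : ((s : ℝ) + 2) ^ 2 ≤ (2 * B * e ^ 2 * ℓ) ^ 2 :=
        pow_le_pow_left₀ (by linarith) (hsT.trans hTle) 2
      have h4 : 1 ≤ (2 * B * e ^ 2 * ℓ) ^ 2 := one_le_pow₀ (hT1.trans hTle)
      have h5 := mul_le_mul_of_nonneg_left h3 hCΛ
      rw [hCJ]
      linarith
    · have h6 : a * e ^ 2 * ℓ ^ 2 * n ≤ a * e ^ 2 * ℓ ^ 4 * n :=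
        mul_le_mul_of_nonneg_right (mul_le_mul_of_nonneg_left hℓ24 (by positivity))
          (by positivity)
      calc a * e ^ 2 * ℓ ^ 2 * (n + CJ * (2 * B * e ^ 2 * ℓ) ^ 2)
          = a * e ^ 2 * ℓ ^ 2 * n + 4 * B ^ 2 * a * CJ * e ^ 6 * ℓ ^ 4 := by ring
        _ ≤ a * (n * e ^ 2) * ℓ ^ 4 + 4 * B ^ 2 * a * CJ * e ^ 6 * ℓ ^ 4 := by linarith
        _ ≤ _ := by
          have h7 : 0 ≤ (2 * B + a * CJ + 4 * B ^ 2 * a * CJ) * (n * e ^ 2) * ℓ ^ 4 := by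
            positivity
          have h8 : 0 ≤ (2 * B + a + a * CJ) * e ^ 6 * ℓ ^ 4 := by positivity
          linarith

/-- A finite set containing every index that the first `T` outer iterations use. -/
noncomputable def indexSet (P : Params) (γ c : ℝ) (T : ℕ) : Finset (ℕ × ℕ × ℕ) :=
  let N := ∑ t ∈ Finset.range T, (stageCount P γ c t + stageLen P γ (invLamSeq P t))
  Finset.range T ×ˢ Finset.range N ×ˢ Finset.range N

theorem mem_indexSet {P : Params} {γ c : ℝ} {T t k j : ℕ} (ht : t < T)
    (hk : k < stageCount P γ c t - 1) (hj : j < stageLen P γ (invLamSeq P t) - 1) :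
    (t, k, j) ∈ indexSet P γ c T := by
  have h := Finset.single_le_sum (f := fun t => stageCount P γ c t + stageLen P γ (invLamSeq P t))
    (fun _ _ => Nat.zero_le _) (Finset.mem_range.2 ht)
  simp only [indexSet, Finset.mem_product, Finset.mem_range]
  omega

theorem extendIdx_apply {n : ℕ} {I : Finset (ℕ × ℕ × ℕ)} (l0 : Fin n) (l : ℕ × ℕ × ℕ → Fin n)
    {i : ℕ × ℕ × ℕ} (hi : i ∈ I) : extendIdx I l0 (fun i : I => l i) i = l i := by
  simp [extendIdx, hi]

/-- All atoms have the same weight, and n^|I| is the number of index families, so the integral is a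
mean over times of finite averages. -/
theorem sum_ofReal_uniform {n T : ℕ} (hn : 0 < n) (hT : 0 < T) (I : Finset (ℕ × ℕ × ℕ))
    (l0 : Fin n) (H : ℕ → (ℕ × ℕ × ℕ → Fin n) → ℝ) (hH : ∀ t l, 0 ≤ H t l) :
    ∑ s : Fin T, ∑ v : I → Fin n, ENNReal.ofReal (H s (extendIdx I l0 v))
        * ((T : ℝ≥0∞)⁻¹ * (n : ℝ≥0∞)⁻¹ ^ I.card)
      = ENNReal.ofReal ((T : ℝ)⁻¹ * ∑ t ∈ Finset.range T, finAvg I l0 (H t)) := by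
  have hT' : (0 : ℝ) < T := by exact_mod_cast hT
  have hn' : (0 : ℝ) < n := by exact_mod_cast hn
  have e1 : (T : ℝ≥0∞)⁻¹ * (n : ℝ≥0∞)⁻¹ ^ I.card
      = ENNReal.ofReal ((T : ℝ)⁻¹ * (n : ℝ)⁻¹ ^ I.card) := by
    rw [ENNReal.ofReal_mul (by positivity), ENNReal.ofReal_pow (by positivity),
      ENNReal.ofReal_inv_of_pos hT', ENNReal.ofReal_inv_of_pos hn', ENNReal.ofReal_natCast,
      ENNReal.ofReal_natCast]
  rw [e1]
  simp_rw [← ENNReal.ofReal_mul (hH _ _)]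
  have hnn : ∀ s v, 0 ≤ H s (extendIdx I l0 v) * ((T : ℝ)⁻¹ * (n : ℝ)⁻¹ ^ I.card) :=
    fun s v => mul_nonneg (hH _ _) (by positivity)
  have e2 : ∀ s : Fin T, ∑ v : I → Fin n,
      ENNReal.ofReal (H s (extendIdx I l0 v) * ((T : ℝ)⁻¹ * (n : ℝ)⁻¹ ^ I.card))
      = ENNReal.ofReal ((T : ℝ)⁻¹ * finAvg I l0 (H s)) := fun s => by
    rw [← ENNReal.ofReal_sum_of_nonneg fun v _ => hnn s v]
    congr 1
    unfold finAvg
    rw [← Finset.sum_mul, Fintype.card_fun, Fintype.card_fin, Fintype.card_coe, Nat.cast_pow,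
      inv_pow, div_eq_mul_inv]
    ring
  have havg : ∀ t, 0 ≤ finAvg I l0 (H t) := fun t =>
    div_nonneg (Finset.sum_nonneg fun v _ => hH _ _) (Nat.cast_nonneg _)
  simp_rw [e2]
  rw [← ENNReal.ofReal_sum_of_nonneg (f := fun s : Fin T => (T : ℝ)⁻¹ * finAvg I l0 (H s))
    fun s _ => mul_nonneg (by positivity) (havg s), ← Finset.mul_sum, Finset.sum_range]

variable {E F : Type*} [NormedAddCommGroup E] [InnerProductSpace ℝ E]
  [NormedAddCommGroup F] [NormedSpace ℝ F] {n : ℕ} {D : Problem E F n} {P : Params}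
  {γ c : ℝ} {x0 : E} [FiniteDimensional ℝ E] [FiniteDimensional ℝ F]

/-- The infimum of `ψ` as a real number. -/
theorem Problem.Assumptions.exists_inf_bound (hA : D.Assumptions P) (hx0 : x0 ∈ D.X) {Δ : ℝ}
    (h : D.ψ x0 ≤ (⨅ x, D.ψ x) + (Δ : EReal)) :
    ∃ w : ℝ, (∀ z ∈ D.X, w ≤ (D.ψ z).toReal) ∧ (D.ψ x0).toReal ≤ w + Δ := by
  have htop : (⨅ x, D.ψ x) ≠ ⊤ := fun h' => by
    have h1 := iInf_le D.ψ x0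
    rw [h', ← hA.coe_ψ hx0] at h1
    exact EReal.coe_ne_top _ (top_le_iff.1 h1)
  have hw : (((⨅ x, D.ψ x).toReal : ℝ) : EReal) = ⨅ x, D.ψ x :=
    EReal.coe_toReal htop hA.ψ_bddBelow.ne'
  refine ⟨(⨅ x, D.ψ x).toReal, fun z hz => ?_, ?_⟩
  · rw [← EReal.coe_le_coe_iff, hw, hA.coe_ψ hz]
    exact iInf_le _ z
  · rw [← EReal.coe_le_coe_iff, EReal.coe_add, hw, hA.coe_ψ hx0]
    exact h

/-- The mean squared residual of the random output. -/
theorem Problem.Assumptions.lintegral_residual_le (hA : D.Assumptions P) (hn : 0 < n) (hγ : 0 < γ)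
    (hμX : 0 < muX P γ) (hμ : 0 ≤ P.μ) (hLx : 0 ≤ P.Lx)
    (hLy : 0 ≤ P.Ly) (hL : 0 < max P.Lx P.Ly) (hc : 4 / 3 ≤ c) (hx0 : x0 ∈ D.X) {Δ : ℝ}
    (hΔ : D.ψ x0 ≤ (⨅ x, D.ψ x) + (Δ : EReal)) {Ω : Type*} [MeasurableSpace Ω] {Pr : Measure Ω}
    [IsProbabilityMeasure Pr] {T : ℕ} (hT : 0 < T) {l : ℕ × ℕ × ℕ → Ω → Fin n} {τ : Ω → Fin T}
    (hl : ∀ i, Measurable (l i)) (hτ : Measurable τ) (hind : iIndepFun l Pr)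
    (hτl : IndepFun τ (fun ω i => l i ω) Pr) (hlu : ∀ i b, Pr {ω | l i ω = b} = (n : ℝ≥0∞)⁻¹)
    (hτu : ∀ s, Pr {ω | τ ω = s} = (T : ℝ≥0∞)⁻¹) :
    ∫⁻ ω, edist (D.prox γ (pgsvrg D P γ c x0 (fun i => l i ω) (τ ω)).1)
        (pgsvrg D P γ c x0 (fun i => l i ω) (τ ω)).1 ^ 2 ∂Pr
      ≤ ENNReal.ofReal ((T : ℝ)⁻¹ * (2 / muX P γ
        * ((|Δ| + 18 + P.Dy ^ 2 / 2) * (1 + Real.log T)))) := by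
  obtain ⟨w, hw, hwΔ⟩ := hA.exists_inf_bound hx0 hΔ
  let l0 : Fin n := ⟨0, hn⟩
  let I := indexSet P γ c T
  let H : ℕ → (ℕ × ℕ × ℕ → Fin n) → ℝ := fun t l =>
    ‖D.prox γ (pgsvrg D P γ c x0 l t).1 - (pgsvrg D P γ c x0 l t).1‖ ^ 2
  have hH : ∀ t l, 0 ≤ H t l := fun t l => sq_nonneg _
  have e1 : ∀ ω, edist (D.prox γ (pgsvrg D P γ c x0 (fun i => l i ω) (τ ω)).1)
      (pgsvrg D P γ c x0 (fun i => l i ω) (τ ω)).1 ^ 2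
      = ENNReal.ofReal (H (τ ω) (extendIdx I l0 fun i : I => l i ω)) := fun ω => by
    -- Replacing the indices outside the finite set leaves the iterate unchanged, so the integrand
    -- is a function of finitely many discrete variables.
    have e : pgsvrg D P γ c x0 (fun i => l i ω) (τ ω)
        = pgsvrg D P γ c x0 (extendIdx I l0 fun i : I => l i ω) (τ ω) :=
      pgsvrg_congr fun s hs k hk j hj =>
        (extendIdx_apply l0 (fun i => l i ω) (mem_indexSet (hs.trans (τ ω).2) hk hj)).symm
    rw [e, edist_dist, dist_eq_norm, ← ENNReal.ofReal_pow (norm_nonneg _)]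
  simp_rw [e1]
  rw [lintegral_eq_sum hl hτ hind hτl hlu hτu I
    (fun s v => ENNReal.ofReal (H s (extendIdx I l0 v))), sum_ofReal_uniform hn hT I l0 H hH]
  refine ENNReal.ofReal_le_ofReal (mul_le_mul_of_nonneg_left ?_ (by positivity))
  have h := (finAvg_isExp hn I l0).sum_residual_le hA hn hγ hμX hμ hLx hLy hL hc hx0 hw hwΔ
    (m := T - 1) fun t ht k hk j hj => Finset.mem_coe.2 (mem_indexSet (by omega) hk hj)
  have e2 : ((T - 1 : ℕ) : ℝ) + 1 = T := by exact_mod_cast Nat.sub_add_cancel hT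
  rw [Nat.sub_add_cancel hT, e2] at h
  rw [div_mul_eq_mul_div, le_div_iff₀ hμX]
  change muX P γ / 2 * ∑ t ∈ Finset.range T, finAvg I l0 (H t) ≤ _ at h
  linarith

theorem Problem.Assumptions.lintegral_infEDist_le (hA : D.Assumptions P) (hγ : 0 < γ)
    (hμX : 0 ≤ muX P γ) {Ω : Type*} [MeasurableSpace Ω] (Pr : Measure Ω) (x : Ω → E) :
    ∫⁻ ω, Metric.infEDist 0 (subdiff D.ψ (D.prox γ (x ω))) ^ 2 ∂Pr
      ≤ ENNReal.ofReal (1 / γ ^ 2) * ∫⁻ ω, edist (D.prox γ (x ω)) (x ω) ^ 2 ∂Pr := by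
  rw [← lintegral_const_mul' _ _ ENNReal.ofReal_ne_top]
  refine lintegral_mono fun ω => ?_
  have h := pow_le_pow_left' (hA.infEDist_subdiff_le hγ hμX (x ω)) 2
  rwa [mul_pow, ← ENNReal.ofReal_pow (by positivity), div_pow, one_pow] at h

end Main

end PGSVRG

theorem theorem2
    -- the constants of the problem class; `Δ` bounds the initial gap `ψ(x̄⁽⁰⁾) - ψ*`
    (P : Params) (hρ : 0 < P.ρ) (hμ : 0 ≤ P.μ) (hLx : 0 ≤ P.Lx) (hLy : 0 ≤ P.Ly)
    (hL : 0 < max P.Lx P.Ly) (Δ : ℝ) (c : ℝ) (hc : 4 / 3 ≤ c) (γ : ℝ) (hγ : γ = 1 / (2 * P.ρ)) :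
    ∃ (C : ℝ) (a : ℕ), ∀ ε : ℝ, 0 < ε → ε ≤ 1 → ∃ T : ℕ, 0 < T ∧
      -- the number of outer iterations is `Õ(ε⁻²)`
      (T : ℝ) ≤ C * ε⁻¹ ^ 2 * (1 + Real.log ε⁻¹) ^ a ∧
      ∀ (p : ℕ) (F : Type u) [NormedAddCommGroup F] [NormedSpace ℝ F] [FiniteDimensional ℝ F]
        (n : ℕ) (D : Problem (EuclideanSpace ℝ (Fin p)) F n) (x0 : EuclideanSpace ℝ (Fin p)),
        0 < n → D.Assumptions P → x0 ∈ D.X → D.ψ x0 ≤ (⨅ x, D.ψ x) + (Δ : EReal) →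
        -- the total gradient complexity
        (∀ l : ℕ × ℕ × ℕ → Fin n,
          (0 < P.μ → ((pgsvrg D P γ c x0 l (T - 1)).2 : ℝ) ≤
            C * (n * ε⁻¹ ^ 2) * (1 + Real.log ε⁻¹) ^ a) ∧
          (P.μ = 0 → ((pgsvrg D P γ c x0 l (T - 1)).2 : ℝ) ≤
            C * (n * ε⁻¹ ^ 2 + ε⁻¹ ^ 6) * (1 + Real.log ε⁻¹) ^ a)) ∧
        -- near stationarity of the random output `x̄⁽τ⁾`
        ∀ (Ω : Type v) [MeasurableSpace Ω] (Pr : Measure Ω) [IsProbabilityMeasure Pr]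
          (l : ℕ × ℕ × ℕ → Ω → Fin n) (τ : Ω → Fin T),
          (∀ i, Measurable (l i)) → Measurable τ →
          iIndepFun l Pr → IndepFun τ (fun ω i => l i ω) Pr →
          (∀ i b, Pr {ω | l i ω = b} = (n : ℝ≥0∞)⁻¹) → (∀ s, Pr {ω | τ ω = s} = (T : ℝ≥0∞)⁻¹) →
          let xbar : Ω → EuclideanSpace ℝ (Fin p) :=
            fun ω => (pgsvrg D P γ c x0 (fun i => l i ω) (τ ω)).1
          ∫⁻ ω, Metric.infEDist 0 (subdiff D.ψ (D.prox γ (xbar ω))) ^ 2 ∂Pr ≤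
              ENNReal.ofReal (1 / γ ^ 2) * ∫⁻ ω, edist (D.prox γ (xbar ω)) (xbar ω) ^ 2 ∂Pr ∧
          ENNReal.ofReal (1 / γ ^ 2) * ∫⁻ ω, edist (D.prox γ (xbar ω)) (xbar ω) ^ 2 ∂Pr ≤
              ENNReal.ofReal (ε ^ 2) := by
  have hγ0 : 0 < γ := by rw [hγ]; positivity
  have hγρ : 1 / γ = 2 * P.ρ := by rw [hγ, one_div_one_div]
  have hmuX : muX P γ = P.ρ := by unfold muX; rw [hγρ]; ring
  have hμX : 0 < muX P γ := by rw [hmuX]; exact hρ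
  obtain ⟨M, hM⟩ : ∃ M, M = |Δ| + 18 + P.Dy ^ 2 / 2 := ⟨_, rfl⟩
  have hM0 : 0 ≤ M := by rw [hM]; positivity
  -- The factor 8ρ is (1/γ²)(2/μ_x) = 4ρ² · 2/ρ.
  obtain ⟨B, CL, hB, hCL, hT⟩ := exists_outerCount (by positivity : 0 ≤ 8 * P.ρ * M)
  obtain ⟨C, hBC, hC⟩ := exists_cost_bound P hμ hγ0 hμX (by linarith : 0 ≤ c) hB hCL
  -- Exponent 4: one logarithm from T, one from k_t, and two more from the T² in the stage length
  -- when μ = 0.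
  refine ⟨C, 4, fun ε hε hε1 => ?_⟩
  obtain ⟨hT0, hTle, hTlog, hTε⟩ := hT ε hε hε1
  have he1 : 1 ≤ ε⁻¹ := (one_le_inv₀ hε).2 hε1
  have hℓ : 1 ≤ 1 + Real.log ε⁻¹ := by linarith [Real.log_nonneg he1]
  refine ⟨outerCount B ε, hT0, ?_, ?_⟩
  · refine hTle.trans (mul_le_mul (mul_le_mul_of_nonneg_right hBC (by positivity))
      (le_self_pow₀ hℓ (by norm_num)) (by linarith)
      (mul_nonneg (by linarith) (by positivity)))
  intro p F _ _ _ n D x0 hn hA hx0 hΔ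
  refine ⟨fun l => ?_, ?_⟩
  · rw [pgsvrg_cost]
    obtain ⟨h1, h2⟩ := hC (outerCount B ε) n ε⁻¹ _ hT0 hn he1 hℓ hTle hTlog
    exact ⟨h1, fun _ => h2⟩
  intro Ω _ Pr _ l τ hl hτ hind hτl hlu hτu xbar
  refine ⟨hA.lintegral_infEDist_le hγ0 hμX.le Pr xbar, ?_⟩
  have h := hA.lintegral_residual_le hn hγ0 hμX hμ hLx hLy hL hc hx0 hΔ hT0 hl hτ hind hτl hlu hτu
  refine (mul_le_mul_right h _).trans ?_
  rw [← ENNReal.ofReal_mul (by positivity), ← hM]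
  refine ENNReal.ofReal_le_ofReal ?_
  have hTpos : (0 : ℝ) < outerCount B ε := by exact_mod_cast hT0
  have e : 1 / γ ^ 2 = 4 * P.ρ ^ 2 := by
    rw [← one_div_pow, hγρ]; ring
  rw [e, hmuX]
  calc 4 * P.ρ ^ 2 * ((outerCount B ε : ℝ)⁻¹ * (2 / P.ρ * (M * (1 + Real.log (outerCount B ε)))))
      = 8 * P.ρ * M * (1 + Real.log (outerCount B ε)) / outerCount B ε := by
        field_simp; ring
    _ ≤ ε ^ 2 := by rw [div_le_iff₀ hTpos]; exact hTε
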